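/- Let $\Omega=(0,1)^2$ and let $a=(a_{ij})_{2\times2}$ be a symmetric, uniformly bounded and uniformly positive definite coefficient tensor on $\Omega$ (not necessarily diagonal). Fix a stabilization parameter $\rho>0$ and a shape-regularity constant $\kappa>0$. Let ${\mathcal T}_h=\Delta_x\times\Delta_y$ be a partition of $\Omega$ into rectangles, the Cartesian product of a partition $0=x_0<\dots<x_n=1$ and a partition $0=y_0<\dots<y_m=1$; let $h_T$ be the diameter of $T\in{\mathcal T}_h$ and $h=\max_T h_T$. Assume that every edge of every $T\in{\mathcal T}_h$ has length at least $\kappa h_T$, and that $a$ is constant in each $T\in{\mathcal T}_h$. Let $V_h$ be the space of $v=\{v_0,v_b\}$ with $v_0|_T\in P_1(T)$ for each $T$ and $v_b$ a constant (single-valued) on each edge; let $V_h^0=\{v\in V_h: v_b|_{\partial\Omega}=0\}$; let $\nabla_d v|_T\in[P_0(T)]^2$ be the discrete weak gradient, determined by $(\nabla_d v,\psi)_T=-(v_0,\nabla\cdot\psi)_T+\langle v_b,\psi\cdot{\bf n}\rangle_{\partial T}$ for all $\psi\in[P_0(T)]^2$; and let $Q_b$ be the $L^2$ projection onto constants on each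 edge. Let $u\in H^3(\Omega)$ be the exact solution of $-\nabla\cdot(a\nabla u)=f$ in $\Omega$, $u=g$ on $\partial\Omega$, with $f\in L^2(\Omega)$, and let $u_h=\{u_0,u_b\}\in V_h$ be the weak Galerkin approximation with Dirichlet data $Q_bg$, that is, $u_b=Q_bg$ on $\partial\Omega$ and $$\sum_{T}(a\nabla_du_h,\nabla_dv)_T+\rho h^{-1}\sum_T\langle u_b-Q_bu_0,\,v_b-Q_bv_0\rangle_{\partial T}=(f,v_0)\qquad\forall v\in V_h^0.$$ Then the error $e_b=Q_bu-u_b$ satisfies $$\Big(\sum_{T\in{\mathcal T}_h}\|\nabla_de_b\|_T^2\Big)^{1/2}\le C\,h^{1.5}\big(\|u\|_3+\|\nabla^2u\|_{0,\partial\Omega}\big),$$ where the constant $C$ depends only on $a$, $\rho$ and $\kappa$, and not on the partition, $h$, $f$, $g$ or $u$. Here $\|\cdot\|_3$ is the norm of $H^3(\Omega)$ and $\|\nabla^2u\|_{0,\partial\Omega}$ is the $L^2(\partial\Omega)$ norm of the trace of the Hessian of $u$. -/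

import Mathlib

open MeasureTheory Set
open scoped ContDiff

noncomputable section

namespace WG

/-! ### Sobolev spaces on plane domains -/

/-- The classical partial derivative `∂φ/∂x`. -/
def dx (φ : ℝ × ℝ → ℝ) : ℝ × ℝ → ℝ := fun p => fderiv ℝ φ p (1, 0)

/-- The classical partial derivative `∂φ/∂y`. -/
def dy (φ : ℝ × ℝ → ℝ) : ℝ × ℝ → ℝ := fun p => fderiv ℝ φ p (0, 1)

/-- Test functions: elements of `C_c^∞(U)`. -/
def IsTest (U : Set (ℝ × ℝ)) (φ : ℝ × ℝ → ℝ) : Prop :=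
  ContDiff ℝ ∞ φ ∧ HasCompactSupport φ ∧ tsupport φ ⊆ U

/-- `d ∈ L²(U)` is the weak partial derivative `∂^{i+j} u / ∂x^i ∂y^j` of `u` in `U`. -/
def HasWeakDeriv (U : Set (ℝ × ℝ)) (i j : ℕ) (u d : ℝ × ℝ → ℝ) : Prop :=
  MemLp d 2 (volume.restrict U) ∧
    ∀ φ, IsTest U φ →
      ∫ p in U, u p * (dx^[i] (dy^[j] φ)) p = (-1) ^ (i + j) * ∫ p in U, d p * φ p

/-- `u ∈ H^k(U)`: `u` is square integrable with square integrable weak partial derivatives up to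
order `k`. -/
def MemSobolev (U : Set (ℝ × ℝ)) (k : ℕ) (u : ℝ × ℝ → ℝ) : Prop :=
  MemLp u 2 (volume.restrict U) ∧ ∀ i j, i + j ≤ k → ∃ d, HasWeakDeriv U i j u d

open Classical in
/-- The square integrable weak partial derivative `∂^{i+j} u / ∂x^i ∂y^j` (unique almost
everywhere); the value `0` is only used when there is none. -/
def weakDeriv (U : Set (ℝ × ℝ)) (i j : ℕ) (u : ℝ × ℝ → ℝ) : ℝ × ℝ → ℝ :=
  if h : ∃ d, HasWeakDeriv U i j u d then h.choose else 0

/-- The norm `‖u‖_{k,U}` of `H^k(U)`. -/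
def sobolevNorm (U : Set (ℝ × ℝ)) (k : ℕ) (u : ℝ × ℝ → ℝ) : ℝ :=
  Real.sqrt (∑ i ∈ Finset.range (k + 1), ∑ j ∈ Finset.range (k + 1 - i),
    ∫ p in U, (weakDeriv U i j u p) ^ 2)

/-- The open rectangle `(x₀, x₁) × (y₀, y₁)`. -/
def rect (x₀ x₁ y₀ y₁ : ℝ) : Set (ℝ × ℝ) := Ioo x₀ x₁ ×ˢ Ioo y₀ y₁

/-- The function `w`, which has the weak gradient `(wx, wy)`, has the boundary trace `τ` on the
boundary of the rectangle `R = (x₀, x₁) × (y₀, y₁)`: `τ` is square integrable on the four sides,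
and Green's formula `∫_R (∂ᵢw φ + w ∂ᵢφ) = ∫_{∂R} τ φ nᵢ` holds for all smooth `φ` and `i = 1, 2`.
Only the values of `τ` on `∂R` matter, and they are determined almost everywhere. -/
def IsTrace (x₀ x₁ y₀ y₁ : ℝ) (w wx wy τ : ℝ × ℝ → ℝ) : Prop :=
  (∀ x ∈ ({x₀, x₁} : Set ℝ), MemLp (fun y => τ (x, y)) 2 (volume.restrict (Icc y₀ y₁))) ∧
  (∀ y ∈ ({y₀, y₁} : Set ℝ), MemLp (fun x => τ (x, y)) 2 (volume.restrict (Icc x₀ x₁))) ∧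
  ∀ φ : ℝ × ℝ → ℝ, ContDiff ℝ ∞ φ →
    (∫ p in rect x₀ x₁ y₀ y₁, (wx p * φ p + w p * dx φ p) =
      (∫ y in y₀..y₁, τ (x₁, y) * φ (x₁, y)) - ∫ y in y₀..y₁, τ (x₀, y) * φ (x₀, y)) ∧
    (∫ p in rect x₀ x₁ y₀ y₁, (wy p * φ p + w p * dy φ p) =
      (∫ x in x₀..x₁, τ (x, y₁) * φ (x, y₁)) - ∫ x in x₀..x₁, τ (x, y₀) * φ (x, y₀))

/-! ### The model problem on the unit square -/

/-- The domain `Ω = (0,1)²`. -/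
def Ω : Set (ℝ × ℝ) := rect 0 1 0 1

/-- `τ` is the trace of `w ∈ H¹(Ω)` on `∂Ω`; here `w = ∂^{i+j} u / ∂x^i ∂y^j`. -/
def IsBoundaryTrace (i j : ℕ) (u τ : ℝ × ℝ → ℝ) : Prop :=
  IsTrace 0 1 0 1 (weakDeriv Ω i j u) (weakDeriv Ω (i + 1) j u) (weakDeriv Ω i (j + 1) u) τ

/-- `∫_{∂Ω} F ds`. -/
def boundaryIntegral (F : ℝ × ℝ → ℝ) : ℝ :=
  (∫ y in (0 : ℝ)..1, F (0, y)) + (∫ y in (0 : ℝ)..1, F (1, y)) +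
    (∫ x in (0 : ℝ)..1, F (x, 0)) + (∫ x in (0 : ℝ)..1, F (x, 1))

/-- `‖∇²u‖_{0,∂Ω}`, from the traces on `∂Ω` of `u_xx`, `u_xy` and `u_yy`. -/
def hessianBoundaryNorm (uxx uxy uyy : ℝ × ℝ → ℝ) : ℝ :=
  Real.sqrt (boundaryIntegral fun p => uxx p ^ 2 + 2 * uxy p ^ 2 + uyy p ^ 2)

/-- The bilinear expression `(A ξ) · η`. -/
def matForm (A : Matrix (Fin 2) (Fin 2) ℝ) (ξ η : ℝ × ℝ) : ℝ :=
  (A 0 0 * ξ.1 + A 0 1 * ξ.2) * η.1 + (A 1 0 * ξ.1 + A 1 1 * ξ.2) * η.2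

/-- A diffusive coefficient tensor: symmetric, uniformly bounded and (uniformly) positive definite
in `Ω`. -/
def IsCoefficient (a : ℝ × ℝ → Matrix (Fin 2) (Fin 2) ℝ) : Prop :=
  (∀ p ∈ Ω, (a p).IsSymm) ∧
    ∃ α > 0, ∃ β, ∀ p ∈ Ω, ∀ ξ : ℝ × ℝ,
      α * (ξ.1 ^ 2 + ξ.2 ^ 2) ≤ matForm (a p) ξ ξ ∧
        matForm (a p) ξ ξ ≤ β * (ξ.1 ^ 2 + ξ.2 ^ 2)

/-- `u ∈ H^1(Ω)` is a (weak) solution of `-∇·(a∇u) = f` in `Ω`, `u = g` on `∂Ω`. -/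
def IsSolution (a : ℝ × ℝ → Matrix (Fin 2) (Fin 2) ℝ) (f g u : ℝ × ℝ → ℝ) : Prop :=
  MemSobolev Ω 1 u ∧
  (∀ φ, IsTest Ω φ →
    ∫ p in Ω, matForm (a p) (weakDeriv Ω 1 0 u p, weakDeriv Ω 0 1 u p) (dx φ p, dy φ p) =
      ∫ p in Ω, f p * φ p) ∧
  IsTrace 0 1 0 1 u (weakDeriv Ω 1 0 u) (weakDeriv Ω 0 1 u) g

/-! ### Rectangular partitions -/

/-- A partition of the unit square into rectangles: the Cartesian product of the partitions
`0 = x_0 < ... < x_n = 1` and `0 = y_0 < ... < y_m = 1`. -/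
structure RectMesh where
  n : ℕ
  m : ℕ
  x : Fin (n + 1) → ℝ
  y : Fin (m + 1) → ℝ
  x_mono : StrictMono x
  y_mono : StrictMono y
  x_first : x 0 = 0
  x_last : x (Fin.last n) = 1
  y_first : y 0 = 0
  y_last : y (Fin.last m) = 1

/-- Edges of a partition: `vert i j` is `{x_i} × [y_j, y_{j+1}]`, and `horiz i j` is
`[x_i, x_{i+1}] × {y_j}`. -/
inductive Edge (M : RectMesh) where
  | vert (i : Fin (M.n + 1)) (j : Fin M.m) : Edge M
  | horiz (i : Fin M.n) (j : Fin (M.m + 1)) : Edge M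

namespace RectMesh

variable (M : RectMesh)

/-- Elements: `(i, j)` stands for `[x_i, x_{i+1}] × [y_j, y_{j+1}]`. -/
abbrev Cell : Type := Fin M.n × Fin M.m

/-- The interior of the element `T`. -/
def cell (T : M.Cell) : Set (ℝ × ℝ) :=
  rect (M.x T.1.castSucc) (M.x T.1.succ) (M.y T.2.castSucc) (M.y T.2.succ)

/-- Horizontal side length of `T`. -/
def hx (T : M.Cell) : ℝ := M.x T.1.succ - M.x T.1.castSucc

/-- Vertical side length of `T`. -/
def hy (T : M.Cell) : ℝ := M.y T.2.succ - M.y T.2.castSucc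

/-- The diameter `h_T`. -/
def diam (T : M.Cell) : ℝ := Real.sqrt (M.hx T ^ 2 + M.hy T ^ 2)

/-- The mesh size `h = max_T h_T`. -/
def h : ℝ := ⨆ T : M.Cell, M.diam T

/-- Shape regularity with constant `κ`: every edge of every element `T` has length at least
`κ h_T`. -/
def ShapeRegular (κ : ℝ) : Prop :=
  ∀ T : M.Cell, κ * M.diam T ≤ M.hx T ∧ κ * M.diam T ≤ M.hy T

/-- The tensor `a` is constant in each element. -/
def PiecewiseConstant (a : ℝ × ℝ → Matrix (Fin 2) (Fin 2) ℝ) : Prop :=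
  ∀ T : M.Cell, ∃ A, ∀ p ∈ M.cell T, a p = A

/-- Length of an edge. -/
def len : Edge M → ℝ
  | .vert _ j => M.y j.succ - M.y j.castSucc
  | .horiz i _ => M.x i.succ - M.x i.castSucc

/-- The edges contained in `∂Ω`. -/
def OnBoundary : Edge M → Prop
  | .vert i _ => i = 0 ∨ i = Fin.last M.n
  | .horiz _ j => j = 0 ∨ j = Fin.last M.m

/-- The four edges of the element `T`: left, right, bottom, top. -/
def side (T : M.Cell) : Fin 4 → Edge M :=
  ![.vert T.1.castSucc T.2, .vert T.1.succ T.2, .horiz T.1 T.2.castSucc, .horiz T.1 T.2.succ]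

/-- The outward unit normal vectors on the four edges of an element, in the order of `side`. -/
def normal : Fin 4 → ℝ × ℝ := ![(-1, 0), (1, 0), (0, -1), (0, 1)]

/-- The `L²` projection `Q_b` onto the functions that are constant on each edge. -/
def Qb (w : ℝ × ℝ → ℝ) : Edge M → ℝ
  | .vert i j => (∫ y in M.y j.castSucc..M.y j.succ, w (M.x i, y)) / M.len (.vert i j)
  | .horiz i j => (∫ x in M.x i.castSucc..M.x i.succ, w (x, M.y j)) / M.len (.horiz i j)

/-- `γ` is the trace of `u ∈ H^1(Ω)` on the union of all edges of the partition. -/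
def IsEdgeTrace (u γ : ℝ × ℝ → ℝ) : Prop :=
  ∀ T : M.Cell,
    IsTrace (M.x T.1.castSucc) (M.x T.1.succ) (M.y T.2.castSucc) (M.y T.2.succ)
      u (weakDeriv Ω 1 0 u) (weakDeriv Ω 0 1 u) γ

end RectMesh

/-! ### The lowest order weak Galerkin scheme -/

/-- The polynomial `c₀ + c₁ x + c₂ y`. -/
def affine (c : Fin 3 → ℝ) (p : ℝ × ℝ) : ℝ := c 0 + c 1 * p.1 + c 2 * p.2

/-- The weak finite element space `V_h` (with `k = 1`): a function `{v_0, v_b}` is given by a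
polynomial `v_0` of degree at most one in each element (through its coefficients) and by a single
value `v_b` on each edge. -/
structure WeakFun (M : RectMesh) where
  int : M.Cell → Fin 3 → ℝ
  bdry : Edge M → ℝ

namespace WeakFun

variable {M : RectMesh}

/-- The discrete weak gradient `∇_d v` on `T`, a constant vector; see `weakGrad_iff` for its
defining property. -/
def weakGrad (v : WeakFun M) (T : M.Cell) : ℝ × ℝ :=
  ((v.bdry (M.side T 1) - v.bdry (M.side T 0)) / M.hx T,
    (v.bdry (M.side T 3) - v.bdry (M.side T 2)) / M.hy T)

/-- The discrete weak gradient on `T` is the unique `G ∈ [P_0(T)]²` such that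
`(G, ψ)_T = -(v_0, ∇·ψ)_T + ⟨v_b, ψ·n⟩_{∂T}` for all `ψ ∈ [P_0(T)]²`. -/
theorem weakGrad_iff (v : WeakFun M) (T : M.Cell) (G : ℝ × ℝ) :
    (∀ ψ : ℝ × ℝ,
      ∫ _ in M.cell T, (G.1 * ψ.1 + G.2 * ψ.2) =
        -(∫ p in M.cell T, affine (v.int T) p * (dx (fun _ => ψ.1) p + dy (fun _ => ψ.2) p)) +
          ∑ s, M.len (M.side T s) * (v.bdry (M.side T s) *
            (ψ.1 * (RectMesh.normal s).1 + ψ.2 * (RectMesh.normal s).2))) ↔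
      G = v.weakGrad T := by
  have hx : 0 < M.hx T := sub_pos.2 (M.x_mono Fin.castSucc_lt_succ)
  have hy : 0 < M.hy T := sub_pos.2 (M.y_mono Fin.castSucc_lt_succ)
  have hvol : (volume : Measure (ℝ × ℝ)).real (M.cell T) = M.hx T * M.hy T := by
    rw [RectMesh.cell, rect, Measure.volume_eq_prod, measureReal_prod_prod,
      Real.volume_real_Ioo_of_le (le_of_lt (sub_pos.1 hx)),
      Real.volume_real_Ioo_of_le (le_of_lt (sub_pos.1 hy))]
    rfl
  have l0 : M.len (M.side T 0) = M.hy T := rfl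
  have l1 : M.len (M.side T 1) = M.hy T := rfl
  have l2 : M.len (M.side T 2) = M.hx T := rfl
  have l3 : M.len (M.side T 3) = M.hx T := rfl
  simp only [setIntegral_const, hvol, smul_eq_mul, Fin.sum_univ_four, l0, l1, l2, l3, dx, dy,
    fderiv_fun_const, RectMesh.normal]
  simp only [Pi.zero_apply, zero_apply, add_zero, mul_zero, integral_zero,
    neg_zero, zero_add, Matrix.cons_val]
  constructor
  · intro H
    have h1 := H (1, 0)
    have h2 := H (0, 1)
    simp only [mul_one, mul_zero, add_zero, zero_add] at h1 h2
    refine Prod.ext ?_ ?_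
    · simp only [weakGrad]
      rw [eq_div_iff hx.ne']
      apply mul_left_cancel₀ hy.ne'
      linarith
    · simp only [weakGrad]
      rw [eq_div_iff hy.ne']
      apply mul_left_cancel₀ hx.ne'
      linarith
  · rintro rfl ψ
    simp only [weakGrad]
    field_simp
    ring

/-- `∑_T (a∇_d w, ∇_d v)_T`. -/
def energy (a : ℝ × ℝ → Matrix (Fin 2) (Fin 2) ℝ) (w v : WeakFun M) : ℝ :=
  ∑ T : M.Cell, ∫ p in M.cell T, matForm (a p) (w.weakGrad T) (v.weakGrad T)

/-- `v_b - Q_b v_0` on the edge number `s` of `T`. -/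
def jump (v : WeakFun M) (T : M.Cell) (s : Fin 4) : ℝ :=
  v.bdry (M.side T s) - M.Qb (affine (v.int T)) (M.side T s)

/-- The stabilizer `s(w, v) = ρ h⁻¹ ∑_T ⟨w_b - Q_b w_0, v_b - Q_b v_0⟩_{∂T}`. -/
def stab (ρ : ℝ) (w v : WeakFun M) : ℝ :=
  ρ * (M.h)⁻¹ * ∑ T : M.Cell, ∑ s, M.len (M.side T s) * (w.jump T s * v.jump T s)

/-- `(f, v_0)`. -/
def load (f : ℝ × ℝ → ℝ) (v : WeakFun M) : ℝ :=
  ∑ T : M.Cell, ∫ p in M.cell T, f p * affine (v.int T) p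

/-- `u_h ∈ V_h` solves the weak Galerkin scheme with the boundary value `Q_b g` on `∂Ω`. -/
def IsWGSolution (a : ℝ × ℝ → Matrix (Fin 2) (Fin 2) ℝ) (ρ : ℝ) (f g : ℝ × ℝ → ℝ)
    (uh : WeakFun M) : Prop :=
  (∀ e, M.OnBoundary e → uh.bdry e = M.Qb g e) ∧
    ∀ v : WeakFun M, (∀ e, M.OnBoundary e → v.bdry e = 0) →
      energy a uh v + stab ρ uh v = load f v

/-- The error `e_b = Q_b u - u_b`, as the weak function `{0, e_b}`, where `γ` is the trace of `u`
on the edges. -/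
def error (γ : ℝ × ℝ → ℝ) (uh : WeakFun M) : WeakFun M where
  int := 0
  bdry := fun e => M.Qb γ e - uh.bdry e

/-- `(∑_T ‖∇_d v‖_T²)^{1/2}`. -/
def gradNorm (v : WeakFun M) : ℝ :=
  Real.sqrt (∑ T : M.Cell, ∫ _ in M.cell T, ((v.weakGrad T).1 ^ 2 + (v.weakGrad T).2 ^ 2))

end WeakFun

end WG

end

/-! The interior part of a test function is free. In each cell it is chosen as the least squares fit
of the four edge values (`RectMesh.leastSquares`). The jump of such a function, weighted by the edge
lengths, is orthogonal to the edge means of all affine functions. Hence the stabilizer sees only the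
defect `v_L + v_R - v_B - v_T` of the other argument (`RectMesh.stab_leastSquares`), the unknown
`u_0` drops out, and a scheme for `u_b` alone remains.

For the load, write `f = -div q` with `q = a∇u`. The tensor may jump, but the mean normal flux
through an edge does not (`RectMesh.greenX_of_weak_divergence`). Integration by parts along each
row, against the linear interpolant of the edge values, therefore telescopes to zero
(`RectMesh.sum_flux_eq_zero`), and likewise along columns. The discrete gradient of `Q_b u` is the
cell mean of `∇u`, so the principal terms cancel and the error equation `RectMesh.sum_error_eq_zero`
is left. Its right-hand side has two kinds of terms: first moments of the derivatives of `q`, which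
are of higher order by a further integration by parts, and a residual `R = X - Y + ...` paired with
the defect of the test function. Here `X` and `Y` are `h²` times bounded combinations of cell means
of second derivatives of `u`.

Estimating `R` directly would only give order `h`. The gain is that `X - Y` is itself almost the
defect of a discrete function `d`, namely the one equal to `-Y/2` on vertical and `-X/2` on
horizontal edges. Its discrete gradient is small, because means over adjacent cells differ little.
The error minus `d` is used as the test function. It must vanish on `∂Ω`, and `-Y/2` cannot be
matched from both sides of a line where `a` jumps; on those lines `d` is set to zero. The price is
`h⁴` times the squared means over one column of cells per line. By a trace-type inequality
(`RectMesh.sum_sq_mean_le`) such a column sum is of order `h⁻¹`, so the price is `h³` in the square,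
which is the rate `h^{1.5}`. The number of such lines is bounded independently of the mesh, since
`a` is also piecewise constant on one partition `M₀` fixed in advance.

The analytic tool is `GreenX`: integration by parts in `x` over strips, with a boundary value at
every abscissa. It replaces trace theory inside the square. Everything in the direction `y` follows
by exchanging the coordinates. -/

namespace WG

/-! ### Test functions and weak derivatives on an interval -/

/-- Elements of `C_c^∞(a, b)`. -/
def IsTest1 (a b : ℝ) (η : ℝ → ℝ) : Prop :=
  ContDiff ℝ ∞ η ∧ HasCompactSupport η ∧ tsupport η ⊆ Ioo a b

theorem IsTest1.exists_Icc {a b : ℝ} (hab : a < b) {η : ℝ → ℝ} (h : IsTest1 a b η) :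
    ∃ c d, a < c ∧ c < d ∧ d < b ∧ ∀ x, x ∉ Icc c d → η x = 0 := by
  obtain ⟨-, hc, hs⟩ := h
  have hz : ∀ x, x ∉ tsupport η → η x = 0 := fun x hx => image_eq_zero_of_notMem_tsupport hx
  rcases (tsupport η).eq_empty_or_nonempty with he | hne
  · refine ⟨(2 * a + b) / 3, (a + 2 * b) / 3, by linarith, by linarith, by linarith, fun x _ => ?_⟩
    exact hz x (by simp [he])
  · have hK : IsCompact (tsupport η) := hc
    have h1 := hs (hK.sInf_mem hne)
    have h2 := hs (hK.sSup_mem hne)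
    refine ⟨(a + sInf (tsupport η)) / 2, (b + sSup (tsupport η)) / 2, by linarith [h1.1], ?_,
      by linarith [h2.2], fun x hx => hz x fun hx' => hx ?_⟩
    · have := hK.sInf_mem hne
      have h3 := le_csSup hK.bddAbove this
      linarith [h1.1, h2.2]
    · have h3 := le_csSup hK.bddAbove hx'
      have h4 := csInf_le hK.bddBelow hx'
      constructor <;> linarith [h1.1, h2.2]

/-- To the left of the support of `θ` the primitive from `a` is zero trivially; to the right it
equals the full integral, which is zero by assumption. -/
theorem IsTest1.exists_primitive {a b : ℝ} (hab : a < b) {θ : ℝ → ℝ} (h : IsTest1 a b θ)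
    (h0 : ∫ x in Ioo a b, θ x = 0) : ∃ η, IsTest1 a b η ∧ deriv η = θ := by
  obtain ⟨c, d, hac, hcd, hdb, hz⟩ := h.exists_Icc hab
  have hcont : Continuous θ := h.1.continuous
  have hd : ∀ x, HasDerivAt (fun x => ∫ t in a..x, θ t) (θ x) x := fun x =>
    intervalIntegral.integral_hasDerivAt_right (hcont.intervalIntegrable _ _)
      hcont.stronglyMeasurable.stronglyMeasurableAtFilter hcont.continuousAt
  have hder : deriv (fun x => ∫ t in a..x, θ t) = θ := funext fun x => (hd x).deriv
  have hzero : ∀ x, x ∉ Icc c d → ∫ t in a..x, θ t = 0 := by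
    intro x hx
    rcases lt_or_ge x c with hxc | hxc
    · refine intervalIntegral.integral_zero_ae (ae_of_all _ fun t ht => hz t fun ht' => ?_)
      have := (uIoc_subset_uIcc ht).2
      have h2 : max a x < c := max_lt hac hxc
      exact absurd ht'.1 (not_le.2 (lt_of_le_of_lt this h2))
    · have hxd : d < x := by
        by_contra hh
        exact hx ⟨hxc, not_lt.1 hh⟩
      have h1 : ∫ t in a..b, θ t = 0 := by
        rw [intervalIntegral.integral_of_le hab.le, integral_Ioc_eq_integral_Ioo, h0]
      have h2 : ∫ t in b..x, θ t = 0 := by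
        refine intervalIntegral.integral_zero_ae (ae_of_all _ fun t ht => hz t fun ht' => ?_)
        have := (uIoc_subset_uIcc ht).1
        have h2 : d < min b x := lt_min hdb hxd
        exact absurd ht'.2 (not_le.2 (lt_of_lt_of_le h2 this))
      rw [← intervalIntegral.integral_add_adjacent_intervals (hcont.intervalIntegrable a b)
        (hcont.intervalIntegrable b x), h1, h2, add_zero]
  have hts : tsupport (fun x => ∫ t in a..x, θ t) ⊆ Icc c d :=
    closure_minimal (fun x hx => by
      by_contra hh
      exact hx (hzero x hh)) isClosed_Icc
  refine ⟨fun x => ∫ t in a..x, θ t, ⟨?_, ?_, ?_⟩, hder⟩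
  · refine contDiff_infty_iff_deriv.2 ⟨fun x => (hd x).differentiableAt, ?_⟩
    rw [hder]; exact h.1
  · exact isCompact_Icc.of_isClosed_subset (isClosed_tsupport _) hts
  · exact hts.trans fun x hx => ⟨lt_of_lt_of_le hac hx.1, lt_of_le_of_lt hx.2 hdb⟩

theorem IsTest1.sub_mul {a b : ℝ} {θ η : ℝ → ℝ} (h : IsTest1 a b θ) (h' : IsTest1 a b η) (k : ℝ) :
    IsTest1 a b (fun x => θ x - k * η x) := by
  have h1 : HasCompactSupport fun x => k * η x := h'.2.1.mul_left
  have h2 : tsupport (fun x => k * η x) ⊆ tsupport η := tsupport_mul_subset_right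
  refine ⟨h.1.sub (contDiff_const.mul h'.1), ?_, ?_⟩
  · exact h.2.1.sub h1
  · exact (tsupport_sub θ _).trans (union_subset h.2.2 (h2.trans h'.2.2))

theorem exists_isTest1_integral_one {a b : ℝ} (hab : a < b) :
    ∃ η, IsTest1 a b η ∧ ∫ x in Ioo a b, η x = 1 := by
  let φ : ContDiffBump ((a + b) / 2) := ⟨(b - a) / 8, (b - a) / 4, by linarith, by linarith⟩
  have hts : tsupport (φ.normed volume) ⊆ Ioo a b := by
    rw [φ.tsupport_normed_eq]
    intro x hx
    rw [Real.closedBall_eq_Icc] at hx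
    have h1 : φ.rOut = (b - a) / 4 := rfl
    rw [h1] at hx
    constructor <;> linarith [hx.1, hx.2]
  refine ⟨φ.normed volume, ⟨φ.contDiff_normed, φ.hasCompactSupport_normed, hts⟩, ?_⟩
  rw [setIntegral_eq_integral_of_forall_compl_eq_zero, φ.integral_normed]
  intro x hx
  exact image_eq_zero_of_notMem_tsupport fun h => hx (hts h)

/-- The fundamental lemma of the calculus of variations on an interval. -/
theorem ae_eq_zero_of_forall_isTest1 {a b : ℝ} {F : ℝ → ℝ} (hF : IntegrableOn F (Ioo a b))
    (h : ∀ η, IsTest1 a b η → ∫ x in Ioo a b, F x * η x = 0) :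
    ∀ᵐ x ∂volume.restrict (Ioo a b), F x = 0 := by
  rw [ae_restrict_iff' measurableSet_Ioo]
  refine isOpen_Ioo.ae_eq_zero_of_integral_contDiff_smul_eq_zero hF.locallyIntegrableOn ?_
  intro g hg hc hs
  rw [← h g ⟨hg, hc, hs⟩, setIntegral_eq_integral_of_forall_compl_eq_zero]
  · simp [mul_comm]
  · intro x hx
    rw [image_eq_zero_of_notMem_tsupport fun h => hx (hs h), mul_zero]

/-- The lemma of du Bois-Reymond. -/
theorem ae_const_of_forall_isTest1 {a b : ℝ} (hab : a < b) {F : ℝ → ℝ}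
    (hF : IntegrableOn F (Ioo a b))
    (h : ∀ η, IsTest1 a b η → ∫ x in Ioo a b, F x * deriv η x = 0) :
    ∃ c, ∀ᵐ x ∂volume.restrict (Ioo a b), F x = c := by
  obtain ⟨θ₀, hθ₀, hi⟩ := exists_isTest1_integral_one hab
  have hint : ∀ θ, IsTest1 a b θ → IntegrableOn θ (Ioo a b) := fun θ hθ =>
    (hθ.1.continuous.integrable_of_hasCompactSupport hθ.2.1).integrableOn
  have hFint : ∀ θ, IsTest1 a b θ → IntegrableOn (fun x => F x * θ x) (Ioo a b) := fun θ hθ =>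
    (hF.mul_continuousOn_of_subset hθ.1.continuous.continuousOn measurableSet_Ioo
      isCompact_Icc Ioo_subset_Icc_self)
  -- Testing with the normalized `θ₀` identifies the constant.
  refine ⟨∫ x in Ioo a b, F x * θ₀ x, ?_⟩
  set c := ∫ x in Ioo a b, F x * θ₀ x
  have key : ∀ᵐ x ∂volume.restrict (Ioo a b), F x - c = 0 := by
    refine ae_eq_zero_of_forall_isTest1 (hF.sub (by simp [integrableOn_const_iff])) fun θ hθ => ?_
    set k := ∫ x in Ioo a b, θ x with hk
    -- Subtracting `k θ₀` removes the mean of `θ`, which makes the difference the derivative of a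
    -- test function.
    obtain ⟨η, hη, hd⟩ := (hθ.sub_mul hθ₀ k).exists_primitive hab (by
      rw [integral_sub (hint θ hθ) ((hint θ₀ hθ₀).const_mul k), integral_const_mul, hi]
      simp [hk])
    have := h η hη
    rw [hd] at this
    have e1 : ∫ x in Ioo a b, F x * (θ x - k * θ₀ x) =
        (∫ x in Ioo a b, F x * θ x) - k * c := by
      rw [← integral_const_mul, ← integral_sub (hFint θ hθ) ((hFint θ₀ hθ₀).const_mul k)]
      congr 1; ext x; ring
    have e2 : ∫ x in Ioo a b, (F x - c) * θ x = (∫ x in Ioo a b, F x * θ x) - c * k := by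
      rw [hk, ← integral_const_mul, ← integral_sub (hFint θ hθ) ((hint θ hθ).const_mul c)]
      congr 1; ext x; ring
    rw [e2]; rw [e1] at this; linarith
  filter_upwards [key] with x hx
  linarith

/-- The primitive of an integrable function is absolutely continuous with derivative `B` almost
everywhere, so the product rule for absolutely continuous functions applies. The primitive is
rebased at `s` to work on `[s, t]`; the constant this costs is accounted for by the integral of
`p'`. -/
theorem intervalIntegral_primitive_parts {a b : ℝ} {B : ℝ → ℝ}
    (hB : IntervalIntegrable B volume a b) (c : ℝ) {s t : ℝ} (hs : s ∈ uIcc a b)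
    (ht : t ∈ uIcc a b) {p : ℝ → ℝ} (hp : ContDiff ℝ 1 p) :
    ∫ x in s..t, ((c + ∫ u in a..x, B u) * deriv p x + B x * p x) =
      (c + ∫ u in a..t, B u) * p t - (c + ∫ u in a..s, B u) * p s := by
  have hst : uIcc s t ⊆ uIcc a b := uIcc_subset_uIcc hs ht
  have hB' : IntervalIntegrable B volume s t := hB.mono_set hst
  have hBs : IntervalIntegrable B volume a s := hB.mono_set (uIcc_subset_uIcc left_mem_uIcc hs)
  have hac : AbsolutelyContinuousOnInterval (fun x => ∫ u in s..x, B u) s t :=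
    hB'.absolutelyContinuousOnInterval_intervalIntegral (c := s) left_mem_uIcc
  have hpac : AbsolutelyContinuousOnInterval p s t :=
    hp.contDiffOn.absolutelyContinuousOnInterval
  have h := hac.integral_deriv_mul_eq_sub hpac
  have h2 := hpac.integral_deriv_eq_sub
  have hpi : IntervalIntegrable (deriv p) volume s t :=
    (hp.continuous_deriv le_rfl).intervalIntegrable _ _
  have e : ∫ x in s..t, ((c + ∫ u in a..x, B u) * deriv p x + B x * p x) =
      (∫ x in s..t, (deriv (fun x => ∫ u in s..x, B u) x * p x +
        (∫ u in s..x, B u) * deriv p x)) + (c + ∫ u in a..s, B u) * ∫ x in s..t, deriv p x := by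
    rw [← intervalIntegral.integral_const_mul, ← intervalIntegral.integral_add]
    · refine intervalIntegral.integral_congr_ae ?_
      filter_upwards [hB'.ae_hasDerivAt_integral] with x hx hxs
      have hx' := uIoc_subset_uIcc hxs
      rw [(hx hx' s left_mem_uIcc).deriv, ← intervalIntegral.integral_add_adjacent_intervals hBs
        (hB'.mono_set (uIcc_subset_uIcc left_mem_uIcc hx'))]
      ring
    · exact (hac.intervalIntegrable_deriv.mul_continuousOn hp.continuous.continuousOn).add
        (hpi.continuousOn_mul hac.continuousOn)
    · exact hpi.const_mul _
  rw [e, h, h2, ← intervalIntegral.integral_add_adjacent_intervals hBs hB']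
  simp only [intervalIntegral.integral_same]
  ring

/-- A function on an interval with an integrable weak derivative has values at all points, for which
the formula of integration by parts holds. -/
theorem exists_values_of_weakDeriv {a b : ℝ} (hab : a < b) {A B : ℝ → ℝ}
    (hA : IntegrableOn A (Ioo a b)) (hB : IntegrableOn B (Ioo a b))
    (h : ∀ η, IsTest1 a b η → ∫ x in Ioo a b, (A x * deriv η x + B x * η x) = 0) :
    ∃ V : ℝ → ℝ, ∀ s t, a ≤ s → s ≤ t → t ≤ b → ∀ p : ℝ → ℝ, ContDiff ℝ 1 p →
      ∫ x in Ioo s t, (A x * deriv p x + B x * p x) = V t * p t - V s * p s := by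
  have hBi : IntervalIntegrable B volume a b :=
    (intervalIntegrable_iff_integrableOn_Ioo_of_le hab.le).2 hB
  have hPc : ContinuousOn (fun x => ∫ u in a..x, B u) (Icc a b) := by
    have := (hBi.absolutelyContinuousOnInterval_intervalIntegral (c := a)
      left_mem_uIcc).continuousOn
    rwa [uIcc_of_le hab.le] at this
  have hPi : IntegrableOn (fun x => ∫ u in a..x, B u) (Ioo a b) :=
    (hPc.integrableOn_compact isCompact_Icc).mono_set Ioo_subset_Icc_self
  have hmul : ∀ {F : ℝ → ℝ}, IntegrableOn F (Ioo a b) → ∀ {q : ℝ → ℝ}, Continuous q →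
      IntegrableOn (fun x => F x * q x) (Ioo a b) := fun hF _ hq =>
    hF.mul_continuousOn_of_subset hq.continuousOn measurableSet_Ioo isCompact_Icc
      Ioo_subset_Icc_self
  have hI : ∀ {s t : ℝ}, s ≤ t → ∀ F : ℝ → ℝ, ∫ x in Ioo s t, F x = ∫ x in s..t, F x := by
    intro s t hst F
    rw [intervalIntegral.integral_of_le hst, integral_Ioc_eq_integral_Ioo]
  -- `A` and the primitive of `B` have the same weak derivative, so they differ by a constant; the
  -- values sought are those of the continuous representative.
  obtain ⟨c, hc⟩ := ae_const_of_forall_isTest1 hab (hA.sub hPi) (by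
    intro η hη
    have hη1 : ContDiff ℝ 1 η := hη.1.of_le (by simp)
    have hd := hη1.continuous_deriv le_rfl
    have h1 := intervalIntegral_primitive_parts hBi 0 left_mem_uIcc right_mem_uIcc hη1
    have hz : ∀ x, x ∉ Ioo a b → η x = 0 := fun x hx =>
      image_eq_zero_of_notMem_tsupport fun h => hx (hη.2.2 h)
    rw [hz a (by simp), hz b (by simp), ← hI hab.le] at h1
    simp only [zero_add, mul_zero, sub_zero] at h1
    rw [← sub_eq_zero.2 ((h η hη).trans h1.symm), ← integral_sub]
    · congr 1; ext x; simp only [Pi.sub_apply]; ring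
    · exact (hmul hA hd).add (hmul hB hη.1.continuous)
    · exact (hmul hPi hd).add (hmul hB hη.1.continuous))
  refine ⟨fun x => c + ∫ u in a..x, B u, fun s t has hst htb p hp => ?_⟩
  rw [← intervalIntegral_primitive_parts hBi c (s := s) (t := t)
    (by rw [uIcc_of_le hab.le]; exact ⟨has, hst.trans htb⟩)
    (by rw [uIcc_of_le hab.le]; exact ⟨has.trans hst, htb⟩) hp, ← hI hst]
  refine integral_congr_ae ?_
  filter_upwards [ae_restrict_of_ae_restrict_of_subset (Ioo_subset_Ioo has htb) hc] with x hx
  simp only [Pi.sub_apply] at hx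
  have : A x = c + ∫ u in a..x, B u := by linarith
  rw [this]

/-! ### Integration over rectangles -/

theorem volume_restrict_rect (a b c d : ℝ) : (volume : Measure (ℝ × ℝ)).restrict (rect a b c d) =
    (volume.restrict (Ioo a b)).prod (volume.restrict (Ioo c d)) := by
  rw [rect, Measure.volume_eq_prod, Measure.prod_restrict]

theorem measurableSet_rect (a b c d : ℝ) : MeasurableSet (rect a b c d) :=
  measurableSet_Ioo.prod measurableSet_Ioo

theorem isOpen_rect (a b c d : ℝ) : IsOpen (rect a b c d) := isOpen_Ioo.prod isOpen_Ioo

theorem rect_mono {a b c d a' b' c' d' : ℝ} (ha : a' ≤ a) (hb : b ≤ b') (hc : c' ≤ c)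
    (hd : d ≤ d') : rect a b c d ⊆ rect a' b' c' d' :=
  prod_mono (Ioo_subset_Ioo ha hb) (Ioo_subset_Ioo hc hd)

theorem volume_real_rect {a b c d : ℝ} (hab : a ≤ b) (hcd : c ≤ d) :
    (volume : Measure (ℝ × ℝ)).real (rect a b c d) = (b - a) * (d - c) := by
  rw [rect, Measure.volume_eq_prod, measureReal_prod_prod, Real.volume_real_Ioo_of_le hab,
    Real.volume_real_Ioo_of_le hcd]

theorem volume_rect_ne_top (a b c d : ℝ) : (volume : Measure (ℝ × ℝ)) (rect a b c d) ≠ ⊤ := by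
  rw [rect, Measure.volume_eq_prod, Measure.prod_prod]
  exact ENNReal.mul_ne_top (by simp) (by simp)

instance isFiniteMeasure_restrict_rect (a b c d : ℝ) :
    IsFiniteMeasure ((volume : Measure (ℝ × ℝ)).restrict (rect a b c d)) :=
  ⟨by simpa using (volume_rect_ne_top a b c d).lt_top⟩

theorem integrableOn_rect_mul {a b c d : ℝ} {F : ℝ × ℝ → ℝ} (hF : IntegrableOn F (rect a b c d))
    {g : ℝ × ℝ → ℝ} (hg : Continuous g) : IntegrableOn (fun p => F p * g p) (rect a b c d) :=
  hF.mul_continuousOn_of_subset hg.continuousOn (measurableSet_rect a b c d)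
    (isCompact_Icc.prod isCompact_Icc) (prod_mono Ioo_subset_Icc_self Ioo_subset_Icc_self)

/-- This carries statements proved in the direction `x` over to the direction `y`. -/
theorem integral_rect_swap (a b c d : ℝ) (F : ℝ × ℝ → ℝ) :
    ∫ p in rect c d a b, F p.swap = ∫ p in rect a b c d, F p := by
  have h : MeasurePreserving (Prod.swap : ℝ × ℝ → ℝ × ℝ) volume volume :=
    Measure.measurePreserving_swap
  have h2 := h.setIntegral_preimage_emb
    (MeasurableEquiv.prodComm (α := ℝ) (β := ℝ)).measurableEmbedding F (rect a b c d)
  rw [← h2]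
  congr 2
  simp [rect, preimage_swap_prod]

theorem integrableOn_rect_swap {a b c d : ℝ} {F : ℝ × ℝ → ℝ} (h : IntegrableOn F (rect a b c d)) :
    IntegrableOn (fun p => F p.swap) (rect c d a b) := by
  unfold IntegrableOn at *
  rw [volume_restrict_rect] at *
  exact h.swap

theorem memLp_rect_swap {a b c d : ℝ} {F : ℝ × ℝ → ℝ}
    (h : MemLp F 2 (volume.restrict (rect a b c d))) :
    MemLp (fun p => F p.swap) 2 (volume.restrict (rect c d a b)) := by
  rw [volume_restrict_rect] at *
  exact h.comp_measurePreserving Measure.measurePreserving_swap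

/-! ### Green's formula in one direction -/

/-- Green's formula in the direction `x`, on the rectangles `(s, t) × (c, d)` with
`a ≤ s ≤ t ≤ b`. -/
def GreenX (a b c d : ℝ) (w w' : ℝ × ℝ → ℝ) : Prop :=
  ∀ χ : ℝ → ℝ, Continuous χ → ∃ V : ℝ → ℝ, ∀ s t, a ≤ s → s ≤ t → t ≤ b →
    ∀ p : ℝ → ℝ, ContDiff ℝ 1 p →
      ∫ q in rect s t c d, (w q * deriv p q.1 + w' q * p q.1) * χ q.2 = V t * p t - V s * p s

/-- The fundamental lemma in `y`, for fixed `η`, first frees `χ` from its support condition. Then,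
for fixed `χ`, integrating out `y` leaves a function of `x` with an integrable weak derivative,
which has values at all points. -/
theorem greenX_of_forall_isTest1 {a b c d : ℝ} (hab : a < b) {w w' : ℝ × ℝ → ℝ}
    (hw : IntegrableOn w (rect a b c d)) (hw' : IntegrableOn w' (rect a b c d))
    (h : ∀ η χ, IsTest1 a b η → IsTest1 c d χ →
      ∫ q in rect a b c d, (w q * deriv η q.1 + w' q * η q.1) * χ q.2 = 0) :
    GreenX a b c d w w' := by
  intro χ hχ
  have hI : ∀ p : ℝ → ℝ, ContDiff ℝ 1 p →
      IntegrableOn (fun q => w q * deriv p q.1 + w' q * p q.1) (rect a b c d) := fun p hp =>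
    (integrableOn_rect_mul hw ((hp.continuous_deriv le_rfl).comp continuous_fst)).add
      (integrableOn_rect_mul hw' (hp.continuous.comp continuous_fst))
  have hIχ : ∀ p : ℝ → ℝ, ContDiff ℝ 1 p → ∀ χ : ℝ → ℝ, Continuous χ →
      IntegrableOn (fun q => (w q * deriv p q.1 + w' q * p q.1) * χ q.2) (rect a b c d) :=
    fun p hp χ hχ => integrableOn_rect_mul (hI p hp) (hχ.comp continuous_snd)
  have hwχ : IntegrableOn (fun q => w q * χ q.2) (rect a b c d) :=
    integrableOn_rect_mul hw (hχ.comp continuous_snd)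
  have hwχ' : IntegrableOn (fun q => w' q * χ q.2) (rect a b c d) :=
    integrableOn_rect_mul hw' (hχ.comp continuous_snd)
  -- slices in the direction `x`
  have hsl : ∀ s t, a ≤ s → s ≤ t → t ≤ b → ∀ p : ℝ → ℝ, ContDiff ℝ 1 p →
      ∫ q in rect s t c d, (w q * deriv p q.1 + w' q * p q.1) * χ q.2 =
      ∫ x in Ioo s t, ((∫ y in Ioo c d, w (x, y) * χ y) * deriv p x +
        (∫ y in Ioo c d, w' (x, y) * χ y) * p x) := by
    intro s t hs hst ht p hp
    have hsub := rect_mono hs ht le_rfl le_rfl (c := c) (d := d)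
    have h1 := (hIχ p hp χ hχ).mono_set hsub
    have h2 := hwχ.mono_set hsub
    have h3 := hwχ'.mono_set hsub
    unfold IntegrableOn at h1 h2 h3
    rw [volume_restrict_rect] at h1 h2 h3 ⊢
    rw [integral_prod _ h1]
    refine integral_congr_ae ?_
    filter_upwards [h2.prod_right_ae, h3.prod_right_ae] with x h2x h3x
    rw [← integral_mul_const, ← integral_mul_const, ← integral_add (h2x.mul_const _)
      (h3x.mul_const _)]
    congr 1; ext y; ring
  have hzero : ∀ η, IsTest1 a b η →
      ∫ q in rect a b c d, (w q * deriv η q.1 + w' q * η q.1) * χ q.2 = 0 := by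
    intro η hη
    have hη1 : ContDiff ℝ 1 η := hη.1.of_le (by simp)
    have hy : ∀ χ : ℝ → ℝ, Continuous χ →
        ∫ q in rect a b c d, (w q * deriv η q.1 + w' q * η q.1) * χ q.2 =
        ∫ y in Ioo c d, (∫ x in Ioo a b, (w (x, y) * deriv η x + w' (x, y) * η x)) * χ y := by
      intro χ hχ
      have h1 := hIχ η hη1 χ hχ
      unfold IntegrableOn at h1
      rw [volume_restrict_rect] at h1 ⊢
      rw [integral_prod_symm _ h1]
      congr 1; ext y
      exact integral_mul_const (χ y) _
    have hK : IntegrableOn (fun y => ∫ x in Ioo a b, (w (x, y) * deriv η x + w' (x, y) * η x))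
        (Ioo c d) := by
      have h1 := hI η hη1
      unfold IntegrableOn at h1 ⊢
      rw [volume_restrict_rect] at h1
      exact h1.integral_prod_right
    -- The `x`-integral vanishes for almost every `y`, hence its product with any continuous `χ`
    -- integrates to zero.
    have := ae_eq_zero_of_forall_isTest1 hK fun χ hχ => by
      rw [← hy χ hχ.1.continuous]; exact h η χ hη hχ
    rw [hy χ hχ]
    refine integral_eq_zero_of_ae ?_
    filter_upwards [this] with y hy
    simp [hy]
  obtain ⟨V, hV⟩ := exists_values_of_weakDeriv hab
    (A := fun x => ∫ y in Ioo c d, w (x, y) * χ y) (B := fun x => ∫ y in Ioo c d, w' (x, y) * χ y)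
    (by
      unfold IntegrableOn at hwχ ⊢
      rw [volume_restrict_rect] at hwχ
      exact hwχ.integral_prod_left)
    (by
      unfold IntegrableOn at hwχ' ⊢
      rw [volume_restrict_rect] at hwχ'
      exact hwχ'.integral_prod_left)
    (fun η hη => by
      rw [← hsl a b le_rfl hab.le le_rfl η (hη.1.of_le (by simp))]
      exact hzero η hη)
  exact ⟨V, fun s t hs hst ht p hp => by rw [hsl s t hs hst ht p hp, hV s t hs hst ht p hp]⟩

/-! ### Test functions and weak derivatives in the plane -/

theorem isTest_tensor {a b c d : ℝ} {η χ : ℝ → ℝ} (hη : IsTest1 a b η) (hχ : IsTest1 c d χ) :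
    IsTest (rect a b c d) (fun p => η p.1 * χ p.2) := by
  have hsub : tsupport (fun p : ℝ × ℝ => η p.1 * χ p.2) ⊆ tsupport η ×ˢ tsupport χ := by
    refine closure_minimal (fun p hp => ?_)
      ((isClosed_tsupport η).prod (isClosed_tsupport χ))
    have h1 : η p.1 ≠ 0 := left_ne_zero_of_mul hp
    have h2 : χ p.2 ≠ 0 := right_ne_zero_of_mul hp
    exact ⟨subset_tsupport _ h1, subset_tsupport _ h2⟩
  refine ⟨(hη.1.comp contDiff_fst).mul (hχ.1.comp contDiff_snd), ?_,
    hsub.trans (prod_mono hη.2.2 hχ.2.2)⟩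
  have hK : IsCompact (tsupport η ×ˢ tsupport χ) := IsCompact.prod hη.2.1 hχ.2.1
  exact hK.of_isClosed_subset (isClosed_tsupport _) hsub

theorem dx_tensor {η χ : ℝ → ℝ} (hη : Differentiable ℝ η) (hχ : Differentiable ℝ χ) (p : ℝ × ℝ) :
    dx (fun p => η p.1 * χ p.2) p = deriv η p.1 * χ p.2 := by
  have h1 : HasFDerivAt (fun p : ℝ × ℝ => η p.1)
      ((deriv η p.1) • ContinuousLinearMap.fst ℝ ℝ ℝ) p :=
    (hη p.1).hasDerivAt.comp_hasFDerivAt p hasFDerivAt_fst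
  have h2 : HasFDerivAt (fun p : ℝ × ℝ => χ p.2)
      ((deriv χ p.2) • ContinuousLinearMap.snd ℝ ℝ ℝ) p :=
    (hχ p.2).hasDerivAt.comp_hasFDerivAt p hasFDerivAt_snd
  have h3 : HasFDerivAt (fun p : ℝ × ℝ => η p.1 * χ p.2) _ p := h1.mul h2
  rw [dx, h3.fderiv]
  simp [mul_comm]

theorem dy_tensor {η χ : ℝ → ℝ} (hη : Differentiable ℝ η) (hχ : Differentiable ℝ χ) (p : ℝ × ℝ) :
    dy (fun p => η p.1 * χ p.2) p = η p.1 * deriv χ p.2 := by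
  have h1 : HasFDerivAt (fun p : ℝ × ℝ => η p.1)
      ((deriv η p.1) • ContinuousLinearMap.fst ℝ ℝ ℝ) p :=
    (hη p.1).hasDerivAt.comp_hasFDerivAt p hasFDerivAt_fst
  have h2 : HasFDerivAt (fun p : ℝ × ℝ => χ p.2)
      ((deriv χ p.2) • ContinuousLinearMap.snd ℝ ℝ ℝ) p :=
    (hχ p.2).hasDerivAt.comp_hasFDerivAt p hasFDerivAt_snd
  have h3 : HasFDerivAt (fun p : ℝ × ℝ => η p.1 * χ p.2) _ p := h1.mul h2
  rw [dy, h3.fderiv]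
  simp

theorem IsTest.mono {U V : Set (ℝ × ℝ)} {φ : ℝ × ℝ → ℝ} (h : IsTest U φ) (hUV : U ⊆ V) :
    IsTest V φ := ⟨h.1, h.2.1, h.2.2.trans hUV⟩

theorem IsTest.eq_zero {U : Set (ℝ × ℝ)} {φ : ℝ × ℝ → ℝ} (h : IsTest U φ) {p : ℝ × ℝ}
    (hp : p ∉ U) : φ p = 0 :=
  image_eq_zero_of_notMem_tsupport fun h' => hp (h.2.2 h')

theorem IsTest.dx {U : Set (ℝ × ℝ)} {φ : ℝ × ℝ → ℝ} (h : IsTest U φ) : IsTest U (dx φ) := by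
  have hs : tsupport (WG.dx φ) ⊆ tsupport φ := tsupport_fderiv_apply_subset ℝ (1, 0)
  refine ⟨?_, ?_, hs.trans h.2.2⟩
  · exact (h.1.fderiv_right (m := ∞) (by simp)).clm_apply contDiff_const
  · exact h.2.1.of_isClosed_subset (isClosed_tsupport _) hs

theorem IsTest.dy {U : Set (ℝ × ℝ)} {φ : ℝ × ℝ → ℝ} (h : IsTest U φ) : IsTest U (dy φ) := by
  have hs : tsupport (WG.dy φ) ⊆ tsupport φ := tsupport_fderiv_apply_subset ℝ (0, 1)
  refine ⟨?_, ?_, hs.trans h.2.2⟩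
  · exact (h.1.fderiv_right (m := ∞) (by simp)).clm_apply contDiff_const
  · exact h.2.1.of_isClosed_subset (isClosed_tsupport _) hs

theorem dx_dy_comm {φ : ℝ × ℝ → ℝ} (h : ContDiff ℝ ∞ φ) : dx (dy φ) = dy (dx φ) := by
  have hd : Differentiable ℝ (fderiv ℝ φ) :=
    (h.fderiv_right (m := 1) (by norm_cast)).differentiable (by simp)
  ext p
  have h1 : ∀ u v : ℝ × ℝ, fderiv ℝ (fun q => fderiv ℝ φ q u) p v =
      fderiv ℝ (fderiv ℝ φ) p v u := by
    intro u v
    rw [fderiv_clm_apply (hd p) (differentiableAt_const u)]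
    simp
  have hsymm : IsSymmSndFDerivAt ℝ φ p :=
    h.contDiffAt.isSymmSndFDerivAt (by simp; norm_cast)
  change fderiv ℝ (fun q => fderiv ℝ φ q (0, 1)) p (1, 0) =
    fderiv ℝ (fun q => fderiv ℝ φ q (1, 0)) p (0, 1)
  rw [h1, h1]
  exact hsymm _ _

theorem IsTest.swap {φ : ℝ × ℝ → ℝ} (hφ : IsTest Ω φ) : IsTest Ω (fun p => φ p.swap) := by
  have hts : tsupport (fun p : ℝ × ℝ => φ p.swap) = Prod.swap ⁻¹' tsupport φ :=
    tsupport_comp_eq_preimage φ (Homeomorph.prodComm ℝ ℝ)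
  refine ⟨hφ.1.comp (contDiff_snd.prodMk contDiff_fst),
    hφ.2.1.comp_homeomorph (Homeomorph.prodComm ℝ ℝ), ?_⟩
  rw [hts]
  intro p hp
  have := hφ.2.2 hp
  exact ⟨this.2, this.1⟩

theorem fderiv_comp_swap {φ : ℝ × ℝ → ℝ} (hφ : Differentiable ℝ φ) (p v : ℝ × ℝ) :
    fderiv ℝ (fun p : ℝ × ℝ => φ p.swap) p v = fderiv ℝ φ p.swap v.swap := by
  have h1 : HasFDerivAt (fun p : ℝ × ℝ => p.swap)
      ((ContinuousLinearMap.snd ℝ ℝ ℝ).prod (ContinuousLinearMap.fst ℝ ℝ ℝ)) p :=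
    hasFDerivAt_snd.prodMk hasFDerivAt_fst
  have h3 : HasFDerivAt (fun p : ℝ × ℝ => φ p.swap) _ p := (hφ p.swap).hasFDerivAt.comp p h1
  rw [h3.fderiv]
  simp [Prod.swap]

theorem dx_swap {φ : ℝ × ℝ → ℝ} (hφ : Differentiable ℝ φ) (p : ℝ × ℝ) :
    dx (fun p => φ p.swap) p = dy φ p.swap := fderiv_comp_swap hφ p (1, 0)

theorem dy_swap {φ : ℝ × ℝ → ℝ} (hφ : Differentiable ℝ φ) (p : ℝ × ℝ) :
    dy (fun p => φ p.swap) p = dx φ p.swap := fderiv_comp_swap hφ p (0, 1)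

theorem HasWeakDeriv.swap {w d : ℝ × ℝ → ℝ} (h : HasWeakDeriv Ω 0 1 w d) :
    HasWeakDeriv Ω 1 0 (fun p => w p.swap) (fun p => d p.swap) := by
  refine ⟨memLp_rect_swap h.1, fun φ hφ => ?_⟩
  have h2 := h.2 _ hφ.swap
  simp only [Function.iterate_zero, Function.iterate_succ, Function.comp, id,
    dy_swap (hφ.1.differentiable (by simp))] at h2 ⊢
  have e1 := integral_rect_swap 0 1 0 1 (fun p => w p.swap * dx φ p)
  have e2 := integral_rect_swap 0 1 0 1 (fun p => d p.swap * φ p)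
  simp only [Prod.swap_swap] at e1 e2
  rw [Ω] at *
  rw [← e1, ← e2]
  simpa using h2

theorem weakDeriv_spec {U : Set (ℝ × ℝ)} {k : ℕ} {u : ℝ × ℝ → ℝ} (h : MemSobolev U k u) {i j : ℕ}
    (hij : i + j ≤ k) : HasWeakDeriv U i j u (weakDeriv U i j u) := by
  have h1 := h.2 i j hij
  rw [weakDeriv, dif_pos h1]
  exact h1.choose_spec

theorem IsTest.iterate_dy {U : Set (ℝ × ℝ)} {φ : ℝ × ℝ → ℝ} (h : IsTest U φ) (j : ℕ) :
    IsTest U (WG.dy^[j] φ) := by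
  induction j with
  | zero => exact h
  | succ j ih => rw [Function.iterate_succ_apply']; exact ih.dy

theorem IsTest.iterate_dy_dx {U : Set (ℝ × ℝ)} {φ : ℝ × ℝ → ℝ} (h : IsTest U φ) (j : ℕ) :
    WG.dy^[j] (WG.dx φ) = WG.dx (WG.dy^[j] φ) := by
  induction j with
  | zero => rfl
  | succ j ih =>
    rw [Function.iterate_succ_apply', ih, Function.iterate_succ_apply', dx_dy_comm
      (h.iterate_dy j).1]

/-- Insert `∂φ/∂x` as a test function for the lower derivative. In the definition the
`x`-derivatives act after the `y`-derivatives, so the two have to be commuted first. -/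
theorem HasWeakDeriv.dx_step {U : Set (ℝ × ℝ)} {i j : ℕ} {u d d' : ℝ × ℝ → ℝ}
    (h : HasWeakDeriv U i j u d) (h' : HasWeakDeriv U (i + 1) j u d') :
    HasWeakDeriv U 1 0 d d' := by
  refine ⟨h'.1, fun φ hφ => ?_⟩
  have h1 := h.2 _ hφ.dx
  have h2 := h'.2 _ hφ
  rw [hφ.iterate_dy_dx, ← Function.iterate_succ_apply, h2] at h1
  have h3 : ((-1 : ℝ) ^ (i + j)) ≠ 0 := by simp
  have h4 : (-1 : ℝ) ^ (i + 1 + j) = (-1) ^ (i + j) * (-1) := by ring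
  rw [h4, mul_assoc] at h1
  have h5 := mul_left_cancel₀ h3 h1
  simpa using h5.symm

theorem HasWeakDeriv.dy_step {U : Set (ℝ × ℝ)} {i j : ℕ} {u d d' : ℝ × ℝ → ℝ}
    (h : HasWeakDeriv U i j u d) (h' : HasWeakDeriv U i (j + 1) u d') :
    HasWeakDeriv U 0 1 d d' := by
  refine ⟨h'.1, fun φ hφ => ?_⟩
  have h1 := h.2 _ hφ.dy
  have h2 := h'.2 _ hφ
  rw [← Function.iterate_succ_apply, h2] at h1
  have h3 : ((-1 : ℝ) ^ (i + j)) ≠ 0 := by simp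
  have h4 : (-1 : ℝ) ^ (i + (j + 1)) = (-1) ^ (i + j) * (-1) := by ring
  rw [h4, mul_assoc] at h1
  have h5 := mul_left_cancel₀ h3 h1
  simpa using h5.symm

theorem integrableOn_of_memLp {a b c d : ℝ} {w : ℝ × ℝ → ℝ}
    (hw : MemLp w 2 (volume.restrict (rect a b c d))) : IntegrableOn w (rect a b c d) :=
  hw.integrable (by norm_num)

theorem memLp_rect_mono {a b c d a' b' c' d' : ℝ} {w : ℝ × ℝ → ℝ}
    (hw : MemLp w 2 (volume.restrict (rect a' b' c' d'))) (ha : a' ≤ a) (hb : b ≤ b') (hc : c' ≤ c)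
    (hd : d ≤ d') : MemLp w 2 (volume.restrict (rect a b c d)) :=
  hw.mono_measure (Measure.restrict_mono (rect_mono ha hb hc hd) le_rfl)

theorem setIntegral_eq_of_isTest {U V : Set (ℝ × ℝ)} (hUV : U ⊆ V) {F : ℝ × ℝ → ℝ}
    (h : ∀ p, p ∉ U → F p = 0) : ∫ p in V, F p = ∫ p in U, F p := by
  rw [setIntegral_eq_integral_of_forall_compl_eq_zero h,
    setIntegral_eq_integral_of_forall_compl_eq_zero fun p hp => h p fun hp' => hp (hUV hp')]

theorem HasWeakDeriv.integral_add_eq_zero {a b c d : ℝ} {w w' : ℝ × ℝ → ℝ}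
    (hw : MemLp w 2 (volume.restrict Ω)) (h : HasWeakDeriv Ω 1 0 w w') (ha : 0 ≤ a) (hb : b ≤ 1)
    (hc : 0 ≤ c) (hd : d ≤ 1) {φ : ℝ × ℝ → ℝ} (hφ : IsTest (rect a b c d) φ) :
    ∫ p in rect a b c d, (w p * dx φ p + w' p * φ p) = 0 := by
  have hsub : rect a b c d ⊆ Ω := rect_mono ha hb hc hd
  have h2 := h.2 φ (hφ.mono hsub)
  simp only [Function.iterate_zero, Function.iterate_succ, Function.comp, id] at h2
  rw [setIntegral_eq_of_isTest hsub (fun p hp => by rw [hφ.dx.eq_zero hp, mul_zero]),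
    setIntegral_eq_of_isTest hsub (fun p hp => by rw [hφ.eq_zero hp, mul_zero])] at h2
  rw [integral_add (integrableOn_rect_mul (integrableOn_of_memLp (memLp_rect_mono hw ha hb hc hd))
    hφ.dx.1.continuous) (integrableOn_rect_mul (integrableOn_of_memLp
    (memLp_rect_mono h.1 ha hb hc hd)) hφ.1.continuous), h2]
  simp

theorem HasWeakDeriv.greenX {c d : ℝ} {w w' : ℝ × ℝ → ℝ}
    (hw : MemLp w 2 (volume.restrict Ω)) (h : HasWeakDeriv Ω 1 0 w w')
    (hc : 0 ≤ c) (hd : d ≤ 1) : GreenX 0 1 c d w w' := by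
  refine greenX_of_forall_isTest1 one_pos
    (integrableOn_of_memLp (memLp_rect_mono hw le_rfl le_rfl hc hd))
    (integrableOn_of_memLp (memLp_rect_mono h.1 le_rfl le_rfl hc hd)) fun η χ hη hχ => ?_
  refine Eq.trans ?_ (h.integral_add_eq_zero hw le_rfl le_rfl hc hd (isTest_tensor hη hχ))
  congr 1; ext p
  rw [dx_tensor (hη.1.differentiable (by simp)) (hχ.1.differentiable (by simp))]
  ring

/-! ### Estimates -/

/-- Cauchy–Schwarz against the constant 1, from the nonnegativity of `∫ (|w| - m)²` at the best
constant `m`, the mean of `|w|`. A rectangle of area zero is treated apart. -/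
theorem sq_integral_abs_le {a b c d : ℝ} (hab : a ≤ b) (hcd : c ≤ d) {w : ℝ × ℝ → ℝ}
    (hw : MemLp w 2 (volume.restrict (rect a b c d))) :
    (∫ p in rect a b c d, |w p|) ^ 2 ≤ (b - a) * (d - c) * ∫ p in rect a b c d, w p ^ 2 := by
  have h1 : IntegrableOn (fun p => |w p|) (rect a b c d) := (integrableOn_of_memLp hw).abs
  have h2 : IntegrableOn (fun p => w p ^ 2) (rect a b c d) := hw.integrable_sq
  set I := ∫ p in rect a b c d, |w p| with hI
  set A := (b - a) * (d - c) with hA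
  have hA0 : 0 ≤ A := mul_nonneg (by linarith) (by linarith)
  have key : ∀ m : ℝ, 0 ≤ (∫ p in rect a b c d, w p ^ 2) - 2 * m * I + m ^ 2 * A := by
    intro m
    have h3 : 0 ≤ ∫ p in rect a b c d, (|w p| - m) ^ 2 := integral_nonneg fun p => sq_nonneg _
    have h4 : ∫ p in rect a b c d, (|w p| - m) ^ 2 =
        (∫ p in rect a b c d, w p ^ 2) - 2 * m * I + m ^ 2 * A := by
      have hc : ∫ p in rect a b c d, m ^ 2 = m ^ 2 * A := by
        rw [setIntegral_const, volume_real_rect hab hcd, smul_eq_mul]; ring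
      rw [hI, ← hc, ← integral_const_mul, ← integral_sub h2 (h1.const_mul _),
        ← integral_add (f := fun p => w p ^ 2 - 2 * m * |w p|) (g := fun _ => m ^ 2)
          (Integrable.sub h2 (h1.const_mul _)) (integrable_const _)]
      congr 1; ext p
      rw [sub_sq, sq_abs]; ring
    rwa [h4] at h3
  rcases hA0.eq_or_lt with h0 | h0
  · have hI0 : I = 0 := by
      have hv : (volume : Measure (ℝ × ℝ)).real (rect a b c d) = 0 := by
        rw [volume_real_rect hab hcd]; exact h0.symm
      have hv' : (volume : Measure (ℝ × ℝ)) (rect a b c d) = 0 :=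
        (measureReal_eq_zero_iff (volume_rect_ne_top a b c d)).1 hv
      rw [hI, Measure.restrict_eq_zero.2 hv']; simp
    rw [hI0, ← h0]; simp
  · have h5 := key (I / A)
    have h6 : (∫ p in rect a b c d, w p ^ 2) - 2 * (I / A) * I + (I / A) ^ 2 * A =
        (∫ p in rect a b c d, w p ^ 2) - I ^ 2 / A := by field_simp; ring
    rw [h6, sub_nonneg, div_le_iff₀ h0] at h5
    linarith

theorem abs_integral_mul_le {a b c d K : ℝ} {w : ℝ × ℝ → ℝ}
    (hw : IntegrableOn w (rect a b c d)) {g : ℝ × ℝ → ℝ}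
    (hgK : ∀ p ∈ rect a b c d, |g p| ≤ K) :
    |∫ p in rect a b c d, w p * g p| ≤ K * ∫ p in rect a b c d, |w p| := by
  rw [← integral_const_mul]
  refine norm_integral_le_of_norm_le (f := fun p => w p * g p)
    (μ := volume.restrict (rect a b c d)) (hw.abs.const_mul K) ?_
  filter_upwards [ae_restrict_mem (measurableSet_rect a b c d)] with p hp
  rw [Real.norm_eq_abs, abs_mul, mul_comm]
  exact mul_le_mul_of_nonneg_right (hgK p hp) (abs_nonneg _)

theorem sq_integral_mul_le {a b c d K : ℝ} (hab : a ≤ b) (hcd : c ≤ d) {w : ℝ × ℝ → ℝ}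
    (hw : MemLp w 2 (volume.restrict (rect a b c d))) {g : ℝ × ℝ → ℝ}
    (hgK : ∀ p ∈ rect a b c d, |g p| ≤ K) :
    (∫ p in rect a b c d, w p * g p) ^ 2 ≤
      K ^ 2 * ((b - a) * (d - c) * ∫ p in rect a b c d, w p ^ 2) := by
  have h1 := abs_integral_mul_le (integrableOn_of_memLp hw) hgK
  calc (∫ p in rect a b c d, w p * g p) ^ 2
      = |∫ p in rect a b c d, w p * g p| ^ 2 := (sq_abs _).symm
    _ ≤ (K * ∫ p in rect a b c d, |w p|) ^ 2 := pow_le_pow_left₀ (abs_nonneg _) h1 2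
    _ = K ^ 2 * (∫ p in rect a b c d, |w p|) ^ 2 := by ring
    _ ≤ _ := mul_le_mul_of_nonneg_left (sq_integral_abs_le hab hcd hw) (sq_nonneg K)

/-- The case `χ = 1`: `V t` plays the role of the integral of the trace of `w` over the segment at
abscissa `t`. One `V` serves all `s` and `t`, so boundary terms from adjacent rectangles can be
compared. -/
theorem GreenX.exists_boundary_values {a b c d : ℝ} {w w' : ℝ × ℝ → ℝ} (h : GreenX a b c d w w')
    (hw : IntegrableOn w (rect a b c d)) (hw' : IntegrableOn w' (rect a b c d)) :
    ∃ V : ℝ → ℝ, ∀ s t, a ≤ s → s ≤ t → t ≤ b → ∀ p : ℝ → ℝ, ContDiff ℝ 1 p →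
      (∫ q in rect s t c d, w q * deriv p q.1) + (∫ q in rect s t c d, w' q * p q.1) =
        V t * p t - V s * p s := by
  obtain ⟨V, hV⟩ := h (fun _ => 1) continuous_const
  refine ⟨V, fun s t hs hst ht p hp => ?_⟩
  have hsub := rect_mono hs ht le_rfl le_rfl (c := c) (d := d)
  rw [← hV s t hs hst ht p hp]
  refine (integral_add
    (integrableOn_rect_mul (hw.mono_set hsub) ((hp.continuous_deriv le_rfl).comp continuous_fst))
    (integrableOn_rect_mul (hw'.mono_set hsub) (hp.continuous.comp continuous_fst))).symm.trans ?_
  simp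

/-- The primitive `p` of the weight vanishes at both ends, so integration by parts leaves no
boundary term and moves the derivative onto `w`; Cauchy–Schwarz does the rest. A weight of mean zero
thus gains a power of the width. -/
theorem GreenX.sq_integral_mul_deriv_le {a b c d : ℝ} {w w' : ℝ × ℝ → ℝ}
    (h : GreenX a b c d w w') (hw : IntegrableOn w (rect a b c d))
    (hw' : MemLp w' 2 (volume.restrict (rect a b c d))) {s t : ℝ} (hs : a ≤ s) (hst : s ≤ t)
    (ht : t ≤ b) (hcd : c ≤ d) {p p' : ℝ → ℝ} (hp : ∀ x, HasDerivAt p (p' x) x)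
    (hp' : Continuous p') (hps : p s = 0) (hpt : p t = 0) {K : ℝ}
    (hK : ∀ x ∈ Ioo s t, |p x| ≤ K) :
    (∫ q in rect s t c d, w q * p' q.1) ^ 2 ≤
      K ^ 2 * ((t - s) * (d - c) * ∫ q in rect s t c d, w' q ^ 2) := by
  obtain ⟨V, hV⟩ := h.exists_boundary_values hw (integrableOn_of_memLp hw')
  have hd : deriv p = p' := funext fun x => (hp x).deriv
  have hp1 : ContDiff ℝ 1 p := contDiff_one_iff_deriv.2
    ⟨fun x => (hp x).differentiableAt, by rwa [hd]⟩
  have h1 := hV s t hs hst ht p hp1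
  rw [hps, hpt, hd, mul_zero, mul_zero, sub_zero, add_eq_zero_iff_eq_neg] at h1
  rw [h1, neg_sq]
  exact sq_integral_mul_le hst hcd (memLp_rect_mono hw' hs ht le_rfl le_rfl)
    fun q hq => hK q.1 hq.1

theorem GreenX.sq_integral_mul_sub_mid_le {a b c d : ℝ} {w w' : ℝ × ℝ → ℝ}
    (h : GreenX a b c d w w') (hw : IntegrableOn w (rect a b c d))
    (hw' : MemLp w' 2 (volume.restrict (rect a b c d))) {s t : ℝ} (hs : a ≤ s) (hst : s ≤ t)
    (ht : t ≤ b) (hcd : c ≤ d) :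
    (∫ q in rect s t c d, w q * (q.1 - (s + t) / 2)) ^ 2 ≤
      ((t - s) ^ 2) ^ 2 * ((t - s) * (d - c) * ∫ q in rect s t c d, w' q ^ 2) := by
  refine h.sq_integral_mul_deriv_le hw hw' hs hst ht hcd
    -- The constant `1/8` makes this primitive vanish at both end points.
    (p := fun x => (x - (s + t) / 2) ^ 2 / 2 - (t - s) ^ 2 / 8)
    (p' := fun x => x - (s + t) / 2) (fun x => ?_) (by fun_prop) (by ring) (by ring) ?_
  · have := ((((hasDerivAt_id x).sub_const ((s + t) / 2)).pow 2).div_const 2).sub_const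
      ((t - s) ^ 2 / 8)
    exact HasDerivAt.congr_deriv this (by simp)
  · intro x hx
    have h1 := hx.1
    have h2 := hx.2
    rw [abs_le]
    constructor <;> nlinarith [mul_pos (sub_pos.2 h1) (sub_pos.2 h2), sq_nonneg (x - (s + t) / 2)]

theorem GreenX.sq_integral_mul_quadratic_le {a b c d : ℝ} {w w' : ℝ × ℝ → ℝ}
    (h : GreenX a b c d w w') (hw : IntegrableOn w (rect a b c d))
    (hw' : MemLp w' 2 (volume.restrict (rect a b c d))) {s t : ℝ} (hs : a ≤ s) (hst : s ≤ t)
    (ht : t ≤ b) (hcd : c ≤ d) :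
    (∫ q in rect s t c d, w q * ((q.1 - (s + t) / 2) ^ 2 / 2 - (t - s) ^ 2 / 24)) ^ 2 ≤
      ((t - s) ^ 3) ^ 2 * ((t - s) * (d - c) * ∫ q in rect s t c d, w' q ^ 2) := by
  refine h.sq_integral_mul_deriv_le hw hw' hs hst ht hcd
    -- The constant `1/24` in the weight is its mean-zero normalization: it makes this cubic vanish
    -- at both ends.
    (p := fun x => (x - (s + t) / 2) ^ 3 / 6 - (x - (s + t) / 2) * (t - s) ^ 2 / 24)
    (p' := fun x => (x - (s + t) / 2) ^ 2 / 2 - (t - s) ^ 2 / 24)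
    (fun x => ?_) (by fun_prop) (by ring) (by ring) ?_
  · have h1 := ((hasDerivAt_id x).sub_const ((s + t) / 2))
    have := ((h1.pow 3).div_const 6).sub ((h1.mul_const ((t - s) ^ 2)).div_const 24)
    exact HasDerivAt.congr_deriv this (by simp; ring)
  · intro x hx
    have h1 : |x - (s + t) / 2| ≤ t - s := by
      rw [abs_le]; constructor <;> linarith [hx.1, hx.2]
    have h3 : |x - (s + t) / 2| ^ 3 ≤ (t - s) ^ 3 := pow_le_pow_left₀ (abs_nonneg _) h1 3
    have h4 : |x - (s + t) / 2| * (t - s) ^ 2 ≤ (t - s) ^ 3 := by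
      calc _ ≤ (t - s) * (t - s) ^ 2 := mul_le_mul_of_nonneg_right h1 (sq_nonneg _)
        _ = _ := by ring
    have h5 : 0 ≤ (t - s) ^ 3 := pow_nonneg (by linarith) 3
    calc |(x - (s + t) / 2) ^ 3 / 6 - (x - (s + t) / 2) * (t - s) ^ 2 / 24|
        ≤ |(x - (s + t) / 2) ^ 3 / 6| + |(x - (s + t) / 2) * (t - s) ^ 2 / 24| := abs_sub _ _
      _ = |x - (s + t) / 2| ^ 3 / 6 + |x - (s + t) / 2| * (t - s) ^ 2 / 24 := by
        rw [abs_div, abs_div, abs_mul, abs_pow, abs_pow, sq_abs]; norm_num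
      _ ≤ _ := by linarith

/-- The mean values over adjacent intervals are close. -/
theorem GreenX.sq_mean_sub_mean_le {a b c d : ℝ} {w w' : ℝ × ℝ → ℝ}
    (h : GreenX a b c d w w') (hw : IntegrableOn w (rect a b c d))
    (hw' : MemLp w' 2 (volume.restrict (rect a b c d))) {s t r : ℝ} (hs : a ≤ s) (hst : s < t)
    (htr : t < r) (hr : r ≤ b) (hcd : c ≤ d) :
    ((∫ q in rect s t c d, w q) / (t - s) - (∫ q in rect t r c d, w q) / (r - t)) ^ 2 ≤
      2 * ((t - s) * (d - c) * ∫ q in rect s t c d, w' q ^ 2) +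
      2 * ((r - t) * (d - c) * ∫ q in rect t r c d, w' q ^ 2) := by
  obtain ⟨V, hV⟩ := h.exists_boundary_values hw (integrableOn_of_memLp hw')
  have hp : ∀ m k : ℝ, ContDiff ℝ 1 (fun x : ℝ => (x - m) / k) := fun m k => by fun_prop
  have hd : ∀ m k : ℝ, deriv (fun x : ℝ => (x - m) / k) = fun _ => 1 / k := fun m k => by
    funext x; exact (((hasDerivAt_id x).sub_const m).div_const k).deriv
  -- Two linear weights, each vanishing at its outer end, express both means through the same value
  -- `V t`, which cancels in the difference.
  have h1 := hV s t hs hst.le (htr.le.trans hr) _ (hp s (t - s))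
  have h2 := hV t r (hs.trans hst.le) htr.le hr _ (hp r (r - t))
  simp only [hd, integral_mul_const] at h1 h2
  have e1 : (t - s) / (t - s) = 1 := div_self (by linarith)
  have e2 : (t - r) / (r - t) = -1 := by
    rw [← neg_sub, neg_div, div_self (by linarith)]
  rw [e1] at h1
  rw [e2] at h2
  simp only [sub_self, zero_div, mul_zero, mul_one] at h1 h2
  have b1 := sq_integral_mul_le hst.le hcd (memLp_rect_mono hw' hs (htr.le.trans hr) le_rfl le_rfl)
    (g := fun q => (q.1 - s) / (t - s)) (K := 1) (fun q hq => by
      rw [abs_le]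
      constructor
      · rw [le_div_iff₀ (by linarith)]; linarith [hq.1.1, hq.1.2]
      · rw [div_le_iff₀ (by linarith)]; linarith [hq.1.1, hq.1.2])
  have b2 := sq_integral_mul_le htr.le hcd (memLp_rect_mono hw' (hs.trans hst.le) hr le_rfl le_rfl)
    (g := fun q => (q.1 - r) / (r - t)) (K := 1) (fun q hq => by
      rw [abs_le]
      constructor
      · rw [le_div_iff₀ (by linarith)]; linarith [hq.1.1, hq.1.2]
      · rw [div_le_iff₀ (by linarith)]; linarith [hq.1.1, hq.1.2])
  set P := ∫ q in rect s t c d, w' q * ((q.1 - s) / (t - s))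
  set Q := ∫ q in rect t r c d, w' q * ((q.1 - r) / (r - t))
  have e3 : (∫ q in rect s t c d, w q) / (t - s) - (∫ q in rect t r c d, w q) / (r - t) =
      Q - P := by
    rw [div_eq_mul_one_div, div_eq_mul_one_div (∫ q in rect t r c d, w q)]
    linarith
  rw [e3]
  nlinarith [sq_nonneg (P + Q)]

/-- Writing strip integrals as differences turns additivity over a partition into a telescoping sum.
-/
theorem exists_primitive_rect {c d : ℝ} {w : ℝ × ℝ → ℝ} (hw : IntegrableOn w (rect 0 1 c d)) :
    ∃ U : ℝ → ℝ, ∀ s t, 0 ≤ s → s ≤ t → t ≤ 1 → ∫ q in rect s t c d, w q = U t - U s := by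
  refine ⟨fun x => ∫ x in (0:ℝ)..x, ∫ y in Ioo c d, w (x, y), fun s t hs hst ht => ?_⟩
  have hi : IntegrableOn (fun x => ∫ y in Ioo c d, w (x, y)) (Ioo 0 1) := by
    have h1 := hw
    unfold IntegrableOn at h1 ⊢
    rw [volume_restrict_rect] at h1
    exact h1.integral_prod_left
  have hii : IntervalIntegrable (fun x => ∫ y in Ioo c d, w (x, y)) volume 0 1 :=
    (intervalIntegrable_iff_integrableOn_Ioo_of_le zero_le_one).2 hi
  rw [intervalIntegral.integral_interval_sub_left, intervalIntegral.integral_of_le hst,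
    integral_Ioc_eq_integral_Ioo]
  · have h1 := hw.mono_set (rect_mono hs ht le_rfl le_rfl)
    unfold IntegrableOn at h1
    rw [volume_restrict_rect] at h1 ⊢
    exact integral_prod _ h1
  · exact hii.mono_set (uIcc_subset_uIcc left_mem_uIcc
      (by rw [uIcc_of_le zero_le_one]; exact ⟨hs.trans hst, ht⟩))
  · exact hii.mono_set (uIcc_subset_uIcc left_mem_uIcc
      (by rw [uIcc_of_le zero_le_one]; exact ⟨hs, hst.trans ht⟩))

/-- The mean value over `(s, t)` is bounded by the norm on the whole interval. -/
theorem GreenX.sq_mean_le {c d : ℝ} {w w' : ℝ × ℝ → ℝ}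
    (h : GreenX 0 1 c d w w') (hw : MemLp w 2 (volume.restrict (rect 0 1 c d)))
    (hw' : MemLp w' 2 (volume.restrict (rect 0 1 c d))) {s t : ℝ} (hs : 0 ≤ s) (hst : s < t)
    (ht : t ≤ 1) (hcd : c ≤ d) :
    ((∫ q in rect s t c d, w q) / (t - s)) ^ 2 ≤
      18 * ((d - c) * ((∫ q in rect 0 1 c d, w q ^ 2) + ∫ q in rect 0 1 c d, w' q ^ 2)) := by
  have hwi := integrableOn_of_memLp hw
  have hwi' := integrableOn_of_memLp hw'
  obtain ⟨V, hV⟩ := h.exists_boundary_values hwi hwi'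
  have hp : ∀ m : ℝ, ContDiff ℝ 1 (fun x : ℝ => x - m) := fun m => by fun_prop
  have hd : ∀ m : ℝ, deriv (fun x : ℝ => x - m) = fun _ => 1 := fun m => by
    funext x; exact ((hasDerivAt_id x).sub_const m).deriv
  have h1 := hV s t hs hst.le ht _ (hp s)
  have h2 := hV 0 t le_rfl (hs.trans hst.le) ht _ (hp 0)
  have h3 := hV t 1 (hs.trans hst.le) ht le_rfl _ (hp 1)
  simp only [hd, mul_one, sub_self, sub_zero, mul_zero, zero_sub, deriv_id''] at h1 h2 h3
  have hsplit : (∫ q in rect 0 1 c d, w q) =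
      (∫ q in rect 0 t c d, w q) + ∫ q in rect t 1 c d, w q := by
    obtain ⟨U, hU⟩ := exists_primitive_rect hwi
    rw [hU 0 1 le_rfl zero_le_one le_rfl, hU 0 t le_rfl (hs.trans hst.le) ht,
      hU t 1 (hs.trans hst.le) ht le_rfl]
    ring
  have hmono : ∀ s t, 0 ≤ s → t ≤ 1 → ∫ q in rect s t c d, |w' q| ≤ ∫ q in rect 0 1 c d, |w' q| :=
    fun s t hs ht => setIntegral_mono_set hwi'.abs (ae_of_all _ fun q => abs_nonneg _)
      (rect_mono hs ht le_rfl le_rfl).eventuallyLE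
  have b1 : |∫ q in rect s t c d, w' q * (q.1 - s)| ≤ (t - s) * ∫ q in rect 0 1 c d, |w' q| :=
    (abs_integral_mul_le (hwi'.mono_set (rect_mono hs ht le_rfl le_rfl)) fun q hq => by
      rw [abs_le]; constructor <;> linarith [hq.1.1, hq.1.2]).trans
      (mul_le_mul_of_nonneg_left (hmono s t hs ht) (by linarith))
  have b2 : |∫ q in rect 0 t c d, w' q * q.1| ≤ 1 * ∫ q in rect 0 1 c d, |w' q| :=
    (abs_integral_mul_le (hwi'.mono_set (rect_mono le_rfl ht le_rfl le_rfl)) fun q hq => by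
      rw [abs_le]; constructor <;> linarith [hq.1.1, hq.1.2]).trans
      (mul_le_mul_of_nonneg_left (hmono 0 t le_rfl ht) (by linarith))
  have b3 : |∫ q in rect t 1 c d, w' q * (q.1 - 1)| ≤ 1 * ∫ q in rect 0 1 c d, |w' q| :=
    (abs_integral_mul_le (hwi'.mono_set (rect_mono (hs.trans hst.le) le_rfl le_rfl le_rfl))
      fun q hq => by
        rw [abs_le]; constructor <;> linarith [hq.1.1, hq.1.2]).trans
      (mul_le_mul_of_nonneg_left (hmono t 1 (hs.trans hst.le) le_rfl) (by linarith))
  have b4 : |∫ q in rect 0 1 c d, w q| ≤ ∫ q in rect 0 1 c d, |w q| := abs_integral_le_integral_abs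
  have c1 := sq_integral_abs_le zero_le_one hcd hw
  have c2 := sq_integral_abs_le zero_le_one hcd hw'
  set I := ∫ q in rect 0 1 c d, |w q|
  set J := ∫ q in rect 0 1 c d, |w' q|
  have hts : 0 < t - s := sub_pos.2 hst
  -- The mean differs from `V t` by at most `J`. The weights `x` on `(0, t)` and `x - 1` on `(t, 1)`
  -- bound `V t` itself by `I + 2J`.
  have hmean : |(∫ q in rect s t c d, w q) / (t - s)| ≤ I + 3 * J := by
    have e1 : (∫ q in rect s t c d, w q) / (t - s) =
        V t - (∫ q in rect s t c d, w' q * (q.1 - s)) / (t - s) := by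
      field_simp; linarith
    have e2 : |(∫ q in rect s t c d, w' q * (q.1 - s)) / (t - s)| ≤ J := by
      rw [abs_div, abs_of_pos hts, div_le_iff₀ hts]; linarith
    have e3 : |V t| ≤ I + 2 * J := by
      have : V t = (∫ q in rect 0 1 c d, w q) + (∫ q in rect 0 t c d, w' q * q.1) +
          ∫ q in rect t 1 c d, w' q * (q.1 - 1) := by rw [hsplit]; linarith
      rw [this]
      refine (abs_add_three _ _ _).trans ?_
      linarith
    rw [e1]
    refine (abs_sub _ _).trans ?_
    linarith
  have hIJ := pow_le_pow_left₀ (abs_nonneg _) hmean 2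
  rw [sq_abs] at hIJ
  have : (0:ℝ) ≤ (d - c) * ∫ q in rect 0 1 c d, w q ^ 2 :=
    mul_nonneg (by linarith) (integral_nonneg fun q => sq_nonneg _)
  nlinarith [sq_nonneg (I - 3 * J)]

/-! ### Sums over cells and cell means -/

theorem sum_succ_sub_castSucc {n : ℕ} (f : Fin (n + 1) → ℝ) :
    ∑ i : Fin n, (f i.succ - f i.castSucc) = f (Fin.last n) - f 0 := by
  rw [Finset.sum_sub_distrib]
  have h1 := Fin.sum_univ_succ f
  have h2 := Fin.sum_univ_castSucc f
  linarith

namespace RectMesh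

variable (M : RectMesh)

theorem x_nonneg (i : Fin (M.n + 1)) : 0 ≤ M.x i := by
  rw [← M.x_first]; exact M.x_mono.monotone (Fin.zero_le _)

theorem x_le_one (i : Fin (M.n + 1)) : M.x i ≤ 1 := by
  rw [← M.x_last]; exact M.x_mono.monotone (Fin.le_last _)

theorem y_nonneg (i : Fin (M.m + 1)) : 0 ≤ M.y i := by
  rw [← M.y_first]; exact M.y_mono.monotone (Fin.zero_le _)

theorem y_le_one (i : Fin (M.m + 1)) : M.y i ≤ 1 := by
  rw [← M.y_last]; exact M.y_mono.monotone (Fin.le_last _)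

theorem x_lt (i : Fin M.n) : M.x i.castSucc < M.x i.succ := M.x_mono Fin.castSucc_lt_succ

theorem y_lt (j : Fin M.m) : M.y j.castSucc < M.y j.succ := M.y_mono Fin.castSucc_lt_succ

theorem hx_pos (T : M.Cell) : 0 < M.hx T := sub_pos.2 (M.x_lt _)

theorem hy_pos (T : M.Cell) : 0 < M.hy T := sub_pos.2 (M.y_lt _)

theorem cell_subset (T : M.Cell) : M.cell T ⊆ Ω :=
  rect_mono (M.x_nonneg _) (M.x_le_one _) (M.y_nonneg _) (M.y_le_one _)

theorem volume_real_cell (T : M.Cell) :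
    (volume : Measure (ℝ × ℝ)).real (M.cell T) = M.hx T * M.hy T :=
  volume_real_rect (M.x_lt _).le (M.y_lt _).le

/-- The partition with the two coordinates exchanged. -/
def swap : RectMesh where
  n := M.m
  m := M.n
  x := M.y
  y := M.x
  x_mono := M.y_mono
  y_mono := M.x_mono
  x_first := M.y_first
  x_last := M.y_last
  y_first := M.x_first
  y_last := M.x_last

theorem integral_cell_swap (T : M.Cell) (F : ℝ × ℝ → ℝ) :
    ∫ p in M.swap.cell T.swap, F p.swap = ∫ p in M.cell T, F p :=
  integral_rect_swap _ _ _ _ F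

/-- The mean value on an element. -/
noncomputable def mean (w : ℝ × ℝ → ℝ) (T : M.Cell) : ℝ :=
  (∫ p in M.cell T, w p) / (M.hx T * M.hy T)

theorem mean_swap (w : ℝ × ℝ → ℝ) (T : M.Cell) :
    M.swap.mean (fun p => w p.swap) T.swap = M.mean w T := by
  unfold mean
  rw [integral_cell_swap, mul_comm]; rfl

theorem mean_mul (w : ℝ × ℝ → ℝ) (T : M.Cell) :
    M.mean w T * (M.hx T * M.hy T) = ∫ p in M.cell T, w p :=
  div_mul_cancel₀ _ (mul_pos (M.hx_pos T) (M.hy_pos T)).ne'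

theorem sum_row {w : ℝ × ℝ → ℝ} {c d : ℝ} (hw : IntegrableOn w (rect 0 1 c d)) :
    ∑ i : Fin M.n, ∫ p in rect (M.x i.castSucc) (M.x i.succ) c d, w p =
      ∫ p in rect 0 1 c d, w p := by
  obtain ⟨U, hU⟩ := exists_primitive_rect hw
  rw [hU 0 1 le_rfl zero_le_one le_rfl, ← M.x_last, ← M.x_first,
    ← sum_succ_sub_castSucc fun i => U (M.x i)]
  exact Finset.sum_congr rfl fun i _ => hU _ _ (M.x_nonneg _) (M.x_lt i).le (M.x_le_one _)

theorem sum_rows {w : ℝ × ℝ → ℝ} (hw : IntegrableOn w Ω) :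
    ∑ j : Fin M.m, ∫ p in rect 0 1 (M.y j.castSucc) (M.y j.succ), w p = ∫ p in Ω, w p := by
  rw [Ω, ← integral_rect_swap, ← M.swap.sum_row (integrableOn_rect_swap hw)]
  exact Finset.sum_congr rfl fun j _ => (integral_rect_swap _ _ _ _ _).symm

theorem sum_cells {w : ℝ × ℝ → ℝ} (hw : IntegrableOn w Ω) :
    ∑ T : M.Cell, ∫ p in M.cell T, w p = ∫ p in Ω, w p := by
  rw [← M.sum_rows hw, Fintype.sum_prod_type_right]
  exact Finset.sum_congr rfl fun j _ => M.sum_row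
    (hw.mono_set (rect_mono le_rfl le_rfl (M.y_nonneg j.castSucc) (M.y_le_one j.succ)))

theorem sum_swap (F : M.Cell → ℝ) : ∑ T : M.swap.Cell, F T.swap = ∑ T : M.Cell, F T :=
  Equiv.sum_comp (Equiv.prodComm (Fin M.m) (Fin M.n)) F

/-- All sides of all elements have a length between `k h` and `h`. -/
def QuasiUniform (k h : ℝ) : Prop :=
  ∀ T : M.Cell, (k * h ≤ M.hx T ∧ M.hx T ≤ h) ∧ (k * h ≤ M.hy T ∧ M.hy T ≤ h)

variable {M}

theorem QuasiUniform.swap {k h : ℝ} (H : M.QuasiUniform k h) : M.swap.QuasiUniform k h :=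
  fun T => ⟨(H T.swap).2, (H T.swap).1⟩

/-- A trace-type inequality for one column of cells: averages over a thin strip in `x` are
controlled by the `L²` norms of `w` and `∂w/∂x` on the whole row. The factor is `h⁻¹`, whereas
bounding each mean on its own cell would give `h⁻²`. This is where the half power of `h` is gained.
-/
theorem sum_sq_mean_le {k h : ℝ} (hk : 0 < k) (hh : 0 < h) (H : M.QuasiUniform k h)
    {w w' : ℝ × ℝ → ℝ} (hw : MemLp w 2 (volume.restrict Ω)) (h' : HasWeakDeriv Ω 1 0 w w')
    (i : Fin M.n) :
    ∑ j : Fin M.m, M.mean w (i, j) ^ 2 ≤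
      18 / (k * h) * ((∫ p in Ω, w p ^ 2) + ∫ p in Ω, w' p ^ 2) := by
  rw [← M.sum_rows hw.integrable_sq, ← M.sum_rows h'.1.integrable_sq, ← Finset.sum_add_distrib,
    Finset.mul_sum]
  refine Finset.sum_le_sum fun j _ => ?_
  have hg := h'.greenX hw (M.y_nonneg j.castSucc) (M.y_le_one j.succ)
  have e := hg.sq_mean_le (memLp_rect_mono hw le_rfl le_rfl (M.y_nonneg _) (M.y_le_one _))
    (memLp_rect_mono h'.1 le_rfl le_rfl (M.y_nonneg _) (M.y_le_one _)) (M.x_nonneg _) (M.x_lt i)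
    (M.x_le_one _) (M.y_lt j).le
  have hkh : k * h ≤ M.hy (i, j) := (H (i, j)).2.1
  have hkh0 : 0 < k * h := mul_pos hk hh
  have hy := M.hy_pos (i, j)
  set S := (∫ p in rect 0 1 (M.y j.castSucc) (M.y j.succ), w p ^ 2) +
    ∫ p in rect 0 1 (M.y j.castSucc) (M.y j.succ), w' p ^ 2 with hS
  have hS0 : 0 ≤ S := add_nonneg (integral_nonneg fun _ => sq_nonneg _)
    (integral_nonneg fun _ => sq_nonneg _)
  have e2 : M.mean w (i, j) = (∫ p in M.cell (i, j), w p) / M.hx (i, j) / M.hy (i, j) := by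
    rw [mean, div_div]
  rw [e2, div_pow, div_le_iff₀ (by positivity)]
  refine e.trans ?_
  change 18 * (M.hy (i, j) * S) ≤ _
  have e3 : 18 / (k * h) * S * M.hy (i, j) ^ 2 =
      18 * (M.hy (i, j) * S) * (M.hy (i, j) / (k * h)) := by
    field_simp
  rw [e3]
  refine le_mul_of_one_le_right (by positivity) ?_
  rwa [one_le_div hkh0]

/-- The strip estimate divided by the square of the row height. As widths are at most the height
divided by `k`, the resulting constant is free of `h`. -/
theorem sq_mean_sub_mean_le {k h : ℝ} (hk : 0 < k) (hh : 0 < h) (H : M.QuasiUniform k h)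
    {w w' : ℝ × ℝ → ℝ} (hw : MemLp w 2 (volume.restrict Ω)) (h' : HasWeakDeriv Ω 1 0 w w')
    {i i' : Fin M.n} (hi : i.succ = i'.castSucc) (j : Fin M.m) :
    (M.mean w (i, j) - M.mean w (i', j)) ^ 2 ≤
      2 / k * ((∫ p in M.cell (i, j), w' p ^ 2) + ∫ p in M.cell (i', j), w' p ^ 2) := by
  have hg := h'.greenX hw (M.y_nonneg j.castSucc) (M.y_le_one j.succ)
  have e := hg.sq_mean_sub_mean_le (integrableOn_of_memLp
    (memLp_rect_mono hw le_rfl le_rfl (M.y_nonneg _) (M.y_le_one _)))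
    (memLp_rect_mono h'.1 le_rfl le_rfl (M.y_nonneg _) (M.y_le_one _)) (M.x_nonneg _) (M.x_lt i)
    (t := M.x i.succ) (r := M.x i'.succ) (by rw [hi]; exact M.x_lt i')
    (M.x_le_one _) (M.y_lt j).le
  have hkh : k * h ≤ M.hy (i, j) := (H (i, j)).2.1
  have hkh0 : 0 < k * h := mul_pos hk hh
  have hy := M.hy_pos (i, j)
  have hx1 : M.hx (i, j) ≤ h := (H (i, j)).1.2
  have hx2 : M.hx (i', j) ≤ h := (H (i', j)).1.2
  have e2 : M.mean w (i, j) = (∫ p in M.cell (i, j), w p) / M.hx (i, j) / M.hy (i, j) := by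
    rw [mean, div_div]
  have e3 : M.mean w (i', j) = (∫ p in M.cell (i', j), w p) / M.hx (i', j) / M.hy (i, j) := by
    rw [mean, div_div]; rfl
  rw [e2, e3, ← sub_div, div_pow, div_le_iff₀ (by positivity)]
  have e' : ((∫ p in M.cell (i, j), w p) / M.hx (i, j) -
      (∫ p in M.cell (i', j), w p) / M.hx (i', j)) ^ 2 ≤
      2 * (M.hx (i, j) * M.hy (i, j) * ∫ p in M.cell (i, j), w' p ^ 2) +
      2 * (M.hx (i', j) * M.hy (i, j) * ∫ p in M.cell (i', j), w' p ^ 2) := by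
    have h1 : M.cell (i', j) = rect (M.x i.succ) (M.x i'.succ) (M.y j.castSucc) (M.y j.succ) := by
      rw [hi]; rfl
    have h2 : M.hx (i', j) = M.x i'.succ - M.x i.succ := by rw [hi]; rfl
    rw [h1, h2]
    exact e
  refine e'.trans ?_
  set P := ∫ p in M.cell (i, j), w' p ^ 2
  set Q := ∫ p in M.cell (i', j), w' p ^ 2
  have hP : 0 ≤ P := integral_nonneg fun _ => sq_nonneg _
  have hQ : 0 ≤ Q := integral_nonneg fun _ => sq_nonneg _
  have h3 : h ≤ M.hy (i, j) / k := by rw [le_div_iff₀ hk]; linarith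
  have h4 : M.hx (i, j) * M.hy (i, j) * P ≤ M.hy (i, j) / k * M.hy (i, j) * P := by
    gcongr; linarith
  have h5 : M.hx (i', j) * M.hy (i, j) * Q ≤ M.hy (i, j) / k * M.hy (i, j) * Q := by
    gcongr; linarith
  calc _ ≤ 2 * (M.hy (i, j) / k * M.hy (i, j) * P) + 2 * (M.hy (i, j) / k * M.hy (i, j) * Q) := by
        linarith
    _ = _ := by ring

end RectMesh

/-! ### Values on grid lines that compensate for given cell values -/

/-- Interpolation on lines of values `-Y/2` on cells, with the value zero on some lines. -/
theorem exists_line_values {n m : ℕ} {bad : Fin (n + 1) → Prop} [DecidablePred bad]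
    (hbl : bad (Fin.last n)) {N : ℝ} (hN : ∑ l, (if bad l then (1 : ℝ) else 0) ≤ N)
    {Y D : Fin n → Fin m → ℝ} {K : ℝ} (hK0 : 0 ≤ K) (hK : ∀ i, ∑ j, Y i j ^ 2 ≤ K)
    (hD0 : ∀ i j, 0 ≤ D i j)
    (hD : ∀ i i' j, i.succ = i'.castSucc → ¬ bad i.succ → (Y i j - Y i' j) ^ 2 ≤ D i j + D i' j) :
    ∃ d : Fin (n + 1) → Fin m → ℝ, (∀ l j, bad l → d l j = 0) ∧
      ∑ i : Fin n, ∑ j, ((d i.castSucc j + Y i j / 2) ^ 2 + (d i.succ j + Y i j / 2) ^ 2) ≤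
        2 * N * K + 2 * ∑ i, ∑ j, D i j := by
  classical
  -- A line is indexed by the cell to its right. The default 0 stands for the last line, which has
  -- no such cell; that line is bad, so its default is never used as a value of `d`.
  let ext : (Fin n → Fin m → ℝ) → Fin (n + 1) → Fin m → ℝ := fun F l j =>
    if h : l.val < n then F ⟨l.val, h⟩ j else 0
  have ext_cast : ∀ F i j, ext F (Fin.castSucc i) j = F i j := fun F i j => by
    simp [ext]
  let β : Fin (n + 1) → ℝ := fun l => if bad l then 1 else 0
  have hβ : ∀ l, 0 ≤ β l := fun l => by simp only [β]; split_ifs <;> norm_num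
  refine ⟨fun l j => if bad l then 0 else -(ext Y l j) / 2, fun l j h => if_pos h, ?_⟩
  -- A good line takes its value from the cell on its right, so the left side of a cell contributes
  -- only when that line is bad.
  have h1 : ∀ i j, ((if bad (Fin.castSucc i) then 0 else -(ext Y (Fin.castSucc i) j) / 2) +
      Y i j / 2) ^ 2 ≤ β i.castSucc * Y i j ^ 2 := by
    intro i j
    by_cases hb : bad i.castSucc
    · simp only [hb, if_true, β]; nlinarith [sq_nonneg (Y i j)]
    · simp only [hb, if_false, β, ext_cast]
      apply le_of_eq; ring
  -- On a good right side, what remains is half the difference to the next cell.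
  have h2 : ∀ i j, ((if bad (Fin.succ i) then 0 else -(ext Y (Fin.succ i) j) / 2) +
      Y i j / 2) ^ 2 ≤ β i.succ * Y i j ^ 2 + (D i j + ext D i.succ j) := by
    intro i j
    have hext : 0 ≤ ext D i.succ j := by
      simp only [ext]; split_ifs
      · exact hD0 _ _
      · exact le_rfl
    by_cases hb : bad i.succ
    · simp only [hb, if_true, β]; nlinarith [sq_nonneg (Y i j), hD0 i j]
    · have hlt : i.val + 1 < n := by
        rcases lt_or_eq_of_le (Nat.succ_le_of_lt i.isLt) with h | h
        · exact h
        · exact absurd (by rwa [show i.succ = Fin.last n from Fin.ext h]) hb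
      obtain ⟨i', hi'⟩ : ∃ i' : Fin n, i.succ = i'.castSucc := ⟨⟨i.val + 1, hlt⟩, rfl⟩
      have := hD i i' j hi' hb
      simp only [hb, if_false, β]
      rw [hi', ext_cast, ext_cast]
      nlinarith [sq_nonneg (Y i j - Y i' j)]
  have hext : ∑ i : Fin n, ∑ j, ext D i.succ j ≤ ∑ i, ∑ j, D i j := by
    have e1 := Fin.sum_univ_succ fun l => ∑ j, ext D l j
    have e2 := Fin.sum_univ_castSucc fun l => ∑ j, ext D l j
    have e3 : 0 ≤ ∑ j, ext D 0 j := Finset.sum_nonneg fun j _ => by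
      simp only [ext]; split_ifs
      · exact hD0 _ _
      · exact le_rfl
    have e4 : ∑ j, ext D (Fin.last n) j = 0 := Finset.sum_eq_zero fun j _ => by simp [ext]
    simp only [ext_cast] at e2
    linarith
  -- Used once for left and once for right sides: each bad line is met at most once, and each costs
  -- one column sum.
  have hβN : ∀ g : Fin n → Fin (n + 1), Function.Injective g →
      ∑ i, ∑ j, β (g i) * Y i j ^ 2 ≤ N * K := by
    intro g hg
    calc ∑ i, ∑ j, β (g i) * Y i j ^ 2 = ∑ i, β (g i) * ∑ j, Y i j ^ 2 := by
          simp_rw [Finset.mul_sum]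
      _ ≤ ∑ i, β (g i) * K :=
          Finset.sum_le_sum fun i _ => mul_le_mul_of_nonneg_left (hK i) (hβ _)
      _ = (∑ i, β (g i)) * K := by rw [Finset.sum_mul]
      _ ≤ N * K := by
          refine mul_le_mul_of_nonneg_right (le_trans ?_ hN) hK0
          rw [← Finset.sum_image (f := β) (s := Finset.univ) (g := g) fun a _ b _ h => hg h]
          exact Finset.sum_le_sum_of_subset_of_nonneg (Finset.subset_univ _) fun l _ _ => hβ l
  calc _ ≤ ∑ i : Fin n, ∑ j, (β i.castSucc * Y i j ^ 2 +
        (β i.succ * Y i j ^ 2 + (D i j + ext D i.succ j))) :=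
        Finset.sum_le_sum fun i _ => Finset.sum_le_sum fun j _ => add_le_add (h1 i j) (h2 i j)
    _ = (∑ i : Fin n, ∑ j, β i.castSucc * Y i j ^ 2) + ((∑ i : Fin n, ∑ j, β i.succ * Y i j ^ 2) +
        ((∑ i, ∑ j, D i j) + ∑ i : Fin n, ∑ j, ext D i.succ j)) := by
        simp only [Finset.sum_add_distrib]
    _ ≤ _ := by
        have e1 := hβN Fin.castSucc (Fin.castSucc_injective n)
        have e2 := hβN Fin.succ (Fin.succ_injective n)
        linarith

namespace RectMesh

variable {M : RectMesh}

/-- The cell values are `O(h²)` times means. Each bad line costs `h⁴ · h⁻¹` by the column estimate.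
On the good lines the coefficients agree on both sides, so only differences of means enter, and
these cost `h⁴` in total. -/
theorem exists_vert_correction {k h : ℝ} (hk : 0 < k) (hh : 0 < h) (hh2 : h ≤ 2)
    (H : M.QuasiUniform k h) {bad : Fin (M.n + 1) → Prop} [DecidablePred bad] (hb0 : bad 0)
    (hbl : bad (Fin.last M.n)) {N : ℝ} (hN : ∑ l, (if bad l then (1 : ℝ) else 0) ≤ N)
    {w₁ w₁' w₂ w₂' : ℝ × ℝ → ℝ} (hw₁ : MemLp w₁ 2 (volume.restrict Ω))
    (h₁ : HasWeakDeriv Ω 1 0 w₁ w₁') (hw₂ : MemLp w₂ 2 (volume.restrict Ω))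
    (h₂ : HasWeakDeriv Ω 1 0 w₂ w₂') {c₁ c₂ : M.Cell → ℝ} {K : ℝ}
    (hc₁ : ∀ T, |c₁ T| ≤ K * h ^ 2) (hc₂ : ∀ T, |c₂ T| ≤ K * h ^ 2)
    (hc : ∀ i i' j, i.succ = i'.castSucc → ¬ bad i.succ →
      c₁ (i, j) = c₁ (i', j) ∧ c₂ (i, j) = c₂ (i', j)) :
    ∃ d : Fin (M.n + 1) → Fin M.m → ℝ, d 0 = 0 ∧ d (Fin.last M.n) = 0 ∧
      ∑ T : M.Cell, ((d T.1.castSucc T.2 + (c₁ T * M.mean w₁ T + c₂ T * M.mean w₂ T) / 2) ^ 2 +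
        (d T.1.succ T.2 + (c₁ T * M.mean w₁ T + c₂ T * M.mean w₂ T) / 2) ^ 2) ≤
        (72 * N + 16) * K ^ 2 / k * h ^ 3 * (((∫ p in Ω, w₁ p ^ 2) + ∫ p in Ω, w₁' p ^ 2) +
          ((∫ p in Ω, w₂ p ^ 2) + ∫ p in Ω, w₂' p ^ 2)) := by
  have hsq : ∀ c : M.Cell → ℝ, (∀ T, |c T| ≤ K * h ^ 2) → ∀ T, c T ^ 2 ≤ K ^ 2 * h ^ 4 := by
    intro c hc T
    have := pow_le_pow_left₀ (abs_nonneg _) (hc T) 2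
    rw [sq_abs] at this
    linarith
  have hcomb : ∀ a₁ a₂ b₁ b₂ : ℝ, a₁ ^ 2 ≤ K ^ 2 * h ^ 4 → a₂ ^ 2 ≤ K ^ 2 * h ^ 4 →
      (a₁ * b₁ + a₂ * b₂) ^ 2 ≤ 2 * (K ^ 2 * h ^ 4) * (b₁ ^ 2 + b₂ ^ 2) := by
    intro a₁ a₂ b₁ b₂ h1 h2
    have e1 := mul_le_mul_of_nonneg_right h1 (sq_nonneg b₁)
    have e2 := mul_le_mul_of_nonneg_right h2 (sq_nonneg b₂)
    nlinarith [sq_nonneg (a₁ * b₁ - a₂ * b₂)]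
  set S₁ := (∫ p in Ω, w₁ p ^ 2) + ∫ p in Ω, w₁' p ^ 2 with hS₁
  set S₂ := (∫ p in Ω, w₂ p ^ 2) + ∫ p in Ω, w₂' p ^ 2 with hS₂
  have n1 : 0 ≤ ∫ p in Ω, w₁ p ^ 2 := integral_nonneg fun _ => sq_nonneg _
  have n2 : 0 ≤ ∫ p in Ω, w₁' p ^ 2 := integral_nonneg fun _ => sq_nonneg _
  have n3 : 0 ≤ ∫ p in Ω, w₂ p ^ 2 := integral_nonneg fun _ => sq_nonneg _
  have n4 : 0 ≤ ∫ p in Ω, w₂' p ^ 2 := integral_nonneg fun _ => sq_nonneg _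
  have hkh : 0 < k * h := mul_pos hk hh
  obtain ⟨d, hd, hsum⟩ := exists_line_values hbl hN
    (Y := fun i j => c₁ (i, j) * M.mean w₁ (i, j) + c₂ (i, j) * M.mean w₂ (i, j))
    (D := fun i j => 2 * (K ^ 2 * h ^ 4) * (2 / k * ((∫ p in M.cell (i, j), w₁' p ^ 2) +
      ∫ p in M.cell (i, j), w₂' p ^ 2)))
    (K := 2 * (K ^ 2 * h ^ 4) * (18 / (k * h) * (S₁ + S₂)))
    (by positivity)
    (fun i => by
      calc _ ≤ ∑ j, 2 * (K ^ 2 * h ^ 4) * (M.mean w₁ (i, j) ^ 2 + M.mean w₂ (i, j) ^ 2) :=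
            Finset.sum_le_sum fun j _ => hcomb _ _ _ _ (hsq _ hc₁ _) (hsq _ hc₂ _)
        _ = 2 * (K ^ 2 * h ^ 4) * (∑ j, M.mean w₁ (i, j) ^ 2 + ∑ j, M.mean w₂ (i, j) ^ 2) := by
            rw [← Finset.mul_sum, Finset.sum_add_distrib]
        _ ≤ _ := by
            refine mul_le_mul_of_nonneg_left ?_ (by positivity)
            rw [mul_add]
            exact add_le_add (sum_sq_mean_le hk hh H hw₁ h₁ i) (sum_sq_mean_le hk hh H hw₂ h₂ i))
    (fun i j => by
      have e1 : 0 ≤ ∫ p in M.cell (i, j), w₁' p ^ 2 := integral_nonneg fun _ => sq_nonneg _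
      have e2 : 0 ≤ ∫ p in M.cell (i, j), w₂' p ^ 2 := integral_nonneg fun _ => sq_nonneg _
      positivity)
    (fun i i' j hi hb => by
      obtain ⟨e1, e2⟩ := hc i i' j hi hb
      have e3 : c₁ (i, j) * M.mean w₁ (i, j) + c₂ (i, j) * M.mean w₂ (i, j) -
          (c₁ (i', j) * M.mean w₁ (i', j) + c₂ (i', j) * M.mean w₂ (i', j)) =
          c₁ (i, j) * (M.mean w₁ (i, j) - M.mean w₁ (i', j)) +
          c₂ (i, j) * (M.mean w₂ (i, j) - M.mean w₂ (i', j)) := by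
        rw [← e1, ← e2]; ring
      rw [e3]
      refine (hcomb _ _ _ _ (hsq _ hc₁ _) (hsq _ hc₂ _)).trans ?_
      rw [← mul_add]
      refine mul_le_mul_of_nonneg_left ?_ (by positivity)
      have e4 := sq_mean_sub_mean_le hk hh H hw₁ h₁ hi j
      have e5 := sq_mean_sub_mean_le hk hh H hw₂ h₂ hi j
      linarith)
  refine ⟨d, funext fun j => hd 0 j hb0, funext fun j => hd _ j hbl, ?_⟩
  rw [Fintype.sum_prod_type]
  refine hsum.trans ?_
  have hDsum : ∑ i : Fin M.n, ∑ j : Fin M.m, 2 * (K ^ 2 * h ^ 4) *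
      (2 / k * ((∫ p in M.cell (i, j), w₁' p ^ 2) + ∫ p in M.cell (i, j), w₂' p ^ 2)) =
      2 * (K ^ 2 * h ^ 4) * (2 / k * ((∫ p in Ω, w₁' p ^ 2) + ∫ p in Ω, w₂' p ^ 2)) := by
    rw [← M.sum_cells h₁.1.integrable_sq, ← M.sum_cells h₂.1.integrable_sq,
      ← Finset.sum_add_distrib, Finset.mul_sum, Finset.mul_sum, Fintype.sum_prod_type]
  rw [hDsum]
  have e1 : 2 * N * (2 * (K ^ 2 * h ^ 4) * (18 / (k * h) * (S₁ + S₂))) =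
      72 * N * K ^ 2 / k * h ^ 3 * (S₁ + S₂) := by field_simp; ring
  -- The spare power of `h` is absorbed by `h ≤ 2`.
  have e2 : 2 * (2 * (K ^ 2 * h ^ 4) * (2 / k * ((∫ p in Ω, w₁' p ^ 2) + ∫ p in Ω, w₂' p ^ 2))) ≤
      16 * K ^ 2 / k * h ^ 3 * (S₁ + S₂) := by
    calc _ = 8 * K ^ 2 / k * h ^ 3 * h * ((∫ p in Ω, w₁' p ^ 2) + ∫ p in Ω, w₂' p ^ 2) := by
          field_simp; ring
      _ ≤ 8 * K ^ 2 / k * h ^ 3 * 2 * (S₁ + S₂) := by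
          have : (∫ p in Ω, w₁' p ^ 2) + ∫ p in Ω, w₂' p ^ 2 ≤ S₁ + S₂ := by
            rw [hS₁, hS₂]; linarith
          gcongr
      _ = _ := by ring
  rw [e1]
  calc _ ≤ 72 * N * K ^ 2 / k * h ^ 3 * (S₁ + S₂) + 16 * K ^ 2 / k * h ^ 3 * (S₁ + S₂) := by
        linarith
    _ = _ := by ring

end RectMesh

/-! ### The cells cover the square up to a null set -/

theorem exists_mem_Ioo_of_notMem_range {n : ℕ} {x : Fin (n + 1) → ℝ} {t : ℝ}
    (h0 : x 0 < t) (h1 : t < x (Fin.last n)) (ht : t ∉ range x) :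
    ∃ i : Fin n, t ∈ Ioo (x i.castSucc) (x i.succ) := by
  by_contra hcon
  push Not at hcon
  have key : ∀ i : Fin (n + 1), x i < t := by
    intro i
    induction i using Fin.induction with
    | zero => exact h0
    | succ i ih =>
      rcases lt_trichotomy (x i.succ) t with h | h | h
      · exact h
      · exact absurd ⟨_, h⟩ ht
      · exact absurd ⟨ih, h⟩ (hcon i)
  exact absurd (key (Fin.last n)) (not_lt.2 h1.le)

theorem ae_fst_notMem_of_finite {s : Set ℝ} (hs : s.Finite) :
    ∀ᵐ p : ℝ × ℝ, p.1 ∉ s := by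
  rw [Measure.volume_eq_prod]
  exact Measure.quasiMeasurePreserving_fst.ae (hs.countable.ae_notMem volume)

theorem ae_snd_notMem_of_finite {s : Set ℝ} (hs : s.Finite) :
    ∀ᵐ p : ℝ × ℝ, p.2 ∉ s := by
  rw [Measure.volume_eq_prod]
  exact Measure.quasiMeasurePreserving_snd.ae (hs.countable.ae_notMem volume)

theorem measurableSet_Ω : MeasurableSet Ω := measurableSet_rect 0 1 0 1

namespace RectMesh

variable (M : RectMesh)

theorem exists_mem_cell {p : ℝ × ℝ} (hp : p ∈ Ω) (hx : p.1 ∉ range M.x) (hy : p.2 ∉ range M.y) :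
    ∃ T, p ∈ M.cell T := by
  obtain ⟨i, hi⟩ := exists_mem_Ioo_of_notMem_range (by rw [M.x_first]; exact hp.1.1)
    (by rw [M.x_last]; exact hp.1.2) hx
  obtain ⟨j, hj⟩ := exists_mem_Ioo_of_notMem_range (by rw [M.y_first]; exact hp.2.1)
    (by rw [M.y_last]; exact hp.2.2) hy
  exact ⟨(i, j), hi, hj⟩

theorem ae_mem_cell : ∀ᵐ p ∂volume.restrict Ω, ∃ T, p ∈ M.cell T := by
  rw [ae_restrict_iff' measurableSet_Ω]
  filter_upwards [ae_fst_notMem_of_finite (finite_range M.x),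
    ae_snd_notMem_of_finite (finite_range M.y)] with p h1 h2 hp
  exact M.exists_mem_cell hp h1 h2

theorem iUnion_cell_ae_eq : (⋃ T, M.cell T : Set (ℝ × ℝ)) =ᵐ[volume] Ω := by
  have h := M.ae_mem_cell
  rw [ae_restrict_iff' measurableSet_Ω] at h
  refine Filter.EventuallyLE.antisymm ?_ ?_
  · exact (iUnion_subset M.cell_subset).eventuallyLE
  · filter_upwards [h] with p hp hpΩ
    exact mem_iUnion.2 (hp hpΩ)

theorem integrableOn_of_cells {F : ℝ × ℝ → ℝ} (h : ∀ T, IntegrableOn F (M.cell T)) :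
    IntegrableOn F Ω :=
  (integrableOn_finite_iUnion.2 h).congr_set_ae M.iUnion_cell_ae_eq.symm

theorem ae_of_cells {P : ℝ × ℝ → Prop} (h : ∀ T, ∀ᵐ p ∂volume.restrict (M.cell T), P p) :
    ∀ᵐ p ∂volume.restrict Ω, P p := by
  rw [← Measure.restrict_congr_set M.iUnion_cell_ae_eq, ae_restrict_iUnion_iff]
  exact h

variable {M}

/-! ### Continuity of the normal flux -/

/-- The component `q₁` of a vector field `q` with the divergence `-f ∈ L²(Ω)` satisfies Green's
formula across the vertical lines of the partition. -/
theorem greenX_of_weak_divergence {q₁ q₂ d₁ d₂ f : ℝ × ℝ → ℝ}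
    (hq₁ : IntegrableOn q₁ Ω) (hq₂ : IntegrableOn q₂ Ω) (hd₁ : IntegrableOn d₁ Ω)
    (hd₂ : IntegrableOn d₂ Ω) (hf : IntegrableOn f Ω)
    (hweak : ∀ φ, IsTest Ω φ → ∫ p in Ω, (q₁ p * dx φ p + q₂ p * dy φ p) = ∫ p in Ω, f p * φ p)
    (hdiv : ∀ᵐ p ∂volume.restrict Ω, f p + (d₁ p + d₂ p) = 0)
    (j : Fin M.m)
    (hy : ∀ i, ∀ η χ : ℝ → ℝ, Continuous η → IsTest1 (M.y j.castSucc) (M.y j.succ) χ →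
      ∫ p in M.cell (i, j), (q₂ p * deriv χ p.2 + d₂ p * χ p.2) * η p.1 = 0) :
    GreenX 0 1 (M.y j.castSucc) (M.y j.succ) q₁ d₁ := by
  have hsub : rect 0 1 (M.y j.castSucc) (M.y j.succ) ⊆ Ω :=
    rect_mono le_rfl le_rfl (M.y_nonneg _) (M.y_le_one _)
  refine greenX_of_forall_isTest1 one_pos (hq₁.mono_set hsub) (hd₁.mono_set hsub)
    fun η χ hη hχ => ?_
  have hφ := isTest_tensor hη hχ
  have hηd := hη.1.differentiable (by simp)
  have hχd := hχ.1.differentiable (by simp)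
  have hχ' : Continuous (deriv χ) := (hχ.1.continuous_deriv (by simp))
  have hw := hweak _ (hφ.mono hsub)
  rw [setIntegral_eq_of_isTest hsub (fun p hp => by
      rw [hφ.dx.eq_zero hp, hφ.dy.eq_zero hp, mul_zero, mul_zero, add_zero]),
    setIntegral_eq_of_isTest hsub (fun p hp => by rw [hφ.eq_zero hp, mul_zero])] at hw
  have i1 : IntegrableOn (fun p => q₁ p * dx (fun p => η p.1 * χ p.2) p +
      q₂ p * dy (fun p => η p.1 * χ p.2) p) (rect 0 1 (M.y j.castSucc) (M.y j.succ)) :=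
    (integrableOn_rect_mul (hq₁.mono_set hsub) hφ.dx.1.continuous).add
      (integrableOn_rect_mul (hq₂.mono_set hsub) hφ.dy.1.continuous)
  have i2 : IntegrableOn (fun p => f p * (η p.1 * χ p.2))
      (rect 0 1 (M.y j.castSucc) (M.y j.succ)) :=
    integrableOn_rect_mul (hf.mono_set hsub) hφ.1.continuous
  have i3 : IntegrableOn (fun p => (q₂ p * deriv χ p.2 + d₂ p * χ p.2) * η p.1)
      (rect 0 1 (M.y j.castSucc) (M.y j.succ)) :=
    integrableOn_rect_mul ((integrableOn_rect_mul (hq₂.mono_set hsub)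
      (hχ'.comp continuous_snd)).add (integrableOn_rect_mul (hd₂.mono_set hsub)
      (hχ.1.continuous.comp continuous_snd))) (hη.1.continuous.comp continuous_fst)
  have e3 : ∫ p in rect 0 1 (M.y j.castSucc) (M.y j.succ),
      (q₂ p * deriv χ p.2 + d₂ p * χ p.2) * η p.1 = 0 := by
    -- The `y`-part vanishes cell by cell: `χ` is supported inside the row, while `η` need not
    -- vanish on the vertical lines. The weak equation then isolates the `x`-part across them.
    rw [← M.sum_row i3]
    exact Finset.sum_eq_zero fun i _ => hy i η χ hη.1.continuous hχ
  have e4 : ∫ p in rect 0 1 (M.y j.castSucc) (M.y j.succ),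
      (q₁ p * deriv η p.1 + d₁ p * η p.1) * χ p.2 =
      ∫ p in rect 0 1 (M.y j.castSucc) (M.y j.succ),
        ((q₁ p * dx (fun p => η p.1 * χ p.2) p + q₂ p * dy (fun p => η p.1 * χ p.2) p -
          f p * (η p.1 * χ p.2)) - (q₂ p * deriv χ p.2 + d₂ p * χ p.2) * η p.1) := by
    refine integral_congr_ae ?_
    filter_upwards [ae_restrict_of_ae_restrict_of_subset hsub hdiv] with p hp
    rw [dx_tensor hηd hχd, dy_tensor hηd hχd]
    linear_combination (η p.1 * χ p.2) * hp
  rw [e4]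
  refine (integral_sub (Integrable.sub i1 i2) i3).trans ?_
  rw [e3, sub_zero]
  exact (integral_sub i1 i2).trans (sub_eq_zero.2 hw)

/-- In each cell, integration by parts against the linear interpolant of the edge values yields a
difference of products `V · v`. With a single `V` for the row these telescope, and `v` vanishes at
both ends. -/
theorem sum_flux_eq_zero {q₁ d₁ : ℝ × ℝ → ℝ} (hq₁ : IntegrableOn q₁ Ω) (hd₁ : IntegrableOn d₁ Ω)
    (hG : ∀ j : Fin M.m, GreenX 0 1 (M.y j.castSucc) (M.y j.succ) q₁ d₁)
    {v : Fin (M.n + 1) → Fin M.m → ℝ} (hv0 : v 0 = 0) (hvl : v (Fin.last M.n) = 0) :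
    ∑ T : M.Cell, ((∫ p in M.cell T, q₁ p) *
      ((v T.1.succ T.2 - v T.1.castSucc T.2) / M.hx T) +
      ∫ p in M.cell T, d₁ p * (v T.1.castSucc T.2 +
        (v T.1.succ T.2 - v T.1.castSucc T.2) / M.hx T * (p.1 - M.x T.1.castSucc))) = 0 := by
  rw [Fintype.sum_prod_type_right]
  refine Finset.sum_eq_zero fun j _ => ?_
  have hsub : rect 0 1 (M.y j.castSucc) (M.y j.succ) ⊆ Ω :=
    rect_mono le_rfl le_rfl (M.y_nonneg _) (M.y_le_one _)
  obtain ⟨V, hV⟩ := (hG j).exists_boundary_values (hq₁.mono_set hsub) (hd₁.mono_set hsub)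
  have h := sum_succ_sub_castSucc fun i => V (M.x i) * v i j
  simp only [hv0, hvl, Pi.zero_apply, mul_zero, sub_zero] at h
  rw [← h]
  refine Finset.sum_congr rfl fun i _ => ?_
  set G := (v i.succ j - v i.castSucc j) / M.hx (i, j) with hG'
  have hd : deriv (fun x => v i.castSucc j + G * (x - M.x i.castSucc)) = fun _ => G := by
    funext x
    exact ((((hasDerivAt_id x).sub_const _).const_mul G).const_add _).deriv.trans (mul_one G)
  have := hV (M.x i.castSucc) (M.x i.succ) (M.x_nonneg _) (M.x_lt i).le (M.x_le_one _)
    (fun x => v i.castSucc j + G * (x - M.x i.castSucc)) (by fun_prop)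
  rw [hd] at this
  simp only [integral_mul_const] at this
  have hGm : v i.castSucc j + G * (M.x i.succ - M.x i.castSucc) = v i.succ j := by
    rw [hG']
    change v i.castSucc j + (v i.succ j - v i.castSucc j) / M.hx (i, j) * M.hx (i, j) = _
    rw [div_mul_cancel₀ _ (M.hx_pos (i, j)).ne']; ring
  rw [hGm, sub_self, mul_zero, add_zero] at this
  exact this

/-! ### The scheme for the boundary values -/

variable (M)

/-- `v_L + v_R - v_B - v_T`, which vanishes for the edge means of affine functions. -/
def defect (b : Edge M → ℝ) (T : M.Cell) : ℝ :=
  b (M.side T 0) + b (M.side T 1) - b (M.side T 2) - b (M.side T 3)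

/-- The weight of the square of `defect` in the stabilizer. -/
noncomputable def weight (T : M.Cell) : ℝ := M.hx T * M.hy T / (2 * (M.hx T + M.hy T))

/-- The weak function whose interior part is the least squares approximation of the boundary part
in each element. -/
noncomputable def leastSquares (b : Edge M → ℝ) : WeakFun M where
  int T :=
    ![(b (M.side T 0) + b (M.side T 1)) / 2 - M.weight T * M.defect b T / M.hy T -
        (b (M.side T 1) - b (M.side T 0)) / M.hx T * ((M.x T.1.castSucc + M.x T.1.succ) / 2) -
        (b (M.side T 3) - b (M.side T 2)) / M.hy T * ((M.y T.2.castSucc + M.y T.2.succ) / 2),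
      (b (M.side T 1) - b (M.side T 0)) / M.hx T, (b (M.side T 3) - b (M.side T 2)) / M.hy T]
  bdry := b

variable {M}

theorem integral_affine_snd (c : Fin 3 → ℝ) (x s t : ℝ) :
    ∫ y in s..t, affine c (x, y) = (t - s) * affine c (x, (s + t) / 2) := by
  simp only [affine]
  rw [intervalIntegral.integral_add (Continuous.intervalIntegrable (by fun_prop) _ _)
    (Continuous.intervalIntegrable (by fun_prop) _ _),
    intervalIntegral.integral_const_mul, integral_id]
  simp only [intervalIntegral.integral_const, smul_eq_mul]
  ring

theorem integral_affine_fst (c : Fin 3 → ℝ) (y s t : ℝ) :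
    ∫ x in s..t, affine c (x, y) = (t - s) * affine c ((s + t) / 2, y) := by
  have h : ∀ x, affine c (x, y) = affine ![c 0, c 2, c 1] (y, x) := fun x => by
    simp [affine]; ring
  simp only [h]
  exact integral_affine_snd _ _ _ _

theorem Qb_affine_vert (c : Fin 3 → ℝ) (i : Fin (M.n + 1)) (j : Fin M.m) :
    M.Qb (affine c) (.vert i j) = affine c (M.x i, (M.y j.castSucc + M.y j.succ) / 2) := by
  have h : M.len (.vert i j) = M.y j.succ - M.y j.castSucc := rfl
  rw [Qb, integral_affine_snd, h, mul_div_cancel_left₀ _ (sub_pos.2 (M.y_lt j)).ne']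

theorem Qb_affine_horiz (c : Fin 3 → ℝ) (i : Fin M.n) (j : Fin (M.m + 1)) :
    M.Qb (affine c) (.horiz i j) = affine c ((M.x i.castSucc + M.x i.succ) / 2, M.y j) := by
  have h : M.len (.horiz i j) = M.x i.succ - M.x i.castSucc := rfl
  rw [Qb, integral_affine_fst, h, mul_div_cancel_left₀ _ (sub_pos.2 (M.x_lt i)).ne']

theorem x_succ (M : RectMesh) (T : M.Cell) : M.x T.1.succ = M.x T.1.castSucc + M.hx T :=
  (add_sub_cancel _ _).symm

theorem y_succ (M : RectMesh) (T : M.Cell) : M.y T.2.succ = M.y T.2.castSucc + M.hy T :=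
  (add_sub_cancel _ _).symm

/-- Multiplied by the edge lengths, the four jumps are `c, c, -c, -c`. This is the direction
orthogonal to the edge means of affine functions, as a least squares residual has to be. -/
theorem jump_leastSquares (b : Edge M → ℝ) (T : M.Cell) :
    (M.leastSquares b).jump T = ![M.weight T * M.defect b T / M.hy T,
      M.weight T * M.defect b T / M.hy T, -(M.weight T * M.defect b T / M.hx T),
      -(M.weight T * M.defect b T / M.hx T)] := by
  have hx := M.hx_pos T
  have hy := M.hy_pos T
  have ex : M.x T.1.succ = M.x T.1.castSucc + M.hx T := M.x_succ T
  have ey : M.y T.2.succ = M.y T.2.castSucc + M.hy T := M.y_succ T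
  have e0 : M.Qb (affine ((M.leastSquares b).int T)) (M.side T 0) = affine _ (_, _) :=
    Qb_affine_vert _ _ _
  have e1 : M.Qb (affine ((M.leastSquares b).int T)) (M.side T 1) = affine _ (_, _) :=
    Qb_affine_vert _ _ _
  have e2 : M.Qb (affine ((M.leastSquares b).int T)) (M.side T 2) = affine _ (_, _) :=
    Qb_affine_horiz _ _ _
  have e3 : M.Qb (affine ((M.leastSquares b).int T)) (M.side T 3) = affine _ (_, _) :=
    Qb_affine_horiz _ _ _
  funext s
  fin_cases s
  · change b (M.side T 0) - M.Qb _ (M.side T 0) = M.weight T * M.defect b T / M.hy T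
    rw [e0]
    simp only [affine, leastSquares, ex, ey, weight, defect, Matrix.cons_val]
    field_simp
    ring
  · change b (M.side T 1) - M.Qb _ (M.side T 1) = M.weight T * M.defect b T / M.hy T
    rw [e1]
    simp only [affine, leastSquares, ex, ey, weight, defect, Matrix.cons_val]
    field_simp
    ring
  · change b (M.side T 2) - M.Qb _ (M.side T 2) = -(M.weight T * M.defect b T / M.hx T)
    rw [e2]
    simp only [affine, leastSquares, ex, ey, weight, defect, Matrix.cons_val]
    field_simp
    ring
  · change b (M.side T 3) - M.Qb _ (M.side T 3) = -(M.weight T * M.defect b T / M.hx T)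
    rw [e3]
    simp only [affine, leastSquares, ex, ey, weight, defect, Matrix.cons_val]
    field_simp
    ring

/-- By that orthogonality the interior part of `w` contributes nothing. -/
theorem sum_side_jump_leastSquares (w : WeakFun M) (b : Edge M → ℝ) (T : M.Cell) :
    ∑ s, M.len (M.side T s) * (w.jump T s * (M.leastSquares b).jump T s) =
      M.weight T * (M.defect w.bdry T * M.defect b T) := by
  have hx := M.hx_pos T
  have hy := M.hy_pos T
  have l0 : M.len (M.side T 0) = M.hy T := rfl
  have l1 : M.len (M.side T 1) = M.hy T := rfl
  have l2 : M.len (M.side T 2) = M.hx T := rfl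
  have l3 : M.len (M.side T 3) = M.hx T := rfl
  have e0 : M.Qb (affine (w.int T)) (M.side T 0) = affine _ (_, _) := Qb_affine_vert _ _ _
  have e1 : M.Qb (affine (w.int T)) (M.side T 1) = affine _ (_, _) := Qb_affine_vert _ _ _
  have e2 : M.Qb (affine (w.int T)) (M.side T 2) = affine _ (_, _) := Qb_affine_horiz _ _ _
  have e3 : M.Qb (affine (w.int T)) (M.side T 3) = affine _ (_, _) := Qb_affine_horiz _ _ _
  rw [jump_leastSquares, Fin.sum_univ_four, l0, l1, l2, l3]
  simp only [WeakFun.jump, e0, e1, e2, e3, affine, Matrix.cons_val]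
  have hd : M.defect w.bdry T = w.bdry (M.side T 0) + w.bdry (M.side T 1) - w.bdry (M.side T 2) -
    w.bdry (M.side T 3) := rfl
  rw [hd]
  field_simp
  ring

theorem stab_leastSquares (ρ : ℝ) (w : WeakFun M) (b : Edge M → ℝ) :
    WeakFun.stab ρ w (M.leastSquares b) =
      ρ * (M.h)⁻¹ * ∑ T : M.Cell, M.weight T * (M.defect w.bdry T * M.defect b T) := by
  simp only [WeakFun.stab, sum_side_jump_leastSquares]

theorem weakGrad_leastSquares (b : Edge M → ℝ) (T : M.Cell) :
    (M.leastSquares b).weakGrad T = ((b (M.side T 1) - b (M.side T 0)) / M.hx T,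
      (b (M.side T 3) - b (M.side T 2)) / M.hy T) := rfl

/-- The first bracket is the linear interpolant in `x` of the left and right edge values, the one
that telescopes against `∂q₁/∂x`. The rest yields the defect term and a first moment in `y`. -/
theorem affine_leastSquares_x (b : Edge M → ℝ) (T : M.Cell) (p : ℝ × ℝ) :
    affine ((M.leastSquares b).int T) p =
      (b (M.side T 0) + ((M.leastSquares b).weakGrad T).1 * (p.1 - M.x T.1.castSucc)) -
      M.weight T * M.defect b T / M.hy T +
      ((M.leastSquares b).weakGrad T).2 * (p.2 - (M.y T.2.castSucc + M.y T.2.succ) / 2) := by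
  have hx := M.hx_pos T
  have ex : M.x T.1.succ = M.x T.1.castSucc + M.hx T := M.x_succ T
  rw [weakGrad_leastSquares]
  simp only [affine, leastSquares, Matrix.cons_val, ex]
  field_simp
  ring

theorem affine_leastSquares_y (b : Edge M → ℝ) (T : M.Cell) (p : ℝ × ℝ) :
    affine ((M.leastSquares b).int T) p =
      (b (M.side T 2) + ((M.leastSquares b).weakGrad T).2 * (p.2 - M.y T.2.castSucc)) +
      M.weight T * M.defect b T / M.hx T +
      ((M.leastSquares b).weakGrad T).1 * (p.1 - (M.x T.1.castSucc + M.x T.1.succ) / 2) := by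
  have hx := M.hx_pos T
  have hy := M.hy_pos T
  have ey : M.y T.2.succ = M.y T.2.castSucc + M.hy T := M.y_succ T
  rw [weakGrad_leastSquares]
  simp only [affine, leastSquares, Matrix.cons_val, ey, weight, defect]
  field_simp
  ring

theorem integral_mul_affine {w : ℝ × ℝ → ℝ} {T : M.Cell} (hw : IntegrableOn w (M.cell T))
    {P R : ℝ × ℝ → ℝ} (hP : Continuous P) (hR : Continuous R) (k : ℝ) (G : ℝ) :
    ∫ p in M.cell T, w p * (P p + k + G * R p) =
      (∫ p in M.cell T, w p * P p) + k * (∫ p in M.cell T, w p) +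
        G * ∫ p in M.cell T, w p * R p := by
  have i1 : IntegrableOn (fun p => w p * P p) (M.cell T) := integrableOn_rect_mul hw hP
  have i2 : IntegrableOn (fun p => w p * R p) (M.cell T) := integrableOn_rect_mul hw hR
  have i3 : IntegrableOn (fun p => k * w p) (M.cell T) := hw.const_mul k
  have i4 : IntegrableOn (fun p => G * (w p * R p)) (M.cell T) := i2.const_mul G
  rw [← integral_const_mul, ← integral_const_mul, ← integral_add i1 i3]
  refine Eq.trans ?_ (integral_add (Integrable.add i1 i3) i4)
  congr 1; ext p
  ring

/-- The load of the test function `leastSquares b`, after integration by parts. -/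
theorem load_leastSquares {q₁ q₂ d₁ d₂ f : ℝ × ℝ → ℝ} (b : Edge M → ℝ)
    (hd₁ : IntegrableOn d₁ Ω) (hd₂ : IntegrableOn d₂ Ω)
    (hdiv : ∀ᵐ p ∂volume.restrict Ω, f p + (d₁ p + d₂ p) = 0)
    (hx : ∑ T : M.Cell, ((∫ p in M.cell T, q₁ p) * ((M.leastSquares b).weakGrad T).1 +
      ∫ p in M.cell T, d₁ p * (b (M.side T 0) +
        ((M.leastSquares b).weakGrad T).1 * (p.1 - M.x T.1.castSucc))) = 0)
    (hy : ∑ T : M.Cell, ((∫ p in M.cell T, q₂ p) * ((M.leastSquares b).weakGrad T).2 +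
      ∫ p in M.cell T, d₂ p * (b (M.side T 2) +
        ((M.leastSquares b).weakGrad T).2 * (p.2 - M.y T.2.castSucc))) = 0) :
    WeakFun.load f (M.leastSquares b) = ∑ T : M.Cell,
      (((M.leastSquares b).weakGrad T).1 * (∫ p in M.cell T, q₁ p) +
        ((M.leastSquares b).weakGrad T).2 * (∫ p in M.cell T, q₂ p) +
        M.weight T * M.defect b T / M.hy T * (∫ p in M.cell T, d₁ p) -
        M.weight T * M.defect b T / M.hx T * (∫ p in M.cell T, d₂ p) -
        ((M.leastSquares b).weakGrad T).2 *
          (∫ p in M.cell T, d₁ p * (p.2 - (M.y T.2.castSucc + M.y T.2.succ) / 2)) -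
        ((M.leastSquares b).weakGrad T).1 *
          (∫ p in M.cell T, d₂ p * (p.1 - (M.x T.1.castSucc + M.x T.1.succ) / 2))) := by
  -- The two telescoped sums, both zero, are added so that the identity can be checked cell by cell.
  rw [← add_zero (WeakFun.load f _), ← add_zero 0, add_zero 0]
  nth_rewrite 1 [← hx]
  rw [← add_zero (_ + _)]
  nth_rewrite 1 [← hy]
  rw [WeakFun.load, ← Finset.sum_add_distrib, ← Finset.sum_add_distrib]
  refine Finset.sum_congr rfl fun T _ => ?_
  have h1 := hd₁.mono_set (M.cell_subset T)
  have h2 := hd₂.mono_set (M.cell_subset T)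
  have hc : Continuous (affine ((M.leastSquares b).int T)) := by unfold affine; fun_prop
  have e : ∫ p in M.cell T, f p * affine ((M.leastSquares b).int T) p =
      -(∫ p in M.cell T, d₁ p * affine ((M.leastSquares b).int T) p) -
        ∫ p in M.cell T, d₂ p * affine ((M.leastSquares b).int T) p := by
    rw [← integral_neg]
    refine Eq.trans ?_ (integral_sub (Integrable.neg (integrableOn_rect_mul h1 hc))
      (integrableOn_rect_mul h2 hc))
    refine integral_congr_ae ?_
    filter_upwards [ae_restrict_of_ae_restrict_of_subset (M.cell_subset T) hdiv] with p hp
    linear_combination affine ((M.leastSquares b).int T) p * hp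
  have e1 := integral_mul_affine h1 (P := fun p => b (M.side T 0) +
    ((M.leastSquares b).weakGrad T).1 * (p.1 - M.x T.1.castSucc))
    (R := fun p => p.2 - (M.y T.2.castSucc + M.y T.2.succ) / 2) (by fun_prop) (by fun_prop)
    (-(M.weight T * M.defect b T / M.hy T)) ((M.leastSquares b).weakGrad T).2
  have e2 := integral_mul_affine h2 (P := fun p => b (M.side T 2) +
    ((M.leastSquares b).weakGrad T).2 * (p.2 - M.y T.2.castSucc))
    (R := fun p => p.1 - (M.x T.1.castSucc + M.x T.1.succ) / 2) (by fun_prop) (by fun_prop)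
    (M.weight T * M.defect b T / M.hx T) ((M.leastSquares b).weakGrad T).1
  rw [e]
  have e3 : ∫ p in M.cell T, d₁ p * affine ((M.leastSquares b).int T) p = _ :=
    (integral_congr_ae (ae_of_all _ fun p => by
      rw [affine_leastSquares_x, sub_eq_add_neg])).trans e1
  have e4 : ∫ p in M.cell T, d₂ p * affine ((M.leastSquares b).int T) p = _ :=
    (integral_congr_ae (ae_of_all _ fun p => by
      rw [affine_leastSquares_y])).trans e2
  rw [e3, e4]
  ring

end RectMesh

/-! ### Traces and edge means -/

theorem IsTrace.swap {x₀ x₁ y₀ y₁ : ℝ} {w wx wy τ : ℝ × ℝ → ℝ}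
    (h : IsTrace x₀ x₁ y₀ y₁ w wx wy τ) :
    IsTrace y₀ y₁ x₀ x₁ (fun p => w p.swap) (fun p => wy p.swap) (fun p => wx p.swap)
      (fun p => τ p.swap) := by
  refine ⟨h.2.1, h.1, fun φ hφ => ?_⟩
  have hs : ContDiff ℝ ∞ (fun p : ℝ × ℝ => φ p.swap) := hφ.comp (contDiff_snd.prodMk contDiff_fst)
  have hd : Differentiable ℝ φ := hφ.differentiable (by simp)
  obtain ⟨h1, h2⟩ := h.2.2 _ hs
  simp only [dx_swap hd, dy_swap hd] at h1 h2
  constructor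
  · rw [← integral_rect_swap]
    exact h2
  · rw [← integral_rect_swap]
    exact h1

/-- Affine weights in `x` suffice: by the choice of `α` and `β` either vertical side can be
isolated. -/
theorem IsTrace.integral_affine_mul {x₀ x₁ y₀ y₁ : ℝ} {w wx wy τ : ℝ × ℝ → ℝ}
    (h : IsTrace x₀ x₁ y₀ y₁ w wx wy τ) (α β : ℝ) {χ : ℝ → ℝ} (hχ : ContDiff ℝ ∞ χ) :
    ∫ p in rect x₀ x₁ y₀ y₁, (wx p * (α + β * p.1) + w p * β) * χ p.2 =
      (α + β * x₁) * (∫ y in y₀..y₁, τ (x₁, y) * χ y) -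
        (α + β * x₀) * ∫ y in y₀..y₁, τ (x₀, y) * χ y := by
  have hη : ContDiff ℝ ∞ fun x : ℝ => α + β * x := by fun_prop
  have h1 := (h.2.2 (fun p => (α + β * p.1) * χ p.2)
    ((hη.comp contDiff_fst).mul (hχ.comp contDiff_snd))).1
  have hd : ∀ x, deriv (fun x : ℝ => α + β * x) x = β := fun x =>
    ((((hasDerivAt_id x).const_mul β).const_add α).deriv).trans (mul_one β)
  simp only [dx_tensor (η := fun x : ℝ => α + β * x) (hη.differentiable (by simp))
    (hχ.differentiable (by simp)), hd] at h1
  rw [← intervalIntegral.integral_const_mul, ← intervalIntegral.integral_const_mul]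
  convert h1 using 2
  · ext p; ring
  · congr 1; ext y; ring
  · congr 1; ext y; ring

theorem IsTrace.integral_affine {x₀ x₁ y₀ y₁ : ℝ} {w wx wy τ : ℝ × ℝ → ℝ}
    (h : IsTrace x₀ x₁ y₀ y₁ w wx wy τ) (hw : IntegrableOn w (rect x₀ x₁ y₀ y₁))
    (hwx : IntegrableOn wx (rect x₀ x₁ y₀ y₁)) (α β : ℝ) :
    (∫ p in rect x₀ x₁ y₀ y₁, wx p * (α + β * p.1)) + β * (∫ p in rect x₀ x₁ y₀ y₁, w p) =
      (α + β * x₁) * (∫ y in y₀..y₁, τ (x₁, y)) -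
        (α + β * x₀) * ∫ y in y₀..y₁, τ (x₀, y) := by
  have h1 := h.integral_affine_mul α β (χ := fun _ => 1) contDiff_const
  simp only [mul_one] at h1
  rw [← h1, ← integral_const_mul]
  refine (integral_add (integrableOn_rect_mul hwx (g := fun p => α + β * p.1) (by fun_prop))
    (hw.const_mul β)).symm.trans ?_
  congr 1; ext p; ring

theorem IsTrace.intervalIntegrable_left {x₀ x₁ y₀ y₁ : ℝ} {w wx wy τ : ℝ × ℝ → ℝ}
    (h : IsTrace x₀ x₁ y₀ y₁ w wx wy τ) {x : ℝ} (hx : x ∈ ({x₀, x₁} : Set ℝ)) :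
    IntegrableOn (fun y => τ (x, y)) (Icc y₀ y₁) :=
  (h.1 x hx).integrable (by norm_num)

/-- The trace on `∂Ω`, integrated over a part of a vertical side. -/
theorem IsTrace.integral_affine_of_subset {w wx wy τ : ℝ × ℝ → ℝ}
    (h : IsTrace 0 1 0 1 w wx wy τ) (hw : IntegrableOn w Ω)
    (hwx : IntegrableOn wx Ω) (α β : ℝ) {c d : ℝ} (hc : 0 ≤ c) (hcd : c ≤ d) (hd : d ≤ 1) :
    (∫ p in rect 0 1 c d, wx p * (α + β * p.1)) + β * (∫ p in rect 0 1 c d, w p) =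
      (α + β) * (∫ y in c..d, τ (1, y)) - α * ∫ y in c..d, τ (0, y) := by
  set F : ℝ × ℝ → ℝ := fun p => wx p * (α + β * p.1) + w p * β with hF
  have hsub : rect 0 1 c d ⊆ Ω := rect_mono le_rfl le_rfl hc hd
  have hFi : IntegrableOn F Ω :=
    (integrableOn_rect_mul hwx (g := fun p => α + β * p.1) (by fun_prop)).add (hw.mul_const β)
  have hI : ∀ {s t : ℝ}, s ≤ t → ∀ F : ℝ → ℝ, ∫ x in s..t, F x = ∫ x in Ioo s t, F x := by
    intro s t hst F
    rw [intervalIntegral.integral_of_le hst, integral_Ioc_eq_integral_Ioo]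
  have i0 : IntegrableOn (fun y => τ (0, y)) (Ioo 0 1) :=
    (h.intervalIntegrable_left (by simp)).mono_set Ioo_subset_Icc_self
  have i1 : IntegrableOn (fun y => τ (1, y)) (Ioo 0 1) :=
    (h.intervalIntegrable_left (by simp)).mono_set Ioo_subset_Icc_self
  have iK : IntegrableOn (fun y => ∫ x in Ioo (0:ℝ) 1, F (x, y)) (Ioo 0 1) := by
    have h1 := hFi
    unfold IntegrableOn at h1 ⊢
    rw [Ω, volume_restrict_rect] at h1
    exact h1.integral_prod_right
  have iτ : IntegrableOn (fun y => (α + β) * τ (1, y) - α * τ (0, y)) (Ioo 0 1) :=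
    (i1.const_mul (α + β)).sub (i0.const_mul α)
  have hmul : ∀ {F : ℝ → ℝ}, IntegrableOn F (Ioo 0 1) → ∀ {q : ℝ → ℝ}, Continuous q →
      IntegrableOn (fun x => F x * q x) (Ioo 0 1) := fun hF _ hq =>
    hF.mul_continuousOn_of_subset hq.continuousOn measurableSet_Ioo isCompact_Icc
      Ioo_subset_Icc_self
  -- Green's formula on the square holds for every `χ(y)`, so by the fundamental lemma it holds on
  -- almost every horizontal line and may be integrated over part of a side.
  have key : ∀ᵐ y ∂volume.restrict (Ioo (0:ℝ) 1),
      (∫ x in Ioo (0:ℝ) 1, F (x, y)) - ((α + β) * τ (1, y) - α * τ (0, y)) = 0 := by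
    refine ae_eq_zero_of_forall_isTest1 (Integrable.sub iK iτ) fun χ hχ => ?_
    have h1 := h.integral_affine_mul α β hχ.1
    have hFχ : IntegrableOn (fun p => F p * χ p.2) Ω :=
      integrableOn_rect_mul hFi (hχ.1.continuous.comp continuous_snd)
    have e1 : ∫ p in rect 0 1 0 1, F p * χ p.2 =
        ∫ y in Ioo (0:ℝ) 1, (∫ x in Ioo (0:ℝ) 1, F (x, y)) * χ y := by
      unfold IntegrableOn at hFχ
      rw [Ω, volume_restrict_rect] at hFχ
      rw [volume_restrict_rect, integral_prod_symm _ hFχ]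
      congr 1; ext y
      exact integral_mul_const (χ y) _
    have e2 : ∫ y in Ioo (0:ℝ) 1, ((α + β) * τ (1, y) - α * τ (0, y)) * χ y =
        (α + β * 1) * (∫ y in (0:ℝ)..1, τ (1, y) * χ y) -
        (α + β * 0) * ∫ y in (0:ℝ)..1, τ (0, y) * χ y := by
      rw [hI zero_le_one, hI zero_le_one, ← integral_const_mul, ← integral_const_mul]
      refine Eq.trans ?_ (integral_sub ((hmul i1 hχ.1.continuous).const_mul _)
        ((hmul i0 hχ.1.continuous).const_mul _))
      congr 1; ext y; ring
    rw [e1, ← e2, ← sub_eq_zero] at h1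
    refine Eq.trans ?_ h1
    refine Eq.trans ?_ (integral_sub (hmul iK hχ.1.continuous) (hmul iτ hχ.1.continuous))
    congr 1; ext y; ring
  have hcd' : Ioo c d ⊆ Ioo 0 1 := Ioo_subset_Ioo hc hd
  rw [hI hcd, hI hcd, ← integral_const_mul, ← integral_const_mul, ← integral_const_mul]
  refine Eq.trans ?_ (integral_sub ((i1.mono_set hcd').const_mul _)
    ((i0.mono_set hcd').const_mul _))
  have e3 : ∫ p in rect 0 1 c d, F p = ∫ y in Ioo c d, ∫ x in Ioo (0:ℝ) 1, F (x, y) := by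
    have h1 := hFi.mono_set hsub
    unfold IntegrableOn at h1
    rw [volume_restrict_rect] at h1 ⊢
    exact integral_prod_symm _ h1
  have e4 : (∫ p in rect 0 1 c d, wx p * (α + β * p.1)) + (∫ p in rect 0 1 c d, β * w p) =
      ∫ p in rect 0 1 c d, F p := by
    refine (integral_add (integrableOn_rect_mul (hwx.mono_set hsub) (g := fun p => α + β * p.1)
      (by fun_prop)) ((hw.mono_set hsub).const_mul β)).symm.trans ?_
    congr 1; ext p; simp only [hF]; ring
  rw [e4, e3]
  refine integral_congr_ae ?_
  filter_upwards [ae_restrict_of_ae_restrict_of_subset hcd' key] with y hy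
  linarith

namespace RectMesh

variable {M : RectMesh}

theorem n_pos (M : RectMesh) : 0 < M.n := by
  by_contra h
  have h0 : (0 : Fin (M.n + 1)) = Fin.last M.n := Fin.ext (by simp; omega)
  have := M.x_first
  rw [h0, M.x_last] at this
  exact one_ne_zero this

/-- `γ` is the trace of `u`, with the weak gradient `(ux, uy)`, on the edges. -/
def IsEdgeTraceOf (M : RectMesh) (u ux uy γ : ℝ × ℝ → ℝ) : Prop :=
  ∀ T : M.Cell, IsTrace (M.x T.1.castSucc) (M.x T.1.succ) (M.y T.2.castSucc) (M.y T.2.succ)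
    u ux uy γ

theorem IsEdgeTraceOf.swap {u ux uy γ : ℝ × ℝ → ℝ} (h : M.IsEdgeTraceOf u ux uy γ) :
    M.swap.IsEdgeTraceOf (fun p => u p.swap) (fun p => uy p.swap) (fun p => ux p.swap)
      (fun p => γ p.swap) := fun T => (h T.swap).swap

/-- Both traces are compared with the boundary values `V` of `u` on the row, `g` through the whole
row and `γ` through its first or last cell. -/
theorem IsEdgeTraceOf.integral_eq_integral_boundary {u ux uy γ g : ℝ × ℝ → ℝ}
    (h : M.IsEdgeTraceOf u ux uy γ) (hg : IsTrace 0 1 0 1 u ux uy g)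
    (hu : MemLp u 2 (volume.restrict Ω)) (hux : HasWeakDeriv Ω 1 0 u ux) (j : Fin M.m) :
    (∫ y in M.y j.castSucc..M.y j.succ, γ (0, y)) =
        (∫ y in M.y j.castSucc..M.y j.succ, g (0, y)) ∧
      (∫ y in M.y j.castSucc..M.y j.succ, γ (1, y)) =
        ∫ y in M.y j.castSucc..M.y j.succ, g (1, y) := by
  have hui : IntegrableOn u Ω := integrableOn_of_memLp hu
  have huxi : IntegrableOn ux Ω := integrableOn_of_memLp hux.1
  have hsub : rect 0 1 (M.y j.castSucc) (M.y j.succ) ⊆ Ω :=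
    rect_mono le_rfl le_rfl (M.y_nonneg _) (M.y_le_one _)
  obtain ⟨V, hV⟩ := (hux.greenX hu (M.y_nonneg j.castSucc)
    (M.y_le_one j.succ)).exists_boundary_values (hui.mono_set hsub) (huxi.mono_set hsub)
  have hd : ∀ α β : ℝ, deriv (fun x : ℝ => α + β * x) = fun _ => β := fun α β => funext fun x =>
    ((((hasDerivAt_id x).const_mul β).const_add α).deriv).trans (mul_one β)
  have hV' : ∀ s t, 0 ≤ s → s ≤ t → t ≤ 1 → ∀ α β : ℝ,
      (∫ p in rect s t (M.y j.castSucc) (M.y j.succ), ux p * (α + β * p.1)) +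
        β * (∫ p in rect s t (M.y j.castSucc) (M.y j.succ), u p) =
        V t * (α + β * t) - V s * (α + β * s) := by
    intro s t hs hst ht α β
    rw [← hV s t hs hst ht (fun x => α + β * x) (by fun_prop), hd, integral_mul_const]
    ring
  have hgV := fun α β => (hg.integral_affine_of_subset hui huxi α β (M.y_nonneg j.castSucc)
    (M.y_lt j).le (M.y_le_one j.succ)).symm.trans (hV' 0 1 le_rfl zero_le_one le_rfl α β)
  have hγV := fun i α β => ((h (i, j)).integral_affine
    (hui.mono_set (M.cell_subset (i, j))) (huxi.mono_set (M.cell_subset (i, j))) α β).symm.trans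
    (hV' _ _ (M.x_nonneg i.castSucc) (M.x_lt i).le (M.x_le_one i.succ) α β)
  constructor
  · have e0 : M.x (Fin.castSucc ⟨0, M.n_pos⟩) = 0 := M.x_first
    -- The weights `1 - x` on the row and `x₁ - x` on the first cell vanish at the right ends, so
    -- both identities involve only the value at `x = 0`.
    have h1 := hgV 1 (-1)
    have h2 := hγV ⟨0, M.n_pos⟩ (M.x (Fin.succ ⟨0, M.n_pos⟩)) (-1)
    have h3 := M.x_lt ⟨0, M.n_pos⟩
    simp only [e0] at h1 h2 h3
    have h4 : M.x (Fin.succ ⟨0, M.n_pos⟩) *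
        ((∫ y in M.y j.castSucc..M.y j.succ, γ (0, y)) -
          ∫ y in M.y j.castSucc..M.y j.succ, g (0, y)) = 0 := by
      linear_combination (-1 : ℝ) * h2 + M.x (Fin.succ ⟨0, M.n_pos⟩) * h1
    linarith [(mul_eq_zero.1 h4).resolve_left h3.ne']
  · have e0 : M.x (Fin.succ ⟨M.n - 1, Nat.sub_lt M.n_pos one_pos⟩) = 1 := by
      rw [← M.x_last]; congr 1; ext; simp; have := M.n_pos; omega
    have h1 := hgV 0 1
    have h2 := hγV ⟨M.n - 1, Nat.sub_lt M.n_pos one_pos⟩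
      (-M.x (Fin.castSucc ⟨M.n - 1, Nat.sub_lt M.n_pos one_pos⟩)) 1
    have h3 := M.x_lt ⟨M.n - 1, Nat.sub_lt M.n_pos one_pos⟩
    simp only [e0] at h1 h2 h3
    have h4 : (1 - M.x (Fin.castSucc ⟨M.n - 1, Nat.sub_lt M.n_pos one_pos⟩)) *
        ((∫ y in M.y j.castSucc..M.y j.succ, γ (1, y)) -
          ∫ y in M.y j.castSucc..M.y j.succ, g (1, y)) = 0 := by
      linear_combination h2 -
        (1 - M.x (Fin.castSucc ⟨M.n - 1, Nat.sub_lt M.n_pos one_pos⟩)) * h1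
    linarith [(mul_eq_zero.1 h4).resolve_left (sub_pos.2 h3).ne']

theorem IsEdgeTraceOf.Qb_eq_of_onBoundary {u ux uy γ g : ℝ × ℝ → ℝ}
    (h : M.IsEdgeTraceOf u ux uy γ) (hg : IsTrace 0 1 0 1 u ux uy g)
    (hu : MemLp u 2 (volume.restrict Ω)) (hux : HasWeakDeriv Ω 1 0 u ux)
    (huy : HasWeakDeriv Ω 0 1 u uy) (e : Edge M) (he : M.OnBoundary e) : M.Qb γ e = M.Qb g e := by
  cases e with
  | vert i j =>
    have h1 := h.integral_eq_integral_boundary hg hu hux j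
    rcases he with rfl | rfl
    · simp only [Qb, M.x_first, h1.1]
    · simp only [Qb, M.x_last, h1.2]
  | horiz i j =>
    have h1 := h.swap.integral_eq_integral_boundary hg.swap (memLp_rect_swap hu) huy.swap i
    have h2 : (∫ x in M.x i.castSucc..M.x i.succ, γ (x, 0)) =
        (∫ x in M.x i.castSucc..M.x i.succ, g (x, 0)) ∧
      (∫ x in M.x i.castSucc..M.x i.succ, γ (x, 1)) =
        ∫ x in M.x i.castSucc..M.x i.succ, g (x, 1) := h1
    rcases he with rfl | rfl
    · simp only [Qb, M.y_first, h2.1]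
    · simp only [Qb, M.y_last, h2.2]

/-- The commuting property of `Q_b`: Green's formula with the weight 1. -/
theorem IsEdgeTraceOf.Qb_sub_Qb_vert {u ux uy γ : ℝ × ℝ → ℝ} (h : M.IsEdgeTraceOf u ux uy γ)
    (hu : IntegrableOn u Ω) (hux : IntegrableOn ux Ω) (T : M.Cell) :
    (M.Qb γ (M.side T 1) - M.Qb γ (M.side T 0)) / M.hx T = M.mean ux T := by
  have h1 := (h T).integral_affine (hu.mono_set (M.cell_subset T))
    (hux.mono_set (M.cell_subset T)) 1 0
  simp only [zero_mul, add_zero, mul_one, one_mul] at h1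
  have e0 : M.Qb γ (M.side T 0) =
      (∫ y in M.y T.2.castSucc..M.y T.2.succ, γ (M.x T.1.castSucc, y)) / M.hy T := rfl
  have e1 : M.Qb γ (M.side T 1) =
      (∫ y in M.y T.2.castSucc..M.y T.2.succ, γ (M.x T.1.succ, y)) / M.hy T := rfl
  rw [e0, e1, ← sub_div, ← h1, mean, div_div, mul_comm]
  rfl

/-- The weight `x - midpoint` takes opposite values on the two sides, which produces their sum. -/
theorem IsEdgeTraceOf.Qb_add_Qb_vert {u ux uy γ : ℝ × ℝ → ℝ} (h : M.IsEdgeTraceOf u ux uy γ)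
    (hu : IntegrableOn u Ω) (hux : IntegrableOn ux Ω) (T : M.Cell) :
    (M.Qb γ (M.side T 0) + M.Qb γ (M.side T 1)) * (M.hx T * M.hy T) =
      2 * ((∫ p in M.cell T, ux p * (p.1 - (M.x T.1.castSucc + M.x T.1.succ) / 2)) +
        ∫ p in M.cell T, u p) := by
  have h1 := (h T).integral_affine (hu.mono_set (M.cell_subset T))
    (hux.mono_set (M.cell_subset T)) (-((M.x T.1.castSucc + M.x T.1.succ) / 2)) 1
  have e0 : M.Qb γ (M.side T 0) =
      (∫ y in M.y T.2.castSucc..M.y T.2.succ, γ (M.x T.1.castSucc, y)) / M.hy T := rfl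
  have e1 : M.Qb γ (M.side T 1) =
      (∫ y in M.y T.2.castSucc..M.y T.2.succ, γ (M.x T.1.succ, y)) / M.hy T := rfl
  have e2 : (∫ p in M.cell T, ux p * (p.1 - (M.x T.1.castSucc + M.x T.1.succ) / 2)) =
      ∫ p in M.cell T, ux p * (-((M.x T.1.castSucc + M.x T.1.succ) / 2) + 1 * p.1) := by
    congr 1; ext p; ring
  have hy := M.hy_pos T
  rw [e0, e1, e2]
  rw [one_mul, one_mul, one_mul, M.x_succ T] at h1
  rw [M.x_succ T]
  have h2 := h1
  unfold cell
  rw [M.x_succ T]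
  rw [h2]
  field_simp
  ring

/-- The sums over the vertical and over the horizontal pair both contain twice the integral of `u`,
which cancels and leaves first moments of the gradient. -/
theorem IsEdgeTraceOf.defect_Qb {u ux uy γ : ℝ × ℝ → ℝ} (h : M.IsEdgeTraceOf u ux uy γ)
    (hu : IntegrableOn u Ω) (hux : IntegrableOn ux Ω) (huy : IntegrableOn uy Ω) (T : M.Cell) :
    M.defect (M.Qb γ) T * (M.hx T * M.hy T) =
      2 * ((∫ p in M.cell T, ux p * (p.1 - (M.x T.1.castSucc + M.x T.1.succ) / 2)) -
        ∫ p in M.cell T, uy p * (p.2 - (M.y T.2.castSucc + M.y T.2.succ) / 2)) := by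
  have h1 := h.Qb_add_Qb_vert hu hux T
  have h2 := h.swap.Qb_add_Qb_vert (integrableOn_rect_swap hu) (integrableOn_rect_swap huy) T.swap
  have e2 : (∫ p in M.swap.cell T.swap, uy p.swap *
      (p.1 - (M.y T.2.castSucc + M.y T.2.succ) / 2)) =
      ∫ p in M.cell T, uy p * (p.2 - (M.y T.2.castSucc + M.y T.2.succ) / 2) :=
    M.integral_cell_swap T fun p => uy p * (p.2 - (M.y T.2.castSucc + M.y T.2.succ) / 2)
  have h3 : (M.Qb γ (M.side T 2) + M.Qb γ (M.side T 3)) * (M.hy T * M.hx T) =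
      2 * ((∫ p in M.swap.cell T.swap, uy p.swap *
        (p.1 - (M.y T.2.castSucc + M.y T.2.succ) / 2)) +
        ∫ p in M.swap.cell T.swap, u p.swap) := h2
  rw [e2, M.integral_cell_swap T u] at h3
  unfold defect
  linear_combination h1 - h3

theorem IsEdgeTraceOf.Qb_sub_Qb_horiz {u ux uy γ : ℝ × ℝ → ℝ} (h : M.IsEdgeTraceOf u ux uy γ)
    (hu : IntegrableOn u Ω) (huy : IntegrableOn uy Ω) (T : M.Cell) :
    (M.Qb γ (M.side T 3) - M.Qb γ (M.side T 2)) / M.hy T = M.mean uy T := by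
  have h2 := h.swap.Qb_sub_Qb_vert (integrableOn_rect_swap hu) (integrableOn_rect_swap huy) T.swap
  rw [M.mean_swap] at h2
  exact h2

end RectMesh

/-! ### Integration by parts inside cells, and fluxes -/

theorem HasWeakDeriv.integral_tensor_x {w w' : ℝ × ℝ → ℝ}
    (hw : MemLp w 2 (volume.restrict Ω)) (h : HasWeakDeriv Ω 1 0 w w') {a b c d : ℝ} (ha : 0 ≤ a)
    (hab : a ≤ b) (hb : b ≤ 1) (hc : 0 ≤ c) (hd : d ≤ 1) {η χ : ℝ → ℝ} (hη : IsTest1 a b η)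
    (hχ : Continuous χ) :
    ∫ p in rect a b c d, (w p * deriv η p.1 + w' p * η p.1) * χ p.2 = 0 := by
  obtain ⟨V, hV⟩ := h.greenX hw hc hd χ hχ
  have hz : ∀ x, x ∉ Ioo a b → η x = 0 := fun x hx =>
    image_eq_zero_of_notMem_tsupport fun h => hx (hη.2.2 h)
  rw [hV a b ha hab hb η (hη.1.of_le (by simp)), hz a (by simp), hz b (by simp)]
  simp

theorem HasWeakDeriv.integral_tensor_y {w w' : ℝ × ℝ → ℝ}
    (hw : MemLp w 2 (volume.restrict Ω)) (h : HasWeakDeriv Ω 0 1 w w') {a b c d : ℝ} (ha : 0 ≤ a)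
    (hb : b ≤ 1) (hc : 0 ≤ c) (hcd : c ≤ d) (hd : d ≤ 1) {η χ : ℝ → ℝ} (hη : Continuous η)
    (hχ : IsTest1 c d χ) :
    ∫ p in rect a b c d, (w p * deriv χ p.2 + w' p * χ p.2) * η p.1 = 0 := by
  rw [← integral_rect_swap]
  exact h.swap.integral_tensor_x (memLp_rect_swap hw) hc hcd hd ha hb hχ hη

theorem HasWeakDeriv.integral_add_eq_zero_y {a b c d : ℝ} {w w' : ℝ × ℝ → ℝ}
    (hw : MemLp w 2 (volume.restrict Ω)) (h : HasWeakDeriv Ω 0 1 w w') (ha : 0 ≤ a) (hb : b ≤ 1)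
    (hc : 0 ≤ c) (hd : d ≤ 1) {φ : ℝ × ℝ → ℝ} (hφ : IsTest (rect a b c d) φ) :
    ∫ p in rect a b c d, (w p * dy φ p + w' p * φ p) = 0 := by
  have hsub : rect a b c d ⊆ Ω := rect_mono ha hb hc hd
  have h2 := h.2 φ (hφ.mono hsub)
  simp only [Function.iterate_zero, Function.iterate_succ, Function.comp, id] at h2
  rw [setIntegral_eq_of_isTest hsub (fun p hp => by rw [hφ.dy.eq_zero hp, mul_zero]),
    setIntegral_eq_of_isTest hsub (fun p hp => by rw [hφ.eq_zero hp, mul_zero])] at h2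
  rw [integral_add (integrableOn_rect_mul (integrableOn_of_memLp (memLp_rect_mono hw ha hb hc hd))
    hφ.dy.1.continuous) (integrableOn_rect_mul (integrableOn_of_memLp
    (memLp_rect_mono h.1 ha hb hc hd)) hφ.1.continuous), h2]
  simp

namespace RectMesh

variable {M : RectMesh}

/-- The flux `(q₁, q₂)` has the weak divergence `-f` in `Ω`, and the partial derivatives
`d₁ = ∂q₁/∂x` and `d₂ = ∂q₂/∂y` in each element. -/
structure IsFlux (M : RectMesh) (q₁ q₂ d₁ d₂ f : ℝ × ℝ → ℝ) : Prop where
  int_q₁ : IntegrableOn q₁ Ω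
  int_q₂ : IntegrableOn q₂ Ω
  int_d₁ : IntegrableOn d₁ Ω
  int_d₂ : IntegrableOn d₂ Ω
  int_f : IntegrableOn f Ω
  weak : ∀ φ, IsTest Ω φ → ∫ p in Ω, (q₁ p * dx φ p + q₂ p * dy φ p) = ∫ p in Ω, f p * φ p
  div : ∀ᵐ p ∂volume.restrict Ω, f p + (d₁ p + d₂ p) = 0
  cell_x : ∀ (T : M.Cell) (η χ : ℝ → ℝ), IsTest1 (M.x T.1.castSucc) (M.x T.1.succ) η →
    Continuous χ → ∫ p in M.cell T, (q₁ p * deriv η p.1 + d₁ p * η p.1) * χ p.2 = 0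
  cell_y : ∀ (T : M.Cell) (η χ : ℝ → ℝ), Continuous η →
    IsTest1 (M.y T.2.castSucc) (M.y T.2.succ) χ →
    ∫ p in M.cell T, (q₂ p * deriv χ p.2 + d₂ p * χ p.2) * η p.1 = 0

theorem ae_swap {P : ℝ × ℝ → Prop} (h : ∀ᵐ p ∂volume.restrict Ω, P p) :
    ∀ᵐ p ∂volume.restrict Ω, P p.swap := by
  rw [Ω, volume_restrict_rect] at *
  exact Measure.measurePreserving_swap.quasiMeasurePreserving.ae h

theorem IsFlux.swap {q₁ q₂ d₁ d₂ f : ℝ × ℝ → ℝ} (h : M.IsFlux q₁ q₂ d₁ d₂ f) :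
    M.swap.IsFlux (fun p => q₂ p.swap) (fun p => q₁ p.swap) (fun p => d₂ p.swap)
      (fun p => d₁ p.swap) (fun p => f p.swap) where
  int_q₁ := integrableOn_rect_swap h.int_q₂
  int_q₂ := integrableOn_rect_swap h.int_q₁
  int_d₁ := integrableOn_rect_swap h.int_d₂
  int_d₂ := integrableOn_rect_swap h.int_d₁
  int_f := integrableOn_rect_swap h.int_f
  weak φ hφ := by
    have h1 := h.weak _ hφ.swap
    have hd : Differentiable ℝ φ := hφ.1.differentiable (by simp)
    simp only [dx_swap hd, dy_swap hd] at h1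
    rw [Ω] at *
    rw [← integral_rect_swap 0 1 0 1, ← integral_rect_swap 0 1 0 1 (fun p => f p.swap * φ p)]
    simp only [Prod.swap_swap]
    rw [← h1]
    congr 1; ext p; ring
  div := by
    filter_upwards [ae_swap h.div] with p hp
    linarith
  cell_x T η χ hη hχ := by
    rw [← h.cell_y T.swap χ η hχ hη]
    exact M.integral_cell_swap T.swap fun p => (q₂ p * deriv η p.2 + d₂ p * η p.2) * χ p.1
  cell_y T η χ hη hχ := by
    rw [← h.cell_x T.swap χ η hχ hη]
    exact M.integral_cell_swap T.swap fun p => (q₁ p * deriv χ p.1 + d₁ p * χ p.1) * η p.2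

theorem IsFlux.sum_eq_zero {q₁ q₂ d₁ d₂ f : ℝ × ℝ → ℝ} (h : M.IsFlux q₁ q₂ d₁ d₂ f)
    {v : Fin (M.n + 1) → Fin M.m → ℝ} (hv0 : v 0 = 0) (hvl : v (Fin.last M.n) = 0) :
    ∑ T : M.Cell, ((∫ p in M.cell T, q₁ p) *
      ((v T.1.succ T.2 - v T.1.castSucc T.2) / M.hx T) +
      ∫ p in M.cell T, d₁ p * (v T.1.castSucc T.2 +
        (v T.1.succ T.2 - v T.1.castSucc T.2) / M.hx T * (p.1 - M.x T.1.castSucc))) = 0 :=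
  sum_flux_eq_zero h.int_q₁ h.int_d₁ (fun j => greenX_of_weak_divergence h.int_q₁ h.int_q₂ h.int_d₁
    h.int_d₂ h.int_f h.weak h.div j fun i η χ hη hχ => h.cell_y (i, j) η χ hη hχ) hv0 hvl

theorem IsFlux.load_leastSquares {q₁ q₂ d₁ d₂ f : ℝ × ℝ → ℝ} (h : M.IsFlux q₁ q₂ d₁ d₂ f)
    (b : Edge M → ℝ) (hb : ∀ e, M.OnBoundary e → b e = 0) :
    WeakFun.load f (M.leastSquares b) = ∑ T : M.Cell,
      (((M.leastSquares b).weakGrad T).1 * (∫ p in M.cell T, q₁ p) +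
        ((M.leastSquares b).weakGrad T).2 * (∫ p in M.cell T, q₂ p) +
        M.weight T * M.defect b T / M.hy T * (∫ p in M.cell T, d₁ p) -
        M.weight T * M.defect b T / M.hx T * (∫ p in M.cell T, d₂ p) -
        ((M.leastSquares b).weakGrad T).2 *
          (∫ p in M.cell T, d₁ p * (p.2 - (M.y T.2.castSucc + M.y T.2.succ) / 2)) -
        ((M.leastSquares b).weakGrad T).1 *
          (∫ p in M.cell T, d₂ p * (p.1 - (M.x T.1.castSucc + M.x T.1.succ) / 2))) := by
  refine RectMesh.load_leastSquares b h.int_d₁ h.int_d₂ h.div ?_ ?_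
  · exact h.sum_eq_zero (v := fun i j => b (.vert i j)) (funext fun j => hb _ (Or.inl rfl))
      (funext fun j => hb _ (Or.inr rfl))
  · have h1 := h.swap.sum_eq_zero (v := fun j i => b (.horiz i j))
      (funext fun j => hb _ (Or.inl rfl)) (funext fun j => hb _ (Or.inr rfl))
    rw [← M.sum_swap, ← h1]
    refine Finset.sum_congr rfl fun T _ => ?_
    have e1 := M.integral_cell_swap T.swap q₂
    have e2 := M.integral_cell_swap T.swap fun p => d₂ p * (b (M.side T.swap 2) +
      ((M.leastSquares b).weakGrad T.swap).2 * (p.2 - M.y T.swap.2.castSucc))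
    exact congrArg₂ (· + ·) (congrArg (· * _) e1.symm) e2.symm

/-! ### The coefficient tensor -/

theorem measurableSet_cell (M : RectMesh) (T : M.Cell) : MeasurableSet (M.cell T) :=
  measurableSet_rect _ _ _ _

theorem isOpen_cell (M : RectMesh) (T : M.Cell) : IsOpen (M.cell T) := isOpen_rect _ _ _ _

/-- The tensor `a` has the value `A T` in each element `T`. -/
def HasValues (M : RectMesh) (a : ℝ × ℝ → Matrix (Fin 2) (Fin 2) ℝ)
    (A : M.Cell → Matrix (Fin 2) (Fin 2) ℝ) : Prop := ∀ T, ∀ p ∈ M.cell T, a p = A T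

/-- Inside a cell the tensor is a constant factor, so `a∇u` may be differentiated termwise and the
equation holds almost everywhere by testing inside the cell. Across the edges only the weak equation
is available, and no derivative of the flux is claimed there. -/
theorem isFlux_of_isSolution {a : ℝ × ℝ → Matrix (Fin 2) (Fin 2) ℝ}
    {A : M.Cell → Matrix (Fin 2) (Fin 2) ℝ} (hA : M.HasValues a A)
    {f u₁₀ u₀₁ u₂₀ u₁₁ u₀₂ : ℝ × ℝ → ℝ}
    (hf : MemLp f 2 (volume.restrict Ω))
    (h₁₀ : MemLp u₁₀ 2 (volume.restrict Ω)) (h₀₁ : MemLp u₀₁ 2 (volume.restrict Ω))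
    (h₂₀ : HasWeakDeriv Ω 1 0 u₁₀ u₂₀) (h₁₁ : HasWeakDeriv Ω 0 1 u₁₀ u₁₁)
    (h₁₁' : HasWeakDeriv Ω 1 0 u₀₁ u₁₁) (h₀₂ : HasWeakDeriv Ω 0 1 u₀₁ u₀₂)
    (hsol : ∀ φ, IsTest Ω φ →
      ∫ p in Ω, matForm (a p) (u₁₀ p, u₀₁ p) (dx φ p, dy φ p) = ∫ p in Ω, f p * φ p) :
    M.IsFlux (fun p => a p 0 0 * u₁₀ p + a p 0 1 * u₀₁ p)
      (fun p => a p 1 0 * u₁₀ p + a p 1 1 * u₀₁ p) (fun p => a p 0 0 * u₂₀ p + a p 0 1 * u₁₁ p)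
      (fun p => a p 1 0 * u₁₁ p + a p 1 1 * u₀₂ p) f := by
  have hint : ∀ (k : Fin 2) {w z : ℝ × ℝ → ℝ}, MemLp w 2 (volume.restrict Ω) →
      MemLp z 2 (volume.restrict Ω) → IntegrableOn (fun p => a p k 0 * w p + a p k 1 * z p) Ω := by
    intro k w z hw hz
    refine M.integrableOn_of_cells fun T => ?_
    have h1 : IntegrableOn (fun p => A T k 0 * w p + A T k 1 * z p) (M.cell T) :=
      (((integrableOn_of_memLp hw).mono_set (M.cell_subset T)).const_mul _).add
      (((integrableOn_of_memLp hz).mono_set (M.cell_subset T)).const_mul _)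
    refine h1.congr_fun (fun p hp => ?_) (M.measurableSet_cell T)
    simp only [hA T p hp]
  have hcell : ∀ (T : M.Cell) (k : Fin 2) {w₁ w₁' w₂ w₂' g g' : ℝ × ℝ → ℝ}, Continuous g →
      Continuous g' → MemLp w₁ 2 (volume.restrict Ω) → MemLp w₁' 2 (volume.restrict Ω) →
      MemLp w₂ 2 (volume.restrict Ω) → MemLp w₂' 2 (volume.restrict Ω) →
      ∫ p in M.cell T, (w₁ p * g' p + w₁' p * g p) = 0 →
      ∫ p in M.cell T, (w₂ p * g' p + w₂' p * g p) = 0 →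
      ∫ p in M.cell T, ((a p k 0 * w₁ p + a p k 1 * w₂ p) * g' p +
        (a p k 0 * w₁' p + a p k 1 * w₂' p) * g p) = 0 := by
    intro T k w₁ w₁' w₂ w₂' g g' hg hg' h1 h1' h2 h2' e1 e2
    have i1 : IntegrableOn (fun p => w₁ p * g' p + w₁' p * g p) (M.cell T) :=
      (integrableOn_rect_mul ((integrableOn_of_memLp h1).mono_set (M.cell_subset T)) hg').add
      (integrableOn_rect_mul ((integrableOn_of_memLp h1').mono_set (M.cell_subset T)) hg)
    have i2 : IntegrableOn (fun p => w₂ p * g' p + w₂' p * g p) (M.cell T) :=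
      (integrableOn_rect_mul ((integrableOn_of_memLp h2).mono_set (M.cell_subset T)) hg').add
      (integrableOn_rect_mul ((integrableOn_of_memLp h2').mono_set (M.cell_subset T)) hg)
    have e3 : ∫ p in M.cell T, ((a p k 0 * w₁ p + a p k 1 * w₂ p) * g' p +
        (a p k 0 * w₁' p + a p k 1 * w₂' p) * g p) =
        ∫ p in M.cell T, (A T k 0 * (w₁ p * g' p + w₁' p * g p) +
          A T k 1 * (w₂ p * g' p + w₂' p * g p)) := by
      refine setIntegral_congr_fun (M.measurableSet_cell T) fun p hp => ?_
      simp only [hA T p hp]; ring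
    rw [e3, integral_add (i1.const_mul _) (i2.const_mul _), integral_const_mul,
      integral_const_mul, e1, e2]
    simp
  have i_q₁ := hint 0 h₁₀ h₀₁
  have i_q₂ := hint 1 h₁₀ h₀₁
  have i_d₁ := hint 0 h₂₀.1 h₁₁.1
  have i_d₂ := hint 1 h₁₁.1 h₀₂.1
  have i_f : IntegrableOn f Ω := integrableOn_of_memLp hf
  have weak : ∀ φ, IsTest Ω φ → ∫ p in Ω, ((a p 0 0 * u₁₀ p + a p 0 1 * u₀₁ p) * dx φ p +
      (a p 1 0 * u₁₀ p + a p 1 1 * u₀₁ p) * dy φ p) = ∫ p in Ω, f p * φ p :=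
    fun φ hφ => hsol φ hφ
  refine ⟨i_q₁, i_q₂, i_d₁, i_d₂, i_f, weak, ?_, ?_, ?_⟩
  · refine M.ae_of_cells fun T => ?_
    have hsub := M.cell_subset T
    have ii : IntegrableOn (fun p => f p + ((a p 0 0 * u₂₀ p + a p 0 1 * u₁₁ p) +
        (a p 1 0 * u₁₁ p + a p 1 1 * u₀₂ p))) (M.cell T) :=
      (i_f.mono_set hsub).add ((i_d₁.mono_set hsub).add (i_d₂.mono_set hsub))
    rw [ae_restrict_iff' (M.measurableSet_cell T)]
    refine (M.isOpen_cell T).ae_eq_zero_of_integral_contDiff_smul_eq_zero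
      ii.locallyIntegrableOn fun φ hφ hc hs => ?_
    have ht : IsTest (M.cell T) φ := ⟨hφ, hc, hs⟩
    have e1 := hcell T 0 ht.1.continuous ht.dx.1.continuous h₁₀ h₂₀.1 h₀₁ h₁₁.1
      (h₂₀.integral_add_eq_zero h₁₀ (M.x_nonneg _) (M.x_le_one _) (M.y_nonneg _) (M.y_le_one _) ht)
      (h₁₁'.integral_add_eq_zero h₀₁ (M.x_nonneg _) (M.x_le_one _) (M.y_nonneg _) (M.y_le_one _)
        ht)
    have e2 := hcell T 1 ht.1.continuous ht.dy.1.continuous h₁₀ h₁₁.1 h₀₁ h₀₂.1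
      (h₁₁.integral_add_eq_zero_y h₁₀ (M.x_nonneg _) (M.x_le_one _) (M.y_nonneg _) (M.y_le_one _)
        ht)
      (h₀₂.integral_add_eq_zero_y h₀₁ (M.x_nonneg _) (M.x_le_one _) (M.y_nonneg _) (M.y_le_one _)
        ht)
    have e3 := weak φ (ht.mono hsub)
    rw [setIntegral_eq_of_isTest hsub (fun p hp => by
        rw [ht.dx.eq_zero hp, ht.dy.eq_zero hp, mul_zero, mul_zero, add_zero]),
      setIntegral_eq_of_isTest hsub (fun p hp => by rw [ht.eq_zero hp, mul_zero])] at e3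
    have hm : ∀ {w g : ℝ × ℝ → ℝ}, IntegrableOn w Ω → Continuous g →
        IntegrableOn (fun p => w p * g p) (M.cell T) := fun hw hg =>
      integrableOn_rect_mul (hw.mono_set hsub) hg
    rw [← setIntegral_eq_integral_of_forall_compl_eq_zero (s := M.cell T) fun p hp => by
      rw [ht.eq_zero hp, zero_smul]]
    rw [integral_add (hm i_q₁ ht.dx.1.continuous) (hm i_d₁ ht.1.continuous)] at e1
    rw [integral_add (hm i_q₂ ht.dy.1.continuous) (hm i_d₂ ht.1.continuous)] at e2
    rw [integral_add (hm i_q₁ ht.dx.1.continuous) (hm i_q₂ ht.dy.1.continuous)] at e3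
    have e4 : ∫ p in M.cell T, φ p • (f p + ((a p 0 0 * u₂₀ p + a p 0 1 * u₁₁ p) +
        (a p 1 0 * u₁₁ p + a p 1 1 * u₀₂ p))) =
        (∫ p in M.cell T, f p * φ p) +
        ((∫ p in M.cell T, (a p 0 0 * u₂₀ p + a p 0 1 * u₁₁ p) * φ p) +
        ∫ p in M.cell T, (a p 1 0 * u₁₁ p + a p 1 1 * u₀₂ p) * φ p) := by
      rw [← integral_add (hm i_d₁ ht.1.continuous) (hm i_d₂ ht.1.continuous)]
      refine Eq.trans ?_ (integral_add (hm i_f ht.1.continuous)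
        ((hm i_d₁ ht.1.continuous).add (hm i_d₂ ht.1.continuous)))
      congr 1; ext p
      simp only [smul_eq_mul]
      ring
    rw [e4]
    linarith
  · intro T η χ hη hχ
    have hη' : Continuous (deriv η) := hη.1.continuous_deriv (by simp)
    have e1 := h₂₀.integral_tensor_x h₁₀ (M.x_nonneg _) (M.x_lt T.1).le (M.x_le_one _)
      (M.y_nonneg T.2.castSucc) (M.y_le_one T.2.succ) hη hχ
    have e2 := h₁₁'.integral_tensor_x h₀₁ (M.x_nonneg _) (M.x_lt T.1).le (M.x_le_one _)
      (M.y_nonneg T.2.castSucc) (M.y_le_one T.2.succ) hη hχ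
    have := hcell T 0 (g := fun p => η p.1 * χ p.2) (g' := fun p => deriv η p.1 * χ p.2)
      ((hη.1.continuous.comp continuous_fst).mul (hχ.comp continuous_snd))
      ((hη'.comp continuous_fst).mul (hχ.comp continuous_snd)) h₁₀ h₂₀.1 h₀₁ h₁₁.1
      (by rw [← e1]; unfold cell; congr 1; ext p; ring)
      (by rw [← e2]; unfold cell; congr 1; ext p; ring)
    rw [← this]
    congr 1; ext p; ring
  · intro T η χ hη hχ
    have hχ' : Continuous (deriv χ) := hχ.1.continuous_deriv (by simp)
    have e1 := h₁₁.integral_tensor_y h₁₀ (M.x_nonneg T.1.castSucc) (M.x_le_one T.1.succ)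
      (M.y_nonneg _) (M.y_lt T.2).le (M.y_le_one _) hη hχ
    have e2 := h₀₂.integral_tensor_y h₀₁ (M.x_nonneg T.1.castSucc) (M.x_le_one T.1.succ)
      (M.y_nonneg _) (M.y_lt T.2).le (M.y_le_one _) hη hχ
    have := hcell T 1 (g := fun p => χ p.2 * η p.1) (g' := fun p => deriv χ p.2 * η p.1)
      ((hχ.1.continuous.comp continuous_snd).mul (hη.comp continuous_fst))
      ((hχ'.comp continuous_snd).mul (hη.comp continuous_fst)) h₁₀ h₁₁.1 h₀₁ h₀₂.1
      (by rw [← e1]; unfold cell; congr 1; ext p; ring)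
      (by rw [← e2]; unfold cell; congr 1; ext p; ring)
    rw [← this]
    congr 1; ext p; ring

/-- A point of the common edge that lies on no line of `M₀` is interior to a cell of `M₀`, and that
open cell meets both neighbours. -/
theorem eq_of_notMem_range {M M₀ : RectMesh} {a : ℝ × ℝ → Matrix (Fin 2) (Fin 2) ℝ}
    {A : M.Cell → Matrix (Fin 2) (Fin 2) ℝ} {A₀ : M₀.Cell → Matrix (Fin 2) (Fin 2) ℝ}
    (hA : M.HasValues a A) (hA₀ : M₀.HasValues a A₀) {i i' : Fin M.n} (hi : i.succ = i'.castSucc)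
    (hr : M.x i.succ ∉ range M₀.x) (j : Fin M.m) : A (i, j) = A (i', j) := by
  obtain ⟨y, hy, hyr⟩ := (Ioo_infinite (M.y_lt j)).exists_notMem_finite (finite_range M₀.y)
  have hx0 : 0 < M.x i.succ := lt_of_le_of_lt (M.x_nonneg _) (M.x_lt i)
  have hx1 : M.x i.succ < 1 := by rw [hi]; exact lt_of_lt_of_le (M.x_lt i') (M.x_le_one _)
  obtain ⟨T₀, hT₀⟩ := M₀.exists_mem_cell (p := (M.x i.succ, y))
    ⟨⟨hx0, hx1⟩, lt_of_le_of_lt (M.y_nonneg _) hy.1, lt_of_lt_of_le hy.2 (M.y_le_one _)⟩ hr hyr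
  obtain ⟨s, hs1, hs2⟩ := exists_between (max_lt (M.x_lt i) hT₀.1.1)
  obtain ⟨t, ht1, ht2⟩ := exists_between (lt_min (hi ▸ M.x_lt i' : M.x i.succ < M.x i'.succ)
    hT₀.1.2)
  have h1 : A (i, j) = A₀ T₀ := by
    rw [← hA (i, j) (s, y) ⟨⟨(le_max_left _ _).trans_lt hs1, hs2⟩, hy⟩]
    exact hA₀ T₀ (s, y) ⟨⟨(le_max_right _ _).trans_lt hs1, hs2.trans hT₀.1.2⟩, hT₀.2⟩
  have h2 : A (i', j) = A₀ T₀ := by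
    rw [← hA (i', j) (t, y) ⟨⟨by rw [← hi]; exact ht1, ht2.trans_le (min_le_left _ _)⟩, hy⟩]
    exact hA₀ T₀ (t, y) ⟨⟨hT₀.1.1.trans ht1, ht2.trans_le (min_le_right _ _)⟩, hT₀.2⟩
  rw [h1, h2]

open Classical in
-- The bound depends on `M₀` alone; this keeps the final constant independent of the mesh.
theorem sum_mem_range_le (M M₀ : RectMesh) :
    ∑ l, (if M.x l ∈ range M₀.x then (1 : ℝ) else 0) ≤ M₀.n + 1 := by
  rw [Finset.sum_boole]
  have h1 : ((Finset.univ.filter fun l => M.x l ∈ range M₀.x).image M.x) ⊆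
      Finset.univ.image M₀.x := by
    intro t ht
    simp only [Finset.mem_image, Finset.mem_filter, Finset.mem_univ, true_and] at ht ⊢
    obtain ⟨l, ⟨k, hk⟩, rfl⟩ := ht
    exact ⟨k, hk⟩
  have h2 := Finset.card_le_card h1
  rw [Finset.card_image_of_injective _ M.x_mono.injective] at h2
  have h3 : (Finset.univ.image M₀.x).card ≤ M₀.n + 1 :=
    Finset.card_image_le.trans (by simp)
  exact_mod_cast h2.trans h3

theorem HasValues.swap {a : ℝ × ℝ → Matrix (Fin 2) (Fin 2) ℝ}
    {A : M.Cell → Matrix (Fin 2) (Fin 2) ℝ} (h : M.HasValues a A) :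
    M.swap.HasValues (fun p => a p.swap) (fun T => A T.swap) :=
  fun T p hp => h T.swap p.swap ⟨hp.2, hp.1⟩

/-! ### The mesh size -/

theorem diam_le_h (M : RectMesh) (T : M.Cell) : M.diam T ≤ M.h :=
  le_ciSup (Set.finite_range M.diam).bddAbove T

theorem hx_le_diam (T : M.Cell) : M.hx T ≤ M.diam T :=
  Real.le_sqrt_of_sq_le (by linarith [sq_nonneg (M.hy T)])

theorem hy_le_diam (T : M.Cell) : M.hy T ≤ M.diam T :=
  Real.le_sqrt_of_sq_le (by linarith [sq_nonneg (M.hx T)])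

theorem exists_diam_eq_h (M : RectMesh) : ∃ T, M.diam T = M.h := by
  have : Nonempty M.Cell := ⟨(⟨0, M.n_pos⟩, ⟨0, M.swap.n_pos⟩)⟩
  exact exists_eq_ciSup_of_finite

theorem h_pos (M : RectMesh) : 0 < M.h := by
  obtain ⟨T, hT⟩ := M.exists_diam_eq_h
  rw [← hT]
  exact (M.hx_pos T).trans_le (hx_le_diam T)

theorem h_le_two (M : RectMesh) : M.h ≤ 2 := by
  obtain ⟨T, hT⟩ := M.exists_diam_eq_h
  rw [← hT]
  refine Real.sqrt_le_iff.2 ⟨by norm_num, ?_⟩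
  have h1 : M.hx T ≤ 1 := by
    unfold hx; linarith [M.x_nonneg T.1.castSucc, M.x_le_one T.1.succ]
  have h2 : M.hy T ≤ 1 := by
    unfold hy; linarith [M.y_nonneg T.2.castSucc, M.y_le_one T.2.succ]
  nlinarith [M.hx_pos T, M.hy_pos T]

/-- On a product mesh shape regularity forces quasi-uniformity: `T` is compared with a cell of
maximal diameter through the cell in the column of the one and the row of the other. Each comparison
costs a factor `κ`. -/
theorem ShapeRegular.quasiUniform {κ : ℝ} (hκ : 0 < κ) (H : M.ShapeRegular κ) :
    M.QuasiUniform (κ ^ 2) M.h := by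
  obtain ⟨S, hS⟩ := M.exists_diam_eq_h
  intro T
  refine ⟨⟨?_, (hx_le_diam T).trans (M.diam_le_h T)⟩, ?_, (hy_le_diam T).trans (M.diam_le_h T)⟩
  · have h1 : κ * M.h ≤ M.hy (T.1, S.2) := hS ▸ (H S).2
    have h2 := (H (T.1, S.2)).1
    have h3 : M.hx (T.1, S.2) = M.hx T := rfl
    calc κ ^ 2 * M.h = κ * (κ * M.h) := by ring
      _ ≤ κ * M.diam (T.1, S.2) := by gcongr; exact h1.trans (hy_le_diam _)
      _ ≤ M.hx T := h3 ▸ h2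
  · have h1 : κ * M.h ≤ M.hx (S.1, T.2) := hS ▸ (H S).1
    have h2 := (H (S.1, T.2)).2
    have h3 : M.hy (S.1, T.2) = M.hy T := rfl
    calc κ ^ 2 * M.h = κ * (κ * M.h) := by ring
      _ ≤ κ * M.diam (S.1, T.2) := by gcongr; exact h1.trans (hx_le_diam _)
      _ ≤ M.hy T := h3 ▸ h2

end RectMesh

/-! ### Derivatives of functions in `H^k(Ω)` -/

theorem MemSobolev.memLp {k : ℕ} {u : ℝ × ℝ → ℝ} (hu : MemSobolev Ω k u) {i j : ℕ}
    (h : i + j ≤ k) : MemLp (weakDeriv Ω i j u) 2 (volume.restrict Ω) := (weakDeriv_spec hu h).1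

theorem MemSobolev.hasWeakDeriv_x {k : ℕ} {u : ℝ × ℝ → ℝ} (hu : MemSobolev Ω k u) {i j : ℕ}
    (h : i + 1 + j ≤ k) : HasWeakDeriv Ω 1 0 (weakDeriv Ω i j u) (weakDeriv Ω (i + 1) j u) :=
  (weakDeriv_spec hu (by omega)).dx_step (weakDeriv_spec hu h)

theorem MemSobolev.hasWeakDeriv_y {k : ℕ} {u : ℝ × ℝ → ℝ} (hu : MemSobolev Ω k u) {i j : ℕ}
    (h : i + (j + 1) ≤ k) : HasWeakDeriv Ω 0 1 (weakDeriv Ω i j u) (weakDeriv Ω i (j + 1) u) :=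
  (weakDeriv_spec hu (by omega)).dy_step (weakDeriv_spec hu h)

theorem sobolevNorm_nonneg (U : Set (ℝ × ℝ)) (k : ℕ) (u : ℝ × ℝ → ℝ) : 0 ≤ sobolevNorm U k u :=
  Real.sqrt_nonneg _

theorem integral_sq_weakDeriv_le (U : Set (ℝ × ℝ)) (u : ℝ × ℝ → ℝ) {i j k : ℕ} (h : i + j ≤ k) :
    ∫ p in U, weakDeriv U i j u p ^ 2 ≤ sobolevNorm U k u ^ 2 := by
  have h0 : ∀ i j, 0 ≤ ∫ p in U, weakDeriv U i j u p ^ 2 :=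
    fun i j => integral_nonneg fun p => sq_nonneg _
  rw [sobolevNorm, Real.sq_sqrt (Finset.sum_nonneg fun i _ => Finset.sum_nonneg fun j _ => h0 i j)]
  exact (Finset.single_le_sum (f := fun j => ∫ p in U, weakDeriv U i j u p ^ 2)
    (fun j _ => h0 i j) (Finset.mem_range.2 (by omega : j < k + 1 - i))).trans
    (Finset.single_le_sum (f := fun i => ∑ j ∈ Finset.range (k + 1 - i),
      ∫ p in U, weakDeriv U i j u p ^ 2) (fun i _ => Finset.sum_nonneg fun j _ => h0 i j)
      (Finset.mem_range.2 (by omega : i < k + 1)))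

namespace RectMesh

variable {M : RectMesh}

/-! ### Moments on an element -/

theorem sq_integral_mul_sub_mid_le {k h : ℝ} (H : M.QuasiUniform k h) {w w' : ℝ × ℝ → ℝ}
    (hw : MemLp w 2 (volume.restrict Ω)) (h₁ : HasWeakDeriv Ω 1 0 w w') (T : M.Cell) :
    (∫ p in M.cell T, w p * (p.1 - (M.x T.1.castSucc + M.x T.1.succ) / 2)) ^ 2 ≤
      h ^ 4 * (M.hx T * M.hy T * ∫ p in M.cell T, w' p ^ 2) := by
  have h0 := M.hx_pos T
  have hh := (H T).1.2
  refine ((h₁.greenX hw (M.y_nonneg T.2.castSucc) (M.y_le_one T.2.succ)).sq_integral_mul_sub_mid_le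
    (integrableOn_of_memLp (memLp_rect_mono hw le_rfl le_rfl (M.y_nonneg _) (M.y_le_one _)))
    (memLp_rect_mono h₁.1 le_rfl le_rfl (M.y_nonneg _) (M.y_le_one _)) (M.x_nonneg _)
    (M.x_lt T.1).le (M.x_le_one _) (M.y_lt T.2).le).trans ?_
  have hI : 0 ≤ ∫ p in M.cell T, w' p ^ 2 := integral_nonneg fun p => sq_nonneg _
  have e : (M.x T.1.succ - M.x T.1.castSucc) = M.hx T := rfl
  have e' : (M.y T.2.succ - M.y T.2.castSucc) = M.hy T := rfl
  rw [e, e', ← pow_mul]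
  have := M.hy_pos T
  exact mul_le_mul_of_nonneg_right (pow_le_pow_left₀ h0.le hh 4) (by positivity)

/-- Two integrations by parts: the first moment of `w` becomes an integral of `w'` against a
parabola. Its mean gives the leading term, and the mean-zero remainder is paid for by `w''`. -/
theorem sq_mean_moment_sub_le {k h : ℝ} (hk : 0 < k) (hh : 0 < h) (H : M.QuasiUniform k h)
    {w w' w'' : ℝ × ℝ → ℝ} (hw : MemLp w 2 (volume.restrict Ω)) (h₁ : HasWeakDeriv Ω 1 0 w w')
    (h₂ : HasWeakDeriv Ω 1 0 w' w'') (T : M.Cell) :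
    (2 * (∫ p in M.cell T, w p * (p.1 - (M.x T.1.castSucc + M.x T.1.succ) / 2)) /
      (M.hx T * M.hy T) - M.hx T ^ 2 / 6 * M.mean w' T) ^ 2 ≤
      4 / k * h ^ 4 * ∫ p in M.cell T, w'' p ^ 2 := by
  have hx := M.hx_pos T
  have hy := M.hy_pos T
  have hsub : rect 0 1 (M.y T.2.castSucc) (M.y T.2.succ) ⊆ Ω :=
    rect_mono le_rfl le_rfl (M.y_nonneg _) (M.y_le_one _)
  have hw₁ : MemLp w' 2 (volume.restrict (rect 0 1 (M.y T.2.castSucc) (M.y T.2.succ))) :=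
    memLp_rect_mono h₁.1 le_rfl le_rfl (M.y_nonneg _) (M.y_le_one _)
  obtain ⟨V, hV⟩ := (h₁.greenX hw (M.y_nonneg T.2.castSucc)
    (M.y_le_one T.2.succ)).exists_boundary_values
    ((integrableOn_of_memLp hw).mono_set hsub) (integrableOn_of_memLp hw₁)
  set s := M.x T.1.castSucc with hs
  set t := M.x T.1.succ with ht
  have ets : t - s = M.hx T := rfl
  have hd : ∀ x, HasDerivAt (fun x : ℝ => (x - (s + t) / 2) ^ 2 / 2 - (t - s) ^ 2 / 8)
      (x - (s + t) / 2) x := fun x => by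
    have := ((((hasDerivAt_id x).sub_const ((s + t) / 2)).pow 2).div_const 2).sub_const
      ((t - s) ^ 2 / 8)
    exact HasDerivAt.congr_deriv this (by simp)
  have h3 := hV s t (M.x_nonneg _) (M.x_lt T.1).le (M.x_le_one _)
    (fun x => (x - (s + t) / 2) ^ 2 / 2 - (t - s) ^ 2 / 8) (by fun_prop)
  rw [show deriv (fun x : ℝ => (x - (s + t) / 2) ^ 2 / 2 - (t - s) ^ 2 / 8) =
    fun x => x - (s + t) / 2 from funext fun x => (hd x).deriv] at h3
  have hi' : IntegrableOn w' (M.cell T) := (integrableOn_of_memLp h₁.1).mono_set (M.cell_subset T)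
  -- The parabola splits as its mean-zero part plus its mean, `1/24 - 1/8 = -1/12`.
  have h4 : ∫ q in M.cell T, w' q * ((q.1 - (s + t) / 2) ^ 2 / 2 - (t - s) ^ 2 / 8) =
      (∫ q in M.cell T, w' q * ((q.1 - (s + t) / 2) ^ 2 / 2 - (t - s) ^ 2 / 24)) -
        (t - s) ^ 2 / 12 * ∫ q in M.cell T, w' q := by
    rw [← integral_const_mul]
    refine Eq.trans ?_ (integral_sub (integrableOn_rect_mul hi'
      (g := fun q => (q.1 - (s + t) / 2) ^ 2 / 2 - (t - s) ^ 2 / 24) (by fun_prop))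
      (hi'.const_mul _))
    congr 1; ext q; ring
  have h5 := (h₂.greenX h₁.1 (M.y_nonneg T.2.castSucc)
    (M.y_le_one T.2.succ)).sq_integral_mul_quadratic_le (integrableOn_of_memLp hw₁)
    (memLp_rect_mono h₂.1 le_rfl le_rfl (M.y_nonneg _) (M.y_le_one _)) (M.x_nonneg _)
    (M.x_lt T.1).le (M.x_le_one _) (M.y_lt T.2).le
  change (∫ q in M.cell T, w' q * ((q.1 - (s + t) / 2) ^ 2 / 2 - (t - s) ^ 2 / 24)) ^ 2 ≤
    (M.hx T ^ 3) ^ 2 * (M.hx T * M.hy T * ∫ q in M.cell T, w'' q ^ 2) at h5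
  change (∫ q in M.cell T, w q * (q.1 - (s + t) / 2)) +
    (∫ q in M.cell T, w' q * ((q.1 - (s + t) / 2) ^ 2 / 2 - (t - s) ^ 2 / 8)) = _ at h3
  set J := ∫ q in M.cell T, w' q * ((q.1 - (s + t) / 2) ^ 2 / 2 - (t - s) ^ 2 / 24)
  set I := ∫ q in M.cell T, w'' q ^ 2 with hI
  have hI0 : 0 ≤ I := integral_nonneg fun p => sq_nonneg _
  have h6 : ∫ q in M.cell T, w q * (q.1 - (s + t) / 2) =
      M.hx T ^ 2 / 12 * (∫ q in M.cell T, w' q) - J := by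
    rw [h4, ets] at h3
    have e1 : (t - (s + t) / 2) ^ 2 / 2 - (t - s) ^ 2 / 8 = 0 := by ring
    have e2 : (s - (s + t) / 2) ^ 2 / 2 - (t - s) ^ 2 / 8 = 0 := by ring
    rw [ets] at e1 e2
    rw [e1, e2] at h3
    linarith
  have h7 : 2 * (∫ q in M.cell T, w q * (q.1 - (s + t) / 2)) / (M.hx T * M.hy T) -
      M.hx T ^ 2 / 6 * M.mean w' T = -2 * J / (M.hx T * M.hy T) := by
    rw [h6, mean]
    field_simp
    ring
  have hkh := mul_pos hk hh
  rw [h7, div_pow, mul_pow, div_le_iff₀ (by positivity)]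
  calc (-2) ^ 2 * J ^ 2 ≤ (-2) ^ 2 * ((M.hx T ^ 3) ^ 2 * (M.hx T * M.hy T * I)) := by gcongr
    _ = 4 / k * (k * M.hx T) * M.hx T ^ 4 * I * (M.hx T ^ 2 * M.hy T) := by field_simp; ring
    _ ≤ 4 / k * M.hy T * h ^ 4 * I * (M.hx T ^ 2 * M.hy T) := by
        have a1 : k * M.hx T ≤ M.hy T :=
          (mul_le_mul_of_nonneg_left (H T).1.2 hk.le).trans (H T).2.1
        have a2 := (H T).1.2
        gcongr
    _ = 4 / k * h ^ 4 * I * (M.hx T * M.hy T) ^ 2 := by ring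

/-- The defect of `Q_b u` on `T`, up to terms of higher order. -/
theorem IsEdgeTraceOf.sq_defect_Qb_sub_le {k h : ℝ} (hk : 0 < k) (hh : 0 < h)
    (H : M.QuasiUniform k h) {u u₁₀ u₀₁ u₂₀ u₀₂ u₃₀ u₀₃ γ : ℝ × ℝ → ℝ}
    (hγ : M.IsEdgeTraceOf u u₁₀ u₀₁ γ) (hu : IntegrableOn u Ω)
    (h₁₀ : MemLp u₁₀ 2 (volume.restrict Ω)) (h₀₁ : MemLp u₀₁ 2 (volume.restrict Ω))
    (h₂₀ : HasWeakDeriv Ω 1 0 u₁₀ u₂₀) (h₃₀ : HasWeakDeriv Ω 1 0 u₂₀ u₃₀)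
    (h₀₂ : HasWeakDeriv Ω 0 1 u₀₁ u₀₂) (h₀₃ : HasWeakDeriv Ω 0 1 u₀₂ u₀₃) (T : M.Cell) :
    (M.defect (M.Qb γ) T - (M.hx T ^ 2 / 6 * M.mean u₂₀ T - M.hy T ^ 2 / 6 * M.mean u₀₂ T)) ^ 2 ≤
      8 / k * h ^ 4 * ((∫ p in M.cell T, u₃₀ p ^ 2) + ∫ p in M.cell T, u₀₃ p ^ 2) := by
  have h1 := sq_mean_moment_sub_le hk hh H h₁₀ h₂₀ h₃₀ T
  have h2 := sq_mean_moment_sub_le hk hh H.swap (memLp_rect_swap h₀₁) h₀₂.swap h₀₃.swap T.swap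
  rw [M.mean_swap, M.integral_cell_swap T fun p => u₀₃ p ^ 2] at h2
  have e1 : (∫ p in M.swap.cell T.swap, u₀₁ p.swap *
      (p.1 - (M.swap.x T.swap.1.castSucc + M.swap.x T.swap.1.succ) / 2)) =
      ∫ p in M.cell T, u₀₁ p * (p.2 - (M.y T.2.castSucc + M.y T.2.succ) / 2) :=
    M.integral_cell_swap T fun p => u₀₁ p * (p.2 - (M.y T.2.castSucc + M.y T.2.succ) / 2)
  have h2 : (2 * (∫ p in M.cell T, u₀₁ p * (p.2 - (M.y T.2.castSucc + M.y T.2.succ) / 2)) /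
      (M.hx T * M.hy T) - M.hy T ^ 2 / 6 * M.mean u₀₂ T) ^ 2 ≤
      4 / k * h ^ 4 * ∫ p in M.cell T, u₀₃ p ^ 2 := by
    rw [← e1, mul_comm (M.hx T)]
    exact h2
  have e4 := hγ.defect_Qb hu (integrableOn_of_memLp h₁₀) (integrableOn_of_memLp h₀₁) T
  have hs := mul_pos (M.hx_pos T) (M.hy_pos T)
  rw [← eq_div_iff hs.ne', mul_sub, sub_div] at e4
  rw [e4]
  set P := 2 * (∫ p in M.cell T, u₁₀ p * (p.1 - (M.x T.1.castSucc + M.x T.1.succ) / 2)) /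
    (M.hx T * M.hy T)
  set Q := 2 * (∫ p in M.cell T, u₀₁ p * (p.2 - (M.y T.2.castSucc + M.y T.2.succ) / 2)) /
    (M.hx T * M.hy T)
  have h3 := sq_nonneg (P - M.hx T ^ 2 / 6 * M.mean u₂₀ T + (Q - M.hy T ^ 2 / 6 * M.mean u₀₂ T))
  have h4 : 8 / k * h ^ 4 * ((∫ p in M.cell T, u₃₀ p ^ 2) + ∫ p in M.cell T, u₀₃ p ^ 2) =
    2 * (4 / k * h ^ 4 * ∫ p in M.cell T, u₃₀ p ^ 2) +
      2 * (4 / k * h ^ 4 * ∫ p in M.cell T, u₀₃ p ^ 2) := by ring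
  rw [h4]
  nlinarith [h1, h2, h3]

theorem HasValues.integral_mul_add_mul {a : ℝ × ℝ → Matrix (Fin 2) (Fin 2) ℝ}
    {A : M.Cell → Matrix (Fin 2) (Fin 2) ℝ} (hA : M.HasValues a A) (T : M.Cell) (r : Fin 2)
    {w₁ w₂ g : ℝ × ℝ → ℝ} (h₁ : MemLp w₁ 2 (volume.restrict Ω))
    (h₂ : MemLp w₂ 2 (volume.restrict Ω)) (hg : Continuous g) :
    ∫ p in M.cell T, (a p r 0 * w₁ p + a p r 1 * w₂ p) * g p =
      A T r 0 * (∫ p in M.cell T, w₁ p * g p) + A T r 1 * ∫ p in M.cell T, w₂ p * g p := by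
  rw [← integral_const_mul, ← integral_const_mul]
  refine Eq.trans ?_ (MeasureTheory.integral_add
    ((integrableOn_rect_mul ((integrableOn_of_memLp h₁).mono_set (M.cell_subset T)) hg).const_mul _)
    ((integrableOn_rect_mul ((integrableOn_of_memLp h₂).mono_set
      (M.cell_subset T)) hg).const_mul _))
  refine setIntegral_congr_fun (M.measurableSet_cell T) fun p hp => ?_
  simp only [hA T p hp]; ring

theorem HasValues.integral_add {a : ℝ × ℝ → Matrix (Fin 2) (Fin 2) ℝ}
    {A : M.Cell → Matrix (Fin 2) (Fin 2) ℝ} (hA : M.HasValues a A) (T : M.Cell) (r : Fin 2)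
    {w₁ w₂ : ℝ × ℝ → ℝ} (h₁ : MemLp w₁ 2 (volume.restrict Ω))
    (h₂ : MemLp w₂ 2 (volume.restrict Ω)) :
    ∫ p in M.cell T, (a p r 0 * w₁ p + a p r 1 * w₂ p) =
      M.hx T * M.hy T * (A T r 0 * M.mean w₁ T + A T r 1 * M.mean w₂ T) := by
  have h := hA.integral_mul_add_mul T r h₁ h₂ (g := fun _ => 1) continuous_const
  simp only [mul_one] at h
  rw [h, ← M.mean_mul, ← M.mean_mul]
  ring

theorem HasValues.sq_integral_mul_sub_mid_le {k h β : ℝ} (H : M.QuasiUniform k h)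
    {a : ℝ × ℝ → Matrix (Fin 2) (Fin 2) ℝ} {A : M.Cell → Matrix (Fin 2) (Fin 2) ℝ}
    (hA : M.HasValues a A) (T : M.Cell) (r : Fin 2) (hβ : ∀ s, |A T r s| ≤ β)
    {w₁ w₁' w₂ w₂' : ℝ × ℝ → ℝ} (hw₁ : MemLp w₁ 2 (volume.restrict Ω))
    (h₁ : HasWeakDeriv Ω 1 0 w₁ w₁') (hw₂ : MemLp w₂ 2 (volume.restrict Ω))
    (h₂ : HasWeakDeriv Ω 1 0 w₂ w₂') :
    (∫ p in M.cell T, (a p r 0 * w₁ p + a p r 1 * w₂ p) *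
      (p.1 - (M.x T.1.castSucc + M.x T.1.succ) / 2)) ^ 2 ≤
      2 * β ^ 2 * h ^ 4 * (M.hx T * M.hy T) *
        ((∫ p in M.cell T, w₁' p ^ 2) + ∫ p in M.cell T, w₂' p ^ 2) := by
  rw [hA.integral_mul_add_mul T r hw₁ hw₂
    (g := fun p => p.1 - (M.x T.1.castSucc + M.x T.1.succ) / 2) (by fun_prop)]
  have e1 := RectMesh.sq_integral_mul_sub_mid_le H hw₁ h₁ T
  have e2 := RectMesh.sq_integral_mul_sub_mid_le H hw₂ h₂ T
  have b1 := sq_le_sq' (abs_le.1 (hβ 0)).1 (abs_le.1 (hβ 0)).2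
  have b2 := sq_le_sq' (abs_le.1 (hβ 1)).1 (abs_le.1 (hβ 1)).2
  refine (add_sq_le (a := A T r 0 * _) (b := A T r 1 * _)).trans ?_
  rw [mul_pow, mul_pow]
  have f1 := mul_le_mul b1 e1 (sq_nonneg _) (sq_nonneg _)
  have f2 := mul_le_mul b2 e2 (sq_nonneg _) (sq_nonneg _)
  linarith

end RectMesh

/-! ### Bounds for the coefficient tensor -/

/-- The unit vectors bound the diagonal; `(1, 1)` and `(1, -1)` bound the off-diagonal entry, the
trace being positive. -/
theorem abs_entry_le {A : Matrix (Fin 2) (Fin 2) ℝ} (hs : A.IsSymm) {α β : ℝ} (hα : 0 < α)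
    (h : ∀ ξ : ℝ × ℝ, α * (ξ.1 ^ 2 + ξ.2 ^ 2) ≤ matForm A ξ ξ ∧
      matForm A ξ ξ ≤ β * (ξ.1 ^ 2 + ξ.2 ^ 2)) (r s : Fin 2) : |A r s| ≤ β := by
  have h01 : A 1 0 = A 0 1 := hs.apply 0 1
  have h1 := h (1, 0)
  have h2 := h (0, 1)
  have h3 := h (1, 1)
  have h4 := h (1, -1)
  simp only [matForm, h01] at h1 h2 h3 h4
  norm_num at h1 h2 h3 h4
  rw [abs_le]
  fin_cases r <;> fin_cases s <;> simp only [Fin.zero_eta, Fin.mk_one, h01] <;>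
    constructor <;> linarith [h1.1, h1.2, h2.1, h2.2, h3.1, h3.2, h4.1, h4.2]

/-- The energy estimate on an element of area `s`, for the error `e` and an approximation `g`. -/
theorem sq_le_of_energy {A : Matrix (Fin 2) (Fin 2) ℝ} {α β : ℝ} (hα : 0 < α)
    (h : ∀ ξ : ℝ × ℝ, α * (ξ.1 ^ 2 + ξ.2 ^ 2) ≤ matForm A ξ ξ) (hβ : ∀ r s, |A r s| ≤ β)
    {s σ : ℝ} (hs : 0 < s) (hσ : 0 ≤ σ) (e g : ℝ × ℝ) (l l' R t₁ t₂ : ℝ) :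
    s * (e.1 ^ 2 + e.2 ^ 2) ≤
      4 / α * (s * matForm A e (e - g) + σ * (l * (l - l')) - σ * (l - l') * R -
        (e - g).1 * t₁ - (e - g).2 * t₂) +
      (σ / α * (R - l') ^ 2 + 4 / α ^ 2 * ((t₁ ^ 2 + t₂ ^ 2) / s) +
        (16 * β ^ 2 / α ^ 2 + 2) * (s * (g.1 ^ 2 + g.2 ^ 2))) := by
  obtain ⟨v, rfl⟩ : ∃ v, e = v + g := ⟨e - g, by simp⟩
  rw [add_sub_cancel_right]
  have hv := h v
  have hsq : ∀ r s, A r s ^ 2 ≤ β ^ 2 := fun r s =>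
    sq_le_sq' (abs_le.1 (hβ r s)).1 (abs_le.1 (hβ r s)).2
  have hc : ∀ r, (A r 0 * g.1 + A r 1 * g.2) ^ 2 ≤ 2 * β ^ 2 * (g.1 ^ 2 + g.2 ^ 2) := fun r => by
    have h1 := mul_le_mul_of_nonneg_right (hsq r 0) (sq_nonneg g.1)
    have h2 := mul_le_mul_of_nonneg_right (hsq r 1) (sq_nonneg g.2)
    nlinarith [sq_nonneg (A r 0 * g.1 - A r 1 * g.2)]
  have hsplit : matForm A (v + g) v = matForm A v v + (A 0 0 * g.1 + A 0 1 * g.2) * v.1 +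
      (A 1 0 * g.1 + A 1 1 * g.2) * v.2 := by
    simp only [matForm, Prod.fst_add, Prod.snd_add]; ring
  rw [hsplit]
  set c₁ := A 0 0 * g.1 + A 0 1 * g.2
  set c₂ := A 1 0 * g.1 + A 1 1 * g.2
  have hc₁ : c₁ ^ 2 ≤ 2 * β ^ 2 * (g.1 ^ 2 + g.2 ^ 2) := hc 0
  have hc₂ : c₂ ^ 2 ≤ 2 * β ^ 2 * (g.1 ^ 2 + g.2 ^ 2) := hc 1
  set F := matForm A v v
  -- Coercivity supplies `4 s|v|²` for `v = e - g`: one share absorbs the cross term with `g`, one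
  -- the moments, and two pass from `v` back to `e`.
  have y : ∀ c v : ℝ, -(4 / α * (c * v)) ≤ v ^ 2 + 4 / α ^ 2 * c ^ 2 := fun c v => by
    have : v ^ 2 + 4 / α ^ 2 * c ^ 2 + 4 / α * (c * v) = (v + 2 / α * c) ^ 2 := by ring
    linarith [sq_nonneg (v + 2 / α * c)]
  have z : ∀ t v : ℝ, 4 / α * (v * t) ≤ s * v ^ 2 + 4 / α ^ 2 * (t ^ 2 / s) := fun t v => by
    have : s * v ^ 2 + 4 / α ^ 2 * (t ^ 2 / s) - 4 / α * (v * t) =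
        s * (v - 2 / α * (t / s)) ^ 2 := by
      field_simp; ring
    linarith [mul_nonneg hs.le (sq_nonneg (v - 2 / α * (t / s)))]
  have y1 := mul_le_mul_of_nonneg_left (y c₁ v.1) hs.le
  have y2 := mul_le_mul_of_nonneg_left (y c₂ v.2) hs.le
  have z1 := z t₁ v.1
  have z2 := z t₂ v.2
  have hF : 4 * (s * (v.1 ^ 2 + v.2 ^ 2)) ≤ 4 / α * (s * F) := by
    have : 4 * (s * (v.1 ^ 2 + v.2 ^ 2)) = 4 / α * (s * (α * (v.1 ^ 2 + v.2 ^ 2))) := by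
      field_simp
    rw [this]
    gcongr
  have hS : -(4 / α * (σ * (l * (l - l')) - σ * (l - l') * R)) ≤ σ / α * (R - l') ^ 2 := by
    -- Only `R - l'` survives the square: the residual counts only up to the defect of the
    -- approximation.
    have : σ / α * (R - l') ^ 2 + 4 / α * (σ * (l * (l - l')) - σ * (l - l') * R) =
        σ / α * (2 * (l - l') - (R - l')) ^ 2 := by ring
    have h2 : 0 ≤ σ / α * (2 * (l - l') - (R - l')) ^ 2 := by positivity
    linarith
  have hC : 4 / α ^ 2 * (s * (c₁ ^ 2 + c₂ ^ 2)) ≤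
      4 / α ^ 2 * (s * (4 * β ^ 2 * (g.1 ^ 2 + g.2 ^ 2))) := by
    gcongr
    linarith
  have hg1 := mul_le_mul_of_nonneg_left (add_sq_le (a := v.1) (b := g.1)) hs.le
  have hg2 := mul_le_mul_of_nonneg_left (add_sq_le (a := v.2) (b := g.2)) hs.le
  have e1 : 16 * β ^ 2 / α ^ 2 * (s * (g.1 ^ 2 + g.2 ^ 2)) =
    4 / α ^ 2 * (s * (4 * β ^ 2 * (g.1 ^ 2 + g.2 ^ 2))) := by ring
  have e2 : (t₁ ^ 2 + t₂ ^ 2) / s = t₁ ^ 2 / s + t₂ ^ 2 / s := add_div _ _ _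
  rw [e2, add_mul _ 2, e1]
  simp only [Prod.fst_add, Prod.snd_add]
  linarith

namespace RectMesh

variable {M : RectMesh}

/-! ### The correction of the error -/

theorem weight_pos (T : M.Cell) : 0 < M.weight T := by
  have hx := M.hx_pos T
  have hy := M.hy_pos T
  unfold weight
  positivity

theorem weight_le (T : M.Cell) : M.weight T ≤ M.h / 2 := by
  have hx := M.hx_pos T
  have hy := M.hy_pos T
  have h1 := (hx_le_diam T).trans (M.diam_le_h T)
  unfold weight
  rw [div_le_div_iff₀ (by positivity) two_pos]
  nlinarith

/-- The function on the edges with the given values on the vertical and horizontal edges. -/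
def edgeFun (dv : Fin (M.n + 1) → Fin M.m → ℝ) (dh : Fin (M.m + 1) → Fin M.n → ℝ) : Edge M → ℝ
  | .vert i j => dv i j
  | .horiz i j => dh j i

theorem edgeFun_eq_zero {dv : Fin (M.n + 1) → Fin M.m → ℝ} {dh : Fin (M.m + 1) → Fin M.n → ℝ}
    (hv0 : dv 0 = 0) (hvl : dv (Fin.last M.n) = 0) (hh0 : dh 0 = 0) (hhl : dh (Fin.last M.m) = 0)
    (e : Edge M) (he : M.OnBoundary e) : edgeFun dv dh e = 0 := by
  cases e with
  | vert i j =>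
    rcases he with rfl | rfl
    · exact congrFun hv0 j
    · exact congrFun hvl j
  | horiz i j =>
    rcases he with rfl | rfl
    · exact congrFun hh0 i
    · exact congrFun hhl i

/-- The bound for the deviation of the defect of `d` and the discrete gradient of `d`. -/
theorem sq_le_of_sides {k h : ℝ} (hk : 0 < k) (H : M.QuasiUniform k h) (T : M.Cell)
    (d : Edge M → ℝ) (X Y r : ℝ) :
    (X - Y + r - M.defect d T) ^ 2 ≤
      8 * (((d (M.side T 0) + Y / 2) ^ 2 + (d (M.side T 1) + Y / 2) ^ 2) +
        ((d (M.side T 2) + X / 2) ^ 2 + (d (M.side T 3) + X / 2) ^ 2)) + 2 * r ^ 2 ∧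
    M.hx T * M.hy T *
      (((M.leastSquares d).weakGrad T).1 ^ 2 + ((M.leastSquares d).weakGrad T).2 ^ 2) ≤
      2 / k * (((d (M.side T 0) + Y / 2) ^ 2 + (d (M.side T 1) + Y / 2) ^ 2) +
        ((d (M.side T 2) + X / 2) ^ 2 + (d (M.side T 3) + X / 2) ^ 2)) := by
  have hx := M.hx_pos T
  have hy := M.hy_pos T
  constructor
  · unfold defect
    set a := d (M.side T 0) + Y / 2 with ha
    set b := d (M.side T 1) + Y / 2 with hb
    set e := d (M.side T 2) + X / 2 with he
    set f := d (M.side T 3) + X / 2 with hf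
    have : X - Y + r - (d (M.side T 0) + d (M.side T 1) - d (M.side T 2) - d (M.side T 3)) =
        r - (a + b - e - f) := by rw [ha, hb, he, hf]; ring
    rw [this]
    nlinarith [sq_nonneg (r + (a + b - e - f)), sq_nonneg (a - b), sq_nonneg (a + e),
      sq_nonneg (a + f), sq_nonneg (b + e), sq_nonneg (b + f), sq_nonneg (e - f)]
  · rw [weakGrad_leastSquares]
    have h1 : M.hy T / M.hx T ≤ 1 / k := by
      rw [div_le_div_iff₀ hx hk]
      nlinarith [(H T).1.1, (H T).2.2]
    have h2 : M.hx T / M.hy T ≤ 1 / k := by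
      rw [div_le_div_iff₀ hy hk]
      nlinarith [(H T).2.1, (H T).1.2]
    have e1 : M.hx T * M.hy T * (((d (M.side T 1) - d (M.side T 0)) / M.hx T) ^ 2 +
        ((d (M.side T 3) - d (M.side T 2)) / M.hy T) ^ 2) =
        M.hy T / M.hx T * (d (M.side T 1) - d (M.side T 0)) ^ 2 +
        M.hx T / M.hy T * (d (M.side T 3) - d (M.side T 2)) ^ 2 := by field_simp
    change M.hx T * M.hy T * (((d (M.side T 1) - d (M.side T 0)) / M.hx T) ^ 2 +
        ((d (M.side T 3) - d (M.side T 2)) / M.hy T) ^ 2) ≤ _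
    rw [e1]
    have h3 := mul_le_mul_of_nonneg_right h1 (sq_nonneg (d (M.side T 1) - d (M.side T 0)))
    have h4 := mul_le_mul_of_nonneg_right h2 (sq_nonneg (d (M.side T 3) - d (M.side T 2)))
    -- The shift `c`, common to two opposite sides, drops out of their difference.
    have y : ∀ a b c : ℝ, 1 / k * (b - a) ^ 2 ≤ 2 / k * ((a + c) ^ 2 + (b + c) ^ 2) := by
      intro a b c
      have : 2 / k * ((a + c) ^ 2 + (b + c) ^ 2) - 1 / k * (b - a) ^ 2 =
        1 / k * ((a + c) + (b + c)) ^ 2 := by ring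
      have h5 : 0 ≤ 1 / k * ((a + c) + (b + c)) ^ 2 := by positivity
      linarith
    have h5 := y (d (M.side T 0)) (d (M.side T 1)) (Y / 2)
    have h6 := y (d (M.side T 2)) (d (M.side T 3)) (X / 2)
    rw [mul_add]
    linarith

end RectMesh

namespace RectMesh

variable {M : RectMesh}

theorem abs_mul_entry_le {h l ρ β x : ℝ} (hl : 0 < l) (hlh : l ≤ h) (hρ : 0 < ρ) (hx : |x| ≤ β) :
    |l ^ 2 / 6 - h / ρ * l * x| ≤ (1 + β / ρ) * h ^ 2 ∧
      |-(h / ρ * l * x)| ≤ (1 + β / ρ) * h ^ 2 := by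
  have hβ : 0 ≤ β := (abs_nonneg x).trans hx
  have hh : 0 < h := hl.trans_le hlh
  have h1 : |h / ρ * l * x| ≤ β / ρ * h ^ 2 := by
    rw [abs_mul, abs_of_pos (by positivity)]
    calc h / ρ * l * |x| ≤ h / ρ * h * β := by gcongr
      _ = β / ρ * h ^ 2 := by ring
  have h2 : l ^ 2 ≤ h ^ 2 := by gcongr
  have h3 : 0 ≤ h ^ 2 := sq_nonneg h
  constructor
  · refine (abs_sub _ _).trans ?_
    rw [abs_of_nonneg (by positivity : 0 ≤ l ^ 2 / 6)]
    linarith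
  · rw [abs_neg]
    linarith

/-- The leading term of the defect of `Q_b u` that is carried by the horizontal edges. -/
noncomputable def leadX (M : RectMesh) (ρ : ℝ) (A : M.Cell → Matrix (Fin 2) (Fin 2) ℝ)
    (u : ℝ × ℝ → ℝ) (T : M.Cell) : ℝ :=
  (M.hx T ^ 2 / 6 - M.h / ρ * M.hx T * A T 0 0) * M.mean (weakDeriv Ω 2 0 u) T +
    -(M.h / ρ * M.hx T * A T 0 1) * M.mean (weakDeriv Ω 1 1 u) T

/-- The leading term of the defect of `Q_b u` that is carried by the vertical edges. -/
noncomputable def leadY (M : RectMesh) (ρ : ℝ) (A : M.Cell → Matrix (Fin 2) (Fin 2) ℝ)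
    (u : ℝ × ℝ → ℝ) (T : M.Cell) : ℝ :=
  (M.hy T ^ 2 / 6 - M.h / ρ * M.hy T * A T 1 1) * M.mean (weakDeriv Ω 0 2 u) T +
    -(M.h / ρ * M.hy T * A T 1 0) * M.mean (weakDeriv Ω 1 1 u) T

open Classical in
/-- A function on the edges that vanishes on `∂Ω` and compensates for the leading terms. -/
theorem exists_correction {k β ρ : ℝ} (hk : 0 < k) (hρ : 0 < ρ) (H : M.QuasiUniform k M.h)
    {a : ℝ × ℝ → Matrix (Fin 2) (Fin 2) ℝ} {A : M.Cell → Matrix (Fin 2) (Fin 2) ℝ}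
    (hA : M.HasValues a A) (hβ : ∀ T r s, |A T r s| ≤ β) {M₀ : RectMesh}
    {A₀ : M₀.Cell → Matrix (Fin 2) (Fin 2) ℝ} (hA₀ : M₀.HasValues a A₀) {u : ℝ × ℝ → ℝ}
    (hu : MemSobolev Ω 3 u) :
    ∃ d : Edge M → ℝ, (∀ e, M.OnBoundary e → d e = 0) ∧
      ∑ T : M.Cell, (((d (M.side T 0) + M.leadY ρ A u T / 2) ^ 2 +
          (d (M.side T 1) + M.leadY ρ A u T / 2) ^ 2) +
        ((d (M.side T 2) + M.leadX ρ A u T / 2) ^ 2 +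
          (d (M.side T 3) + M.leadX ρ A u T / 2) ^ 2)) ≤
      4 * ((72 * (M₀.n + 1) + 16) + (72 * (M₀.m + 1) + 16)) * (1 + β / ρ) ^ 2 / k * M.h ^ 3 *
        sobolevNorm Ω 3 u ^ 2 := by
  obtain ⟨dv, hv0, hvl, hv⟩ := exists_vert_correction hk M.h_pos M.h_le_two H
    (bad := fun l => M.x l ∈ range M₀.x) ⟨0, by rw [M.x_first, M₀.x_first]⟩
    ⟨Fin.last _, by rw [M.x_last, M₀.x_last]⟩ (sum_mem_range_le M M₀)
    (hu.memLp (by norm_num : 0 + 2 ≤ 3)) (hu.hasWeakDeriv_x (by norm_num))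
    (hu.memLp (by norm_num : 1 + 1 ≤ 3)) (hu.hasWeakDeriv_x (by norm_num))
    (c₁ := fun T => M.hy T ^ 2 / 6 - M.h / ρ * M.hy T * A T 1 1)
    (c₂ := fun T => -(M.h / ρ * M.hy T * A T 1 0)) (K := 1 + β / ρ)
    (fun T => (abs_mul_entry_le (M.hy_pos T) (H T).2.2 hρ (hβ T 1 1)).1)
    (fun T => (abs_mul_entry_le (M.hy_pos T) (H T).2.2 hρ (hβ T 1 0)).2)
    -- Cells of one row share their height, and across a good line the tensor does not change, so
    -- the coefficients of `leadY` agree. For the same reason `leadX`, with its factor `hx`, is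
    -- carried by the horizontal edges.
    (fun i i' j hi hb => by
      simp only [eq_of_notMem_range hA hA₀ hi hb j, show M.hy (i, j) = M.hy (i', j) from rfl,
        and_self])
  obtain ⟨dh, hh0, hhl, hh⟩ := exists_vert_correction (M := M.swap) hk M.h_pos M.h_le_two H.swap
    (bad := fun l => M.swap.x l ∈ range M₀.swap.x)
    ⟨0, M₀.swap.x_first.trans M.swap.x_first.symm⟩
    ⟨Fin.last _, M₀.swap.x_last.trans M.swap.x_last.symm⟩ (sum_mem_range_le M.swap M₀.swap)
    (memLp_rect_swap (hu.memLp (by norm_num : 2 + 0 ≤ 3))) (hu.hasWeakDeriv_y (by norm_num)).swap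
    (memLp_rect_swap (hu.memLp (by norm_num : 1 + 1 ≤ 3))) (hu.hasWeakDeriv_y (by norm_num)).swap
    (c₁ := fun T => M.hx T.swap ^ 2 / 6 - M.h / ρ * M.hx T.swap * A T.swap 0 0)
    (c₂ := fun T => -(M.h / ρ * M.hx T.swap * A T.swap 0 1)) (K := 1 + β / ρ)
    (fun T => (abs_mul_entry_le (M.hx_pos T.swap) (H T.swap).1.2 hρ (hβ T.swap 0 0)).1)
    (fun T => (abs_mul_entry_le (M.hx_pos T.swap) (H T.swap).1.2 hρ (hβ T.swap 0 1)).2)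
    (fun i i' j hi hb => by
      have h1 : A (j, i) = A (j, i') := eq_of_notMem_range hA.swap hA₀.swap hi hb j
      exact ⟨congrArg (fun B => M.hx (j, i) ^ 2 / 6 - M.h / ρ * M.hx (j, i) * B 0 0) h1,
        congrArg (fun B => -(M.h / ρ * M.hx (j, i) * B 0 1)) h1⟩)
  refine ⟨edgeFun dv dh, edgeFun_eq_zero hv0 hvl hh0 hhl, ?_⟩
  have e1 : ∀ w : ℝ × ℝ → ℝ, ∫ p in Ω, w p.swap ^ 2 = ∫ p in Ω, w p ^ 2 :=
    fun w => integral_rect_swap 0 1 0 1 fun p => w p ^ 2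
  have e2 : ∀ (w : ℝ × ℝ → ℝ) (T : M.swap.Cell), M.swap.mean (fun p => w p.swap) T =
    M.mean w T.swap := fun w T => M.mean_swap w T.swap
  simp only [e1, e2] at hh
  have hh := (M.sum_swap fun T => (dh T.2.castSucc T.1 + M.leadX ρ A u T / 2) ^ 2 +
    (dh T.2.succ T.1 + M.leadX ρ A u T / 2) ^ 2).symm.trans_le hh
  rw [Finset.sum_add_distrib]
  refine (add_le_add hv hh).trans ?_
  have hS : ∀ i j, i + j ≤ 3 → ∫ p in Ω, weakDeriv Ω i j u p ^ 2 ≤ sobolevNorm Ω 3 u ^ 2 :=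
    fun i j h => integral_sq_weakDeriv_le Ω u h
  have c : ∀ n : ℕ, 0 ≤ (72 * ((n : ℝ) + 1) + 16) * (1 + β / ρ) ^ 2 / k * M.h ^ 3 := fun n => by
    have := M.h_pos
    positivity
  have c1 := mul_le_mul_of_nonneg_left (add_le_add
    (add_le_add (hS 0 2 (by norm_num)) (hS 1 2 (by norm_num)))
    (add_le_add (hS 1 1 (by norm_num)) (hS 2 1 (by norm_num)))) (c M₀.n)
  have c2 := mul_le_mul_of_nonneg_left (add_le_add
    (add_le_add (hS 2 0 (by norm_num)) (hS 2 1 (by norm_num)))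
    (add_le_add (hS 1 1 (by norm_num)) (hS 1 2 (by norm_num)))) (c M₀.m)
  refine (add_le_add c1 c2).trans (le_of_eq ?_)
  ring

/-! ### The error equation -/

theorem HasValues.energy_eq {a : ℝ × ℝ → Matrix (Fin 2) (Fin 2) ℝ}
    {A : M.Cell → Matrix (Fin 2) (Fin 2) ℝ} (hA : M.HasValues a A) (w v : WeakFun M) :
    WeakFun.energy a w v =
      ∑ T : M.Cell, M.hx T * M.hy T * matForm (A T) (w.weakGrad T) (v.weakGrad T) := by
  refine Finset.sum_congr rfl fun T _ => ?_
  rw [setIntegral_congr_fun (g := fun _ => matForm (A T) (w.weakGrad T) (v.weakGrad T))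
    (M.measurableSet_cell T) fun p hp => by simp only [hA T p hp], setIntegral_const,
    M.volume_real_cell, smul_eq_mul]

/-- The scheme is tested with the least squares extension of `e_b - d`. The defect terms of the load
merge with the defect of `Q_b u` into the residual, which explains the factor `h/ρ` in `leadX` and
`leadY`. -/
theorem sum_error_eq_zero {a : ℝ × ℝ → Matrix (Fin 2) (Fin 2) ℝ}
    {A : M.Cell → Matrix (Fin 2) (Fin 2) ℝ} (hA : M.HasValues a A) {ρ : ℝ} (hρ : 0 < ρ)
    {f g u γ : ℝ × ℝ → ℝ} (hf : MemLp f 2 (volume.restrict Ω)) (hu : MemSobolev Ω 3 u)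
    (hsol : IsSolution a f g u) (hγ : M.IsEdgeTrace u γ) {uh : WeakFun M}
    (huh : uh.IsWGSolution a ρ f g) {d : Edge M → ℝ} (hd : ∀ e, M.OnBoundary e → d e = 0) :
    ∑ T : M.Cell,
      (M.hx T * M.hy T * matForm (A T) ((WeakFun.error γ uh).weakGrad T)
        ((WeakFun.error γ uh).weakGrad T - (M.leastSquares d).weakGrad T) +
      ρ * M.h⁻¹ * M.weight T * (M.defect (WeakFun.error γ uh).bdry T *
        (M.defect (WeakFun.error γ uh).bdry T - M.defect d T)) -
      ρ * M.h⁻¹ * M.weight T * (M.defect (WeakFun.error γ uh).bdry T - M.defect d T) *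
        (M.leadX ρ A u T - M.leadY ρ A u T + (M.defect (M.Qb γ) T -
          (M.hx T ^ 2 / 6 * M.mean (weakDeriv Ω 2 0 u) T -
            M.hy T ^ 2 / 6 * M.mean (weakDeriv Ω 0 2 u) T))) -
      ((WeakFun.error γ uh).weakGrad T - (M.leastSquares d).weakGrad T).1 *
        (∫ p in M.cell T, (a p 1 0 * weakDeriv Ω 1 1 u p + a p 1 1 * weakDeriv Ω 0 2 u p) *
          (p.1 - (M.x T.1.castSucc + M.x T.1.succ) / 2)) -
      ((WeakFun.error γ uh).weakGrad T - (M.leastSquares d).weakGrad T).2 *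
        (∫ p in M.cell T, (a p 0 0 * weakDeriv Ω 2 0 u p + a p 0 1 * weakDeriv Ω 1 1 u p) *
          (p.2 - (M.y T.2.castSucc + M.y T.2.succ) / 2))) = 0 := by
  have m₁₀ := hu.memLp (i := 1) (j := 0) (by norm_num)
  have m₀₁ := hu.memLp (i := 0) (j := 1) (by norm_num)
  have m₂₀ := hu.memLp (i := 2) (j := 0) (by norm_num)
  have m₁₁ := hu.memLp (i := 1) (j := 1) (by norm_num)
  have m₀₂ := hu.memLp (i := 0) (j := 2) (by norm_num)
  have hui : IntegrableOn u Ω := integrableOn_of_memLp hu.1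
  have hγ' : M.IsEdgeTraceOf u (weakDeriv Ω 1 0 u) (weakDeriv Ω 0 1 u) γ := hγ
  set b : Edge M → ℝ := fun e => (WeakFun.error γ uh).bdry e - d e with hb
  -- Admissible as a test function: `Q_b u` and `Q_b g` agree on boundary edges.
  have hb0 : ∀ e, M.OnBoundary e → b e = 0 := fun e he => by
    have h1 := hγ'.Qb_eq_of_onBoundary hsol.2.2 hu.1 (weakDeriv_spec hu (by norm_num))
      (weakDeriv_spec hu (by norm_num)) e he
    simp only [hb, WeakFun.error, hd e he, h1, huh.1 e he, sub_self]
  have hE := huh.2 (M.leastSquares b) hb0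
  rw [hA.energy_eq, stab_leastSquares, Finset.mul_sum, ← Finset.sum_add_distrib,
    (isFlux_of_isSolution hA hf m₁₀ m₀₁ (hu.hasWeakDeriv_x (by norm_num))
      (hu.hasWeakDeriv_y (by norm_num)) (hu.hasWeakDeriv_x (by norm_num))
      (hu.hasWeakDeriv_y (by norm_num)) hsol.2.1).load_leastSquares b hb0, eq_comm,
    ← sub_eq_zero, ← Finset.sum_sub_distrib] at hE
  rw [← hE]
  refine Finset.sum_congr rfl fun T _ => ?_
  rw [hA.integral_add T 0 m₁₀ m₀₁, hA.integral_add T 1 m₁₀ m₀₁, hA.integral_add T 0 m₂₀ m₁₁,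
    hA.integral_add T 1 m₁₁ m₀₂, ← hγ'.Qb_sub_Qb_vert hui (integrableOn_of_memLp m₁₀) T,
    ← hγ'.Qb_sub_Qb_horiz hui (integrableOn_of_memLp m₀₁) T]
  have e1 : (WeakFun.error γ uh).weakGrad T - (M.leastSquares d).weakGrad T =
      (M.leastSquares b).weakGrad T := by
    rw [weakGrad_leastSquares, weakGrad_leastSquares]
    refine Prod.ext ?_ ?_
    · simp only [WeakFun.weakGrad, Prod.fst_sub, hb]; ring
    · simp only [WeakFun.weakGrad, Prod.snd_sub, hb]; ring
  have e2 : (WeakFun.error γ uh).weakGrad T =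
      ((M.Qb γ (M.side T 1) - M.Qb γ (M.side T 0)) / M.hx T - (uh.weakGrad T).1,
        (M.Qb γ (M.side T 3) - M.Qb γ (M.side T 2)) / M.hy T - (uh.weakGrad T).2) := by
    refine Prod.ext ?_ ?_
    · simp only [WeakFun.weakGrad, WeakFun.error]; ring
    · simp only [WeakFun.weakGrad, WeakFun.error]; ring
  have e3 : M.defect (WeakFun.error γ uh).bdry T = M.defect (M.Qb γ) T - M.defect uh.bdry T := by
    simp only [defect, WeakFun.error]; ring
  have e4 : M.defect (WeakFun.error γ uh).bdry T - M.defect d T = M.defect b T := by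
    simp only [defect, hb]; ring
  rw [e1, e4, e2, e3]
  simp only [matForm, leadX, leadY]
  generalize (∫ p in M.cell T, _ * (p.1 - _)) = t₁
  generalize (∫ p in M.cell T, _ * (p.2 - _)) = t₂
  have hx := (M.hx_pos T).ne'
  have hy := (M.hy_pos T).ne'
  have hh := M.h_pos.ne'
  have hr := hρ.ne'
  field_simp
  ring

end RectMesh

namespace RectMesh

variable {M : RectMesh}

/-! ### The error estimate -/

theorem cell_nonempty (T : M.Cell) : (M.cell T).Nonempty :=
  (nonempty_Ioo.2 (M.x_lt T.1)).prod (nonempty_Ioo.2 (M.y_lt T.2))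

theorem gradNorm_eq_sqrt (v : WeakFun M) : v.gradNorm =
    Real.sqrt (∑ T : M.Cell, M.hx T * M.hy T * ((v.weakGrad T).1 ^ 2 + (v.weakGrad T).2 ^ 2)) := by
  simp only [WeakFun.gradNorm, setIntegral_const, M.volume_real_cell, smul_eq_mul]

/-- Each second derivative is differentiated once more in the direction of its moment, so only the
mixed third derivatives appear. -/
theorem HasValues.sq_moments_le {k h β : ℝ} (H : M.QuasiUniform k h)
    {a : ℝ × ℝ → Matrix (Fin 2) (Fin 2) ℝ} {A : M.Cell → Matrix (Fin 2) (Fin 2) ℝ}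
    (hA : M.HasValues a A) (hβ : ∀ T r s, |A T r s| ≤ β) {u : ℝ × ℝ → ℝ} (hu : MemSobolev Ω 3 u)
    (T : M.Cell) :
    ((∫ p in M.cell T, (a p 1 0 * weakDeriv Ω 1 1 u p + a p 1 1 * weakDeriv Ω 0 2 u p) *
        (p.1 - (M.x T.1.castSucc + M.x T.1.succ) / 2)) ^ 2 +
      (∫ p in M.cell T, (a p 0 0 * weakDeriv Ω 2 0 u p + a p 0 1 * weakDeriv Ω 1 1 u p) *
        (p.2 - (M.y T.2.castSucc + M.y T.2.succ) / 2)) ^ 2) / (M.hx T * M.hy T) ≤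
      4 * β ^ 2 * h ^ 4 * ((∫ p in M.cell T, weakDeriv Ω 2 1 u p ^ 2) +
        ∫ p in M.cell T, weakDeriv Ω 1 2 u p ^ 2) := by
  have h1 := hA.sq_integral_mul_sub_mid_le H T 1 (hβ T 1)
    (hu.memLp (by norm_num : 1 + 1 ≤ 3)) (hu.hasWeakDeriv_x (by norm_num))
    (hu.memLp (by norm_num : 0 + 2 ≤ 3)) (hu.hasWeakDeriv_x (by norm_num))
  have h2 := hA.swap.sq_integral_mul_sub_mid_le H.swap T.swap 0 (hβ T 0)
    (memLp_rect_swap (hu.memLp (by norm_num : 2 + 0 ≤ 3))) (hu.hasWeakDeriv_y (by norm_num)).swap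
    (memLp_rect_swap (hu.memLp (by norm_num : 1 + 1 ≤ 3))) (hu.hasWeakDeriv_y (by norm_num)).swap
  rw [M.integral_cell_swap T fun p => weakDeriv Ω 2 (0 + 1) u p ^ 2,
    M.integral_cell_swap T fun p => weakDeriv Ω 1 (1 + 1) u p ^ 2] at h2
  have e1 := M.integral_cell_swap T fun p =>
    (a p 0 0 * weakDeriv Ω 2 0 u p + a p 0 1 * weakDeriv Ω 1 1 u p) *
        (p.2 - (M.y T.2.castSucc + M.y T.2.succ) / 2)
  have h2 : (∫ p in M.cell T, (a p 0 0 * weakDeriv Ω 2 0 u p + a p 0 1 * weakDeriv Ω 1 1 u p) *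
      (p.2 - (M.y T.2.castSucc + M.y T.2.succ) / 2)) ^ 2 ≤
      2 * β ^ 2 * h ^ 4 * (M.hy T * M.hx T) * ((∫ p in M.cell T, weakDeriv Ω 2 1 u p ^ 2) +
        ∫ p in M.cell T, weakDeriv Ω 1 2 u p ^ 2) := by
    rw [← e1]
    exact h2
  rw [div_le_iff₀ (mul_pos (M.hx_pos T) (M.hy_pos T))]
  refine (add_le_add h1 h2).trans (le_of_eq ?_)
  ring

/-- The error estimate with explicit constants, for tensors that are also constant in each element
of the fixed partition `M₀`. -/
theorem gradNorm_error_le {k α β ρ : ℝ} (hk : 0 < k) (hα : 0 < α) (hρ : 0 < ρ)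
    (H : M.QuasiUniform k M.h) {a : ℝ × ℝ → Matrix (Fin 2) (Fin 2) ℝ}
    {A : M.Cell → Matrix (Fin 2) (Fin 2) ℝ} (hA : M.HasValues a A)
    (hAα : ∀ T, ∀ ξ : ℝ × ℝ, α * (ξ.1 ^ 2 + ξ.2 ^ 2) ≤ matForm (A T) ξ ξ)
    (hβ : ∀ T r s, |A T r s| ≤ β) {M₀ : RectMesh} {A₀ : M₀.Cell → Matrix (Fin 2) (Fin 2) ℝ}
    (hA₀ : M₀.HasValues a A₀) {f g u γ : ℝ × ℝ → ℝ} (hf : MemLp f 2 (volume.restrict Ω))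
    (hu : MemSobolev Ω 3 u) (hsol : IsSolution a f g u) (hγ : M.IsEdgeTrace u γ) {uh : WeakFun M}
    (huh : uh.IsWGSolution a ρ f g) :
    ∑ T : M.Cell, M.hx T * M.hy T * (((WeakFun.error γ uh).weakGrad T).1 ^ 2 +
        ((WeakFun.error γ uh).weakGrad T).2 ^ 2) ≤
      ((4 * ρ / α + (16 * β ^ 2 / α ^ 2 + 2) * (2 / k)) *
          (4 * ((72 * (M₀.n + 1) + 16) + (72 * (M₀.m + 1) + 16)) * (1 + β / ρ) ^ 2 / k) +
        8 * (8 * ρ / (α * k) + 16 * β ^ 2 / α ^ 2)) * (M.h ^ 3 * sobolevNorm Ω 3 u ^ 2) := by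
  have hh := M.h_pos
  obtain ⟨d, hd, hV⟩ := exists_correction hk hρ H hA hβ hA₀ hu
  have h0 := sum_error_eq_zero hA hρ hf hu hsol hγ huh hd
  set V : M.Cell → ℝ := fun T => ((d (M.side T 0) + M.leadY ρ A u T / 2) ^ 2 +
      (d (M.side T 1) + M.leadY ρ A u T / 2) ^ 2) +
    ((d (M.side T 2) + M.leadX ρ A u T / 2) ^ 2 + (d (M.side T 3) + M.leadX ρ A u T / 2) ^ 2)
    with hVd
  set E : M.Cell → ℝ := fun T => ((∫ p in M.cell T, weakDeriv Ω 3 0 u p ^ 2) +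
      ∫ p in M.cell T, weakDeriv Ω 0 3 u p ^ 2) + ((∫ p in M.cell T, weakDeriv Ω 2 1 u p ^ 2) +
      ∫ p in M.cell T, weakDeriv Ω 1 2 u p ^ 2) with hE
  set P := 4 * ρ / α + (16 * β ^ 2 / α ^ 2 + 2) * (2 / k) with hP
  set Q := 8 * ρ / (α * k) + 16 * β ^ 2 / α ^ 2 with hQ
  have hP0 : 0 ≤ P := by positivity
  have hQ0 : 0 ≤ Q := by positivity
  have hEsum : ∑ T, E T ≤ 4 * sobolevNorm Ω 3 u ^ 2 := by
    have hi : ∀ i j, i + j ≤ 3 → ∑ T : M.Cell, ∫ p in M.cell T, weakDeriv Ω i j u p ^ 2 ≤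
        sobolevNorm Ω 3 u ^ 2 := fun i j h => by
      rw [M.sum_cells (hu.memLp h).integrable_sq]
      exact integral_sq_weakDeriv_le Ω u h
    simp only [hE, Finset.sum_add_distrib]
    linarith [hi 3 0 (by norm_num), hi 0 3 (by norm_num), hi 2 1 (by norm_num),
      hi 1 2 (by norm_num)]
  -- `I T` is the contribution of `T` to the error equation. It has no sign on a single cell and
  -- disappears only after summation.
  obtain ⟨I, hI, hcell⟩ : ∃ I : M.Cell → ℝ, ∑ T, I T = 0 ∧ ∀ T : M.Cell,
      M.hx T * M.hy T * (((WeakFun.error γ uh).weakGrad T).1 ^ 2 +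
        ((WeakFun.error γ uh).weakGrad T).2 ^ 2) ≤
      4 / α * I T + (P * V T + Q * M.h ^ 4 * E T) := by
    refine ⟨_, h0, fun T => ?_⟩
    have hσ : 0 ≤ ρ * M.h⁻¹ * M.weight T := by
      have := M.weight_pos T
      positivity
    -- The weight is at most `h/2`, which cancels the factor `h⁻¹` of the stabilizer.
    have hσ2 : ρ * M.h⁻¹ * M.weight T ≤ ρ / 2 := by
      calc ρ * M.h⁻¹ * M.weight T ≤ ρ * M.h⁻¹ * (M.h / 2) := by
            have := M.weight_le T
            gcongr
        _ = ρ / 2 := by field_simp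
    refine (sq_le_of_energy hα (hAα T) (hβ T) (mul_pos (M.hx_pos T) (M.hy_pos T)) hσ
      ((WeakFun.error γ uh).weakGrad T) ((M.leastSquares d).weakGrad T)
      (M.defect (WeakFun.error γ uh).bdry T) (M.defect d T)
      (M.leadX ρ A u T - M.leadY ρ A u T + (M.defect (M.Qb γ) T -
          (M.hx T ^ 2 / 6 * M.mean (weakDeriv Ω 2 0 u) T -
            M.hy T ^ 2 / 6 * M.mean (weakDeriv Ω 0 2 u) T)))
      (∫ p in M.cell T, (a p 1 0 * weakDeriv Ω 1 1 u p + a p 1 1 * weakDeriv Ω 0 2 u p) *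
          (p.1 - (M.x T.1.castSucc + M.x T.1.succ) / 2))
      (∫ p in M.cell T, (a p 0 0 * weakDeriv Ω 2 0 u p + a p 0 1 * weakDeriv Ω 1 1 u p) *
          (p.2 - (M.y T.2.castSucc + M.y T.2.succ) / 2))).trans (add_le_add_right ?_ _)
    obtain ⟨b1, b2⟩ := sq_le_of_sides hk H T d (M.leadX ρ A u T) (M.leadY ρ A u T)
      (M.defect (M.Qb γ) T - (M.hx T ^ 2 / 6 * M.mean (weakDeriv Ω 2 0 u) T -
            M.hy T ^ 2 / 6 * M.mean (weakDeriv Ω 0 2 u) T))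
    have b3 := IsEdgeTraceOf.sq_defect_Qb_sub_le hk hh H hγ (integrableOn_of_memLp hu.1)
      (hu.memLp (by norm_num)) (hu.memLp (by norm_num)) (hu.hasWeakDeriv_x (by norm_num))
      (hu.hasWeakDeriv_x (by norm_num)) (hu.hasWeakDeriv_y (by norm_num))
      (hu.hasWeakDeriv_y (by norm_num)) T
    have b4 := hA.sq_moments_le H hβ hu T
    have c1 := mul_le_mul (div_le_div_of_nonneg_right hσ2 hα.le)
      (b1.trans (add_le_add_right (mul_le_mul_of_nonneg_left b3 two_pos.le) _)) (sq_nonneg _)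
      (by positivity)
    have c2 := mul_le_mul_of_nonneg_left b4 (by positivity : 0 ≤ 4 / α ^ 2)
    have c3 := mul_le_mul_of_nonneg_left b2 (by positivity : 0 ≤ 16 * β ^ 2 / α ^ 2 + 2)
    refine (add_le_add (add_le_add c1 c2) c3).trans ?_
    have hE1 : 0 ≤ (∫ p in M.cell T, weakDeriv Ω 3 0 u p ^ 2) +
        ∫ p in M.cell T, weakDeriv Ω 0 3 u p ^ 2 := add_nonneg
      (integral_nonneg fun p => sq_nonneg _) (integral_nonneg fun p => sq_nonneg _)
    have hE2 : 0 ≤ (∫ p in M.cell T, weakDeriv Ω 2 1 u p ^ 2) +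
        ∫ p in M.cell T, weakDeriv Ω 1 2 u p ^ 2 := add_nonneg
      (integral_nonneg fun p => sq_nonneg _) (integral_nonneg fun p => sq_nonneg _)
    have q1 := mul_nonneg (by positivity : 0 ≤ 16 * β ^ 2 / α ^ 2 * M.h ^ 4) hE1
    have q2 := mul_nonneg (by positivity : 0 ≤ 8 * ρ / (α * k) * M.h ^ 4) hE2
    refine (le_add_of_nonneg_right (add_nonneg q1 q2)).trans (le_of_eq ?_)
    simp only [hVd, hE, hP, hQ]
    field_simp
    ring
  refine (Finset.sum_le_sum fun T _ => hcell T).trans ?_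
  rw [Finset.sum_add_distrib, Finset.sum_add_distrib, ← Finset.mul_sum, ← Finset.mul_sum,
    ← Finset.mul_sum, hI, mul_zero, zero_add]
  have h4 : M.h ^ 4 ≤ 2 * M.h ^ 3 := by
    have := mul_le_mul_of_nonneg_right M.h_le_two (by positivity : 0 ≤ M.h ^ 3)
    linarith [show M.h ^ 4 = M.h * M.h ^ 3 by ring]
  have f1 := mul_le_mul_of_nonneg_left hV hP0
  have f2 : Q * M.h ^ 4 * ∑ T, E T ≤ Q * (2 * M.h ^ 3) * (4 * sobolevNorm Ω 3 u ^ 2) := by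
    refine (mul_le_mul_of_nonneg_left hEsum (by positivity)).trans ?_
    gcongr
  refine (add_le_add f1 f2).trans (le_of_eq ?_)
  ring

end RectMesh

end WG

/-! ### The theorem -/

theorem mainTheorem3
    (a : ℝ × ℝ → Matrix (Fin 2) (Fin 2) ℝ) (ha : WG.IsCoefficient a)
    (ρ : ℝ) (hρ : 0 < ρ) (κ : ℝ) (hκ : 0 < κ) :
    ∃ C : ℝ, 0 < C ∧
      ∀ M : WG.RectMesh, M.ShapeRegular κ → M.PiecewiseConstant a →
      ∀ f g u : ℝ × ℝ → ℝ,
        MeasureTheory.MemLp f 2 (MeasureTheory.volume.restrict WG.Ω) →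
        WG.MemSobolev WG.Ω 3 u → WG.IsSolution a f g u →
      ∀ γ : ℝ × ℝ → ℝ, M.IsEdgeTrace u γ →
      ∀ uxx uxy uyy : ℝ × ℝ → ℝ,
        WG.IsBoundaryTrace 2 0 u uxx → WG.IsBoundaryTrace 1 1 u uxy →
        WG.IsBoundaryTrace 0 2 u uyy →
      ∀ uh : WG.WeakFun M, uh.IsWGSolution a ρ f g →
        (WG.WeakFun.error γ uh).gradNorm ≤
          C * M.h ^ (3 / 2 : ℝ) *
            (WG.sobolevNorm WG.Ω 3 u + WG.hessianBoundaryNorm uxx uxy uyy) := by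
  obtain ⟨hsymm, α, hα, β, hαβ⟩ := ha
  -- `M₀` is fixed before the mesh, so a constant built from its numbers of lines depends on `a`
  -- only. If there is no such partition, no mesh is admissible and any constant works.
  by_cases hM₀ : ∃ M₀ : WG.RectMesh, M₀.PiecewiseConstant a
  swap
  · exact ⟨1, one_pos, fun M _ hM => absurd ⟨M, hM⟩ hM₀⟩
  obtain ⟨M₀, hM₀⟩ := hM₀
  choose A₀ hA₀ using hM₀
  set C₀ := ((4 * ρ / α + (16 * β ^ 2 / α ^ 2 + 2) * (2 / κ ^ 2)) *
      (4 * ((72 * (M₀.n + 1) + 16) + (72 * (M₀.m + 1) + 16)) * (1 + β / ρ) ^ 2 / κ ^ 2) +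
    8 * (8 * ρ / (α * κ ^ 2) + 16 * β ^ 2 / α ^ 2)) with hC₀
  have hC₀0 : 0 ≤ C₀ := by positivity
  -- `C₀` bounds the square of the error; `C₀ ≤ (C₀ + 1)²` avoids a square root and the summand 1
  -- gives positivity.
  refine ⟨C₀ + 1, by linarith, ?_⟩
  intro M hreg hM f g u hf hu hsol γ hγ uxx uxy uyy _ _ _ uh huh
  choose A hA using hM
  have hval : ∀ T, (A T).IsSymm ∧ ∀ ξ : ℝ × ℝ, α * (ξ.1 ^ 2 + ξ.2 ^ 2) ≤ WG.matForm (A T) ξ ξ ∧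
      WG.matForm (A T) ξ ξ ≤ β * (ξ.1 ^ 2 + ξ.2 ^ 2) := fun T => by
    obtain ⟨p, hp⟩ := WG.RectMesh.cell_nonempty T
    rw [← hA T p hp]
    exact ⟨hsymm p (M.cell_subset T hp), hαβ p (M.cell_subset T hp)⟩
  have key := WG.RectMesh.gradNorm_error_le (by positivity) hα hρ (hreg.quasiUniform hκ) hA
    (fun T ξ => ((hval T).2 ξ).1) (fun T => WG.abs_entry_le (hval T).1 hα (hval T).2) hA₀ hf hu
    hsol hγ huh
  have hh := M.h_pos
  have hS := WG.sobolevNorm_nonneg WG.Ω 3 u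
  have hB : 0 ≤ WG.hessianBoundaryNorm uxx uxy uyy := Real.sqrt_nonneg _
  have hpow : (M.h ^ (3 / 2 : ℝ)) ^ 2 = M.h ^ 3 := by
    rw [← Real.rpow_natCast, ← Real.rpow_mul hh.le, ← Real.rpow_natCast]
    norm_num
  rw [WG.RectMesh.gradNorm_eq_sqrt]
  refine Real.sqrt_le_iff.2 ⟨by positivity, key.trans ?_⟩
  rw [mul_pow, mul_pow, hpow]
  have h1 : C₀ ≤ (C₀ + 1) ^ 2 := by nlinarith
  have h2 : M.h ^ 3 * WG.sobolevNorm WG.Ω 3 u ^ 2 ≤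
      M.h ^ 3 * (WG.sobolevNorm WG.Ω 3 u + WG.hessianBoundaryNorm uxx uxy uyy) ^ 2 := by
    gcongr
    linarith
  exact (mul_le_mul h1 h2 (by positivity) (by positivity)).trans_eq (mul_assoc _ _ _).symm
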